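/- Let $S$ be a scheme, let $T \cong \mathbb{G}_{m,S}^t$ be a split torus of rank $t \ge 0$ over $S$, and let $X$ be a quasi-compact $S$-scheme with the trivial action of $T$. Let $K_0(X)$ be the Grothendieck ring of the exact category of finite locally free $\mathcal{O}_X$-modules: it is generated by classes $[E]$ with $[E]=[E']+[E'']$ for every short exact sequence $0\to E'\to E\to E''\to 0$, and it has product $[E][F]=[E\otimes_{\mathcal{O}_X}F]$ and unit $1=[\mathcal{O}_X]$. Let $K_0^T(X)$ be the Grothendieck ring, defined in the same way, of the exact category of $T$-equivariant finite locally free $\mathcal{O}_X$-modules. Here a $T$-equivariant module is an $\mathcal{O}_X$-module $F$ with an isomorphism between its pullbacks to $T\times_S X$ along the projection and along the action map that satisfies the cocycle condition; a sequence of equivariant modules is exact if the underlying sequence of $\mathcal{O}_X$-modules is exact. For $\lambda \in \mathbb{Z}^t$ and a finite locally free $\mathcal{O}_X$-module $E$, let $E(\lambda)$ be the $T$-equivariant module with underlying module $E$ on which $T$ acts through the character $(u_1,\dots,u_t)\mapsto u_1^{\lambda_1}\cdots u_t^{\lambda_t}$, and let $e_i\in\mathbb{Z}^t$ be the $i$-th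 unit vector. Then there is an isomorphism of rings $$\frac{K_0(X)[x_1,\dots,x_t,y_1,\dots,y_t]}{(x_iy_i+x_i+y_i \mid i=1,\dots,t)} \;\cong\; K_0^T(X)$$ that sends the class $[E]\in K_0(X)$ of a finite locally free module $E$ to $[E(0)]$, that is, $E$ with the trivial equivariant structure, and sends $x_i$ to $[\mathcal{O}_X(e_i)]-1$ and $y_i$ to $[\mathcal{O}_X(-e_i)]-1$ for $i=1,\dots,t$. -/

import Mathlib

open CategoryTheory AlgebraicGeometry MonoidalCategory CartesianMonoidalCategory Opposite
open scoped MonObj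

universe u

noncomputable section

namespace EquivariantKTheory

/-! ### Modules on a scheme: structure sheaf, scalars, pulled back sections, tensor products -/

section Modules

variable {X Y Z : Scheme.{u}}

/-- The structure sheaf `𝒪_X` as a module over itself. -/
def structureSheaf (X : Scheme.{u}) : X.Modules := SheafOfModules.unit X.ringCatSheaf

/-- The section `1` of `𝒪_X`. -/
def oneSection (X : Scheme.{u}) : Γ(structureSheaf X, ⊤) := (1 : Γ(X, ⊤))

/-- `M` is finite locally free: each point has an open neighbourhood `U` such that `M|_U` is
isomorphic to `𝒪_U ^ n` for some natural number `n`. -/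
def IsFiniteLocallyFree (M : X.Modules) : Prop :=
  ∀ x : X, ∃ U : X.Opens, x ∈ U ∧ ∃ n : ℕ,
    Nonempty (M.restrict U.ι ≅
      (SheafOfModules.free (R := (U : Scheme.{u}).ringCatSheaf) (ULift.{u} (Fin n)) :
        (U : Scheme.{u}).Modules))

/-- The pullback `f^* s` of a section `s` of `M` over `U`, a section of `f^* M` over `f⁻¹ U`. -/
def pullbackSection (f : Y ⟶ X) {M : X.Modules} {U : X.Opens} (s : Γ(M, U)) :
    Γ((Scheme.Modules.pullback f).obj M, f ⁻¹ᵁ U) :=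
  ((Scheme.Modules.pullbackPushforwardAdjunction f).unit.app M).app U s

/-- An `𝒪_X`-bilinear map of sheaves `M × N → P`. -/
structure Pairing (M N P : X.Modules) where
  toFun (U : X.Opens) : Γ(M, U) →ₗ[Γ(X, U)] Γ(N, U) →ₗ[Γ(X, U)] Γ(P, U)
  map_restrict {U V : X.Opens} (i : U ⟶ V) (m : Γ(M, V)) (n : Γ(N, V)) :
    P.presheaf.map i.op (toFun V m n) =
      toFun U (M.presheaf.map i.op m) (N.presheaf.map i.op n)

/-- The bilinear map `β : M × N → P` exhibits `P` as the tensor product of `M` and `N` over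
`𝒪_X`, that is, it is the universal bilinear map. -/
def Pairing.IsTensorProduct {M N P : X.Modules} (β : Pairing M N P) : Prop :=
  ∀ (Q : X.Modules) (β' : Pairing M N Q), ∃! h : P ⟶ Q,
    ∀ (U : X.Opens) (m : Γ(M, U)) (n : Γ(N, U)), h.app U (β.toFun U m n) = β'.toFun U m n

/-- `β'` is the (unique) bilinear map `f^* M × f^* N → f^* P` induced by `β : M × N → P`. -/
def Pairing.IsPullback (f : Y ⟶ X) {M N P : X.Modules} (β : Pairing M N P)
    (β' : Pairing ((Scheme.Modules.pullback f).obj M) ((Scheme.Modules.pullback f).obj N)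
      ((Scheme.Modules.pullback f).obj P)) : Prop :=
  ∀ (U : X.Opens) (m : Γ(M, U)) (n : Γ(N, U)),
    β'.toFun (f ⁻¹ᵁ U) (pullbackSection f m) (pullbackSection f n) =
      pullbackSection f (β.toFun U m n)

/-- Given `φ : f^* M ≅ g^* M` on `Y` and `k : Z ⟶ Y`, the isomorphism `f'^* M ≅ g'^* M` on `Z`
obtained from `k^* φ`, where `f' = f ∘ k` and `g' = g ∘ k`. -/
def baseChange (k : Z ⟶ Y) {f g : Y ⟶ X} {f' g' : Z ⟶ X} (hf : k ≫ f = f') (hg : k ≫ g = g')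
    {M : X.Modules}
    (φ : (Scheme.Modules.pullback f).obj M ≅ (Scheme.Modules.pullback g).obj M) :
    (Scheme.Modules.pullback f').obj M ≅ (Scheme.Modules.pullback g').obj M :=
  (Scheme.Modules.pullbackCongr hf).symm.app M ≪≫
    (Scheme.Modules.pullbackComp k f).symm.app M ≪≫
    (Scheme.Modules.pullback k).mapIso φ ≪≫
    (Scheme.Modules.pullbackComp k g).app M ≪≫
    (Scheme.Modules.pullbackCongr hg).app M

/-- Multiplication by a global function `r` on an `𝒪_X`-module. -/
def scalar (M : X.Modules) (r : Γ(X, ⊤)) : M ⟶ M :=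
  ⟨PresheafOfModules.homMk (M₁ := M.val) (M₂ := M.val)
    { app := fun U => M.smul (X.presheaf.map (homOfLE (le_top : U.unop ≤ ⊤)).op r)
      naturality := by
        intro U V i
        have h := M.map_comp_smul i.unop (X.presheaf.map (homOfLE (le_top : U.unop ≤ ⊤)).op r)
        rw [← ConcreteCategory.comp_apply, ← X.presheaf.map_comp] at h
        exact h.symm }
    (by
      intro U r' m
      exact smul_comm (M := Γ(X, U.unop)) (N := Γ(X, U.unop)) (α := Γ(M, U.unop)) _ _ _)⟩

lemma scalar_app (M : X.Modules) (r : Γ(X, ⊤)) (U : X.Opens) (m : Γ(M, U)) :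
    (scalar M r).app U m = X.presheaf.map (homOfLE (le_top : U ≤ ⊤)).op r • m := rfl

lemma scalar_comp {M N : X.Modules} (r : Γ(X, ⊤)) (h : M ⟶ N) :
    scalar M r ≫ h = h ≫ scalar N r := by
  apply Scheme.Modules.hom_ext
  intro U
  ext m
  exact Scheme.Modules.Hom.app_smul h _ m

lemma scalar_scalar (M : X.Modules) (r s : Γ(X, ⊤)) :
    scalar M r ≫ scalar M s = scalar M (r * s) := by
  apply Scheme.Modules.hom_ext
  intro U
  ext m
  change (scalar M s).app U ((scalar M r).app U m) = (scalar M (r * s)).app U m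
  rw [scalar_app, scalar_app, scalar_app, smul_smul, map_mul, mul_comm]

lemma scalar_one (M : X.Modules) : scalar M 1 = 𝟙 M := by
  apply Scheme.Modules.hom_ext
  intro U
  ext m
  change (scalar M 1).app U m = m
  rw [scalar_app, map_one, one_smul]

/-- Multiplication by an invertible global function, as an automorphism. -/
def scalarIso (M : X.Modules) (r : Γ(X, ⊤)ˣ) : M ≅ M where
  hom := scalar M r
  inv := scalar M (r⁻¹ : Γ(X, ⊤)ˣ)
  hom_inv_id := by rw [scalar_scalar, Units.mul_inv, scalar_one]
  inv_hom_id := by rw [scalar_scalar, Units.inv_mul, scalar_one]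

/-- The pullback of invertible functions. -/
def pullbackUnit (f : Y ⟶ X) : Γ(X, ⊤)ˣ →* Γ(Y, ⊤)ˣ := Units.map f.appTop.hom.toMonoidHom

lemma pullbackUnit_comp (g : Z ⟶ Y) (f : Y ⟶ X) (r : Γ(X, ⊤)ˣ) :
    pullbackUnit (g ≫ f) r = pullbackUnit g (pullbackUnit f r) := by
  ext
  simp only [pullbackUnit, Units.coe_map]
  exact congrArg (fun h => h.hom (r : Γ(X, ⊤))) (Scheme.Hom.comp_appTop g f)

lemma pushforward_map_scalar (f : Y ⟶ X) (N : Y.Modules) (r : Γ(X, ⊤)) :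
    (Scheme.Modules.pushforward f).map (scalar N (f.appTop r)) =
      scalar ((Scheme.Modules.pushforward f).obj N) r := by
  apply Scheme.Modules.hom_ext
  intro U
  ext m
  change (scalar N (f.appTop r)).app (f ⁻¹ᵁ U) m = _
  rw [scalar_app]
  have : Y.presheaf.map (homOfLE (le_top : f ⁻¹ᵁ U ≤ ⊤)).op (f.appTop r) =
      f.app U (X.presheaf.map (homOfLE (le_top : U ≤ ⊤)).op r) := by
    rw [← ConcreteCategory.comp_apply, ← ConcreteCategory.comp_apply]
    congr 1
    exact congrArg _ (f.naturality (homOfLE (le_top : U ≤ ⊤)).op).symm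
  exact congrArg (fun a => (N.smul a).hom m) this

lemma pullback_map_scalar (f : Y ⟶ X) (M : X.Modules) (r : Γ(X, ⊤)) :
    (Scheme.Modules.pullback f).map (scalar M r) =
      scalar ((Scheme.Modules.pullback f).obj M) (f.appTop r) := by
  apply ((Scheme.Modules.pullbackPushforwardAdjunction f).homEquiv _ _).injective
  rw [Adjunction.homEquiv_unit, Adjunction.homEquiv_unit, pushforward_map_scalar]
  refine Eq.trans ?_ (scalar_comp r
    ((Scheme.Modules.pullbackPushforwardAdjunction f).unit.app M))
  exact ((Scheme.Modules.pullbackPushforwardAdjunction f).unit.naturality (scalar M r)).symm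

/-- For equal maps `f = g`, the isomorphism `f^* M ≅ g^* M` given by multiplication by the
invertible function `r`. -/
def scalarCongr {f g : Y ⟶ X} (h : f = g) (M : X.Modules) (r : Γ(Y, ⊤)ˣ) :
    (Scheme.Modules.pullback f).obj M ≅ (Scheme.Modules.pullback g).obj M :=
  scalarIso ((Scheme.Modules.pullback f).obj M) r ≪≫ (Scheme.Modules.pullbackCongr h).app M

lemma scalarCongr_comp {f g h : Y ⟶ X} (p : f = g) (q : g = h) (M : X.Modules)
    (r s : Γ(Y, ⊤)ˣ) :
    (scalarCongr p M r).hom ≫ (scalarCongr q M s).hom =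
      (scalarCongr (p.trans q) M (r * s)).hom := by
  subst p
  subst q
  simp only [scalarCongr, scalarIso, Scheme.Modules.pullbackCongr, eqToIso_refl, Iso.trans_hom,
    Iso.app_hom, Iso.refl_hom, NatTrans.id_app, Category.comp_id, scalar_scalar, Units.val_mul]

lemma baseChange_scalarCongr (k : Z ⟶ Y) {f g : Y ⟶ X} (h : f = g) {f' g' : Z ⟶ X}
    (hf : k ≫ f = f') (hg : k ≫ g = g') (M : X.Modules) (r : Γ(Y, ⊤)ˣ) :
    (baseChange k hf hg (scalarCongr h M r)).hom =
      (scalarCongr (hf.symm.trans ((congrArg (k ≫ ·) h).trans hg)) M (pullbackUnit k r)).hom := by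
  subst h
  subst hf
  subst hg
  simp only [baseChange, scalarCongr, scalarIso, Scheme.Modules.pullbackCongr, eqToIso_refl,
    Iso.trans_hom, Iso.app_hom, Iso.symm_hom, Functor.mapIso_hom, Iso.refl_symm, Iso.refl_hom,
    NatTrans.id_app, Category.comp_id, Category.id_comp, pullback_map_scalar]
  refine (congrArg _ (scalar_comp _ ((Scheme.Modules.pullbackComp k f).hom.app M))).trans ?_
  rw [Iso.inv_hom_id_app_assoc]
  rfl

lemma baseChange_scalarCongr_cocycle {f g : Y ⟶ X} (h : f = g) {t₁ t₂ t₃ : Z ⟶ X}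
    (m p a : Z ⟶ Y) (hm₁ : m ≫ f = t₁) (hm₃ : m ≫ g = t₃) (hp₁ : p ≫ f = t₁) (hp₂ : p ≫ g = t₂)
    (ha₂ : a ≫ f = t₂) (ha₃ : a ≫ g = t₃) (M : X.Modules) (r : Γ(Y, ⊤)ˣ)
    (hr : pullbackUnit m r = pullbackUnit p r * pullbackUnit a r) :
    (baseChange m hm₁ hm₃ (scalarCongr h M r)).hom =
      (baseChange p hp₁ hp₂ (scalarCongr h M r)).hom ≫
        (baseChange a ha₂ ha₃ (scalarCongr h M r)).hom := by
  rw [baseChange_scalarCongr, baseChange_scalarCongr, baseChange_scalarCongr, scalarCongr_comp,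
    hr]

end Modules

/-! ### Grothendieck rings -/

section GrothendieckRing

variable {A : Type*}

/-- The relations of the Grothendieck ring of a collection `A` of objects, where `exact E' E E''`
means that there is a short exact sequence `0 → E' → E → E'' → 0`, `tensor E F P` means that `P`
is a tensor product of `E` and `F`, and `unit E` means that `E` is a unit object. -/
def grothendieckRelations (exact : A → A → A → Prop) (tensor : A → A → A → Prop)
    (unit : A → Prop) : Ideal (FreeCommRing A) :=
  Ideal.span
    ({r | ∃ E' E E'', exact E' E E'' ∧
        r = FreeCommRing.of E - (FreeCommRing.of E' + FreeCommRing.of E'')} ∪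
      {r | ∃ E F P, tensor E F P ∧
        r = FreeCommRing.of P - FreeCommRing.of E * FreeCommRing.of F} ∪
      {r | ∃ E, unit E ∧ r = FreeCommRing.of E - 1})

end GrothendieckRing

/-! ### Vector bundles and `K_0` -/

section VectorBundle

/-- Finite locally free `𝒪_X`-modules. -/
structure VectorBundle (X : Scheme.{u}) where
  obj : X.Modules
  isFiniteLocallyFree : IsFiniteLocallyFree obj

namespace VectorBundle

variable {X : Scheme.{u}}

/-- There is a short exact sequence `0 → E' → E → E'' → 0` of `𝒪_X`-modules. -/
def Exact (E' E E'' : VectorBundle X) : Prop :=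
  ∃ (f : E'.obj ⟶ E.obj) (g : E.obj ⟶ E''.obj) (w : f ≫ g = 0),
    (ShortComplex.mk f g w).ShortExact

/-- `P` is a tensor product of `E` and `F` over `𝒪_X`. -/
def IsTensor (E F P : VectorBundle X) : Prop :=
  ∃ β : Pairing E.obj F.obj P.obj, β.IsTensorProduct

/-- `E` is isomorphic to `𝒪_X`. -/
def IsTrivialLine (E : VectorBundle X) : Prop :=
  Nonempty (structureSheaf X ≅ E.obj)

end VectorBundle

/-- The Grothendieck ring `K_0(X)` of vector bundles on `X`. -/
abbrev K0 (X : Scheme.{u}) : Type (u + 1) :=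
  FreeCommRing (VectorBundle X) ⧸
    grothendieckRelations (A := VectorBundle X) VectorBundle.Exact VectorBundle.IsTensor
      VectorBundle.IsTrivialLine

/-- The class `[E]` in `K_0(X)`. -/
def K0.mk {X : Scheme.{u}} (E : VectorBundle X) : K0 X :=
  Ideal.Quotient.mk _ (FreeCommRing.of E)

end VectorBundle

/-! ### Equivariant vector bundles and equivariant `K_0` -/

section Equivariant

variable {S : Scheme.{u}} {G X : Over S} [GrpObj G]

/-- The map `(g, x) ↦ g x` of an action. -/
def actMap (a : ModObj G X) : G ⊗ X ⟶ X := a.smul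

/-- The map `(g, h, x) ↦ (g h, x)`. -/
def mulMap (G X : Over S) [GrpObj G] : G ⊗ (G ⊗ X) ⟶ G ⊗ X := (α_ G G X).inv ≫ μ[G] ▷ X

lemma mulMap_fst : mulMap G X ≫ fst G X = fst G (G ⊗ X) * (snd G (G ⊗ X) ≫ fst G X) := by
  rw [mulMap, Category.assoc, whiskerRight_fst, ← Category.assoc, Hom.mul_def]
  congr 1
  apply CartesianMonoidalCategory.hom_ext <;> simp

lemma mulMap_snd : mulMap G X ≫ snd G X = snd G (G ⊗ X) ≫ snd G X := by
  simp [mulMap]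

lemma mulMap_actMap (a : ModObj G X) : mulMap G X ≫ actMap a = G ◁ actMap a ≫ actMap a := by
  have h := a.mul_smul
  change μ[G] ▷ X ≫ actMap a = (α_ G G X).hom ≫ G ◁ actMap a ≫ actMap a at h
  rw [mulMap, Category.assoc, h, Iso.inv_hom_id_assoc]

/-- The cocycle condition on `G × G × X` for an isomorphism `φ : pr_X^* M ≅ act^* M` on `G × X`.
On fibres, `φ` at `(g, x)` is an isomorphism `M_x ≅ M_{g x}`, and the cocycle condition says that
`φ` at `(g h, x)` is the composite `M_x ≅ M_{h x} ≅ M_{g h x}`. -/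
def IsCocycle (a : ModObj G X) (M : X.left.Modules)
    (φ : (Scheme.Modules.pullback (snd G X).left).obj M ≅
      (Scheme.Modules.pullback (actMap a).left).obj M) : Prop :=
  (baseChange (mulMap G X).left (f' := (snd G (G ⊗ X) ≫ snd G X).left)
      (g' := (G ◁ actMap a ≫ actMap a).left)
      (congrArg Over.Hom.left mulMap_snd)
      (congrArg Over.Hom.left (mulMap_actMap a)) φ).hom =
    (baseChange (snd G (G ⊗ X)).left (f' := (snd G (G ⊗ X) ≫ snd G X).left)
        (g' := (snd G (G ⊗ X) ≫ actMap a).left) rfl rfl φ).hom ≫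
      (baseChange (G ◁ actMap a).left (f' := (snd G (G ⊗ X) ≫ actMap a).left)
        (g' := (G ◁ actMap a ≫ actMap a).left)
        (congrArg Over.Hom.left (whiskerLeft_snd G (actMap a))) rfl φ).hom

/-- A `G`-equivariant finite locally free `𝒪_X`-module: a finite locally free module with an
isomorphism `φ : pr_X^* F ≅ act^* F` on `G × X` satisfying the cocycle condition. -/
structure EquivariantBundle (a : ModObj G X) where
  obj : X.left.Modules
  isFiniteLocallyFree : IsFiniteLocallyFree obj
  φ : (Scheme.Modules.pullback (snd G X).left).obj obj ≅
    (Scheme.Modules.pullback (actMap a).left).obj obj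
  cocycle : IsCocycle a obj φ

namespace EquivariantBundle

variable {a : ModObj G X}

/-- A morphism of the underlying modules is equivariant. -/
def IsEquivariantHom (E F : EquivariantBundle a) (f : E.obj ⟶ F.obj) : Prop :=
  E.φ.hom ≫ (Scheme.Modules.pullback (actMap a).left).map f =
    (Scheme.Modules.pullback (snd G X).left).map f ≫ F.φ.hom

/-- There is a sequence `0 → E' → E → E'' → 0` of equivariant maps, exact as a sequence of
`𝒪_X`-modules. -/
def Exact (E' E E'' : EquivariantBundle a) : Prop :=
  ∃ (f : E'.obj ⟶ E.obj) (g : E.obj ⟶ E''.obj) (w : f ≫ g = 0),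
    IsEquivariantHom E' E f ∧ IsEquivariantHom E E'' g ∧ (ShortComplex.mk f g w).ShortExact

/-- `P` is the tensor product of `E` and `F` over `𝒪_X` with its diagonal equivariant structure:
there is a universal bilinear map `β : E × F → P` such that the maps induced by `β` after pullback
along the projection and along the action are compatible with the equivariant structures. -/
def IsTensor (E F P : EquivariantBundle a) : Prop :=
  ∃ (β : Pairing E.obj F.obj P.obj)
    (β₁ : Pairing ((Scheme.Modules.pullback (snd G X).left).obj E.obj)
      ((Scheme.Modules.pullback (snd G X).left).obj F.obj)
      ((Scheme.Modules.pullback (snd G X).left).obj P.obj))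
    (β₂ : Pairing ((Scheme.Modules.pullback (actMap a).left).obj E.obj)
      ((Scheme.Modules.pullback (actMap a).left).obj F.obj)
      ((Scheme.Modules.pullback (actMap a).left).obj P.obj)),
    β.IsTensorProduct ∧ β.IsPullback (snd G X).left β₁ ∧ β.IsPullback (actMap a).left β₂ ∧
      ∀ (U : (G ⊗ X).left.Opens)
        (m : Γ((Scheme.Modules.pullback (snd G X).left).obj E.obj, U))
        (n : Γ((Scheme.Modules.pullback (snd G X).left).obj F.obj, U)),
        P.φ.hom.app U (β₁.toFun U m n) = β₂.toFun U (E.φ.hom.app U m) (F.φ.hom.app U n)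

/-- `E` is equivariantly isomorphic to `𝒪_X` with its canonical equivariant structure: it is free
on an invariant global section. -/
def IsTrivialLine (E : EquivariantBundle a) : Prop :=
  ∃ s : structureSheaf X.left ≅ E.obj,
    E.φ.hom.app ⊤ (pullbackSection (snd G X).left (U := ⊤)
        (s.hom.app ⊤ (oneSection X.left))) =
      pullbackSection (actMap a).left (U := ⊤) (s.hom.app ⊤ (oneSection X.left))

end EquivariantBundle

/-- The Grothendieck ring `K_0^G(X)` of `G`-equivariant vector bundles on `X`. -/
abbrev EquivariantK0 (a : ModObj G X) : Type (u + 1) :=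
  FreeCommRing (EquivariantBundle a) ⧸
    grothendieckRelations (A := EquivariantBundle a) EquivariantBundle.Exact
      EquivariantBundle.IsTensor EquivariantBundle.IsTrivialLine

/-- The class `[E]` in `K_0^G(X)`. -/
def EquivariantK0.mk {a : ModObj G X} (E : EquivariantBundle a) : EquivariantK0 a :=
  Ideal.Quotient.mk _ (FreeCommRing.of E)

/-- The action of `G` on `X` is trivial: it is the projection `(g, x) ↦ x`. -/
def IsTrivialAction (a : ModObj G X) : Prop := actMap a = snd G X

/-- A character of `G`: an invertible function `χ` with `χ(g h) = χ(g) χ(h)`. -/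
def IsCharacter (G : Over S) [GrpObj G] (χ : Γ(G.left, ⊤)ˣ) : Prop :=
  ∀ (U : Over S) (g h : U ⟶ G),
    pullbackUnit (g * h).left χ = pullbackUnit g.left χ * pullbackUnit h.left χ

lemma IsCharacter.pullback_mulMap {χ : Γ(G.left, ⊤)ˣ} (hχ : IsCharacter G χ)
    (f : G ⊗ (G ⊗ X) ⟶ G ⊗ X) (hf : f ≫ fst G X = fst G (G ⊗ X)) :
    pullbackUnit (mulMap G X).left (pullbackUnit (fst G X).left χ) =
      pullbackUnit (snd G (G ⊗ X)).left (pullbackUnit (fst G X).left χ) *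
        pullbackUnit f.left (pullbackUnit (fst G X).left χ) := by
  have h₁ := pullbackUnit_comp (mulMap G X).left (fst G X).left χ
  have h₂ := pullbackUnit_comp (snd G (G ⊗ X)).left (fst G X).left χ
  have h₃ := pullbackUnit_comp f.left (fst G X).left χ
  rw [← Over.comp_left] at h₁ h₂ h₃
  rw [mulMap_fst] at h₁
  rw [hf] at h₃
  rw [← h₁, ← h₂, ← h₃, mul_comm]
  exact hχ _ _ _

lemma VectorBundle.twist_cocycle {a : ModObj G X} (ha : IsTrivialAction a) (M : X.left.Modules)
    (χ : Γ(G.left, ⊤)ˣ) (hχ : IsCharacter G χ) :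
    IsCocycle a M
      (scalarCongr (congrArg Over.Hom.left ha.symm) M (pullbackUnit (fst G X).left χ)) :=
  baseChange_scalarCongr_cocycle _ _ _ _ _ _ _ _ _ _ M _
    (hχ.pullback_mulMap (G ◁ actMap a) (whiskerLeft_fst G (actMap a)))

/-- The vector bundle `E` on a scheme `X` with trivial `G`-action, with `G` acting on `E` by the
character `χ`. -/
def VectorBundle.twist {a : ModObj G X} (ha : IsTrivialAction a) (E : VectorBundle X.left)
    (χ : Γ(G.left, ⊤)ˣ) (hχ : IsCharacter G χ) : EquivariantBundle a where
  obj := E.obj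
  isFiniteLocallyFree := E.isFiniteLocallyFree
  φ := scalarCongr (congrArg Over.Hom.left ha.symm) E.obj (pullbackUnit (fst G X).left χ)
  cocycle := VectorBundle.twist_cocycle ha E.obj χ hχ

end Equivariant

/-! ### Split tori -/

section Torus

variable {S : Scheme.{u}}

/-- The functor of points `U ↦ (Γ(U, 𝒪_U)ˣ)^t` of the group scheme `𝔾_m^t` over `S`. -/
def gmPow (S : Scheme.{u}) (t : ℕ) : (Over S)ᵒᵖ ⥤ GrpCat.{u} where
  obj U := GrpCat.of (Fin t → Γ(U.unop.left, ⊤)ˣ)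
  map f := GrpCat.ofHom ((pullbackUnit f.unop.left).compLeft (Fin t))
  map_id U := by
    refine GrpCat.hom_ext (MonoidHom.ext fun (x : Fin t → Γ(U.unop.left, ⊤)ˣ) => ?_)
    funext i
    refine Units.ext ?_
    exact congrArg (fun h => h.hom (x i : Γ(U.unop.left, ⊤)))
      (Scheme.Hom.id_appTop (X := U.unop.left))
  map_comp {U V W} f g := by
    refine GrpCat.hom_ext (MonoidHom.ext fun (x : Fin t → Γ(U.unop.left, ⊤)ˣ) => ?_)
    funext i
    exact (pullbackUnit_comp g.unop.left f.unop.left (x i))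

/-- A splitting of a group scheme `T` over `S`: an isomorphism of group schemes `T ≅ 𝔾_m^t`,
given on functors of points. A split torus of rank `t` is a group scheme with a splitting. -/
abbrev Splitting (T : Over S) [GrpObj T] (t : ℕ) : Type _ := yonedaGrpObj T ≅ gmPow S t

variable {T : Over S} [GrpObj T] {t : ℕ}

/-- The coordinate functions of a split torus. -/
def Splitting.coord (e : Splitting T t) (i : Fin t) : Γ(T.left, ⊤)ˣ :=
  (e.hom.app (op T) (𝟙 T) : Fin t → Γ(T.left, ⊤)ˣ) i

lemma Splitting.isCharacter_coord (e : Splitting T t) (i : Fin t) :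
    IsCharacter T (e.coord i) := by
  have key : ∀ (U : Over S) (g : U ⟶ T),
      pullbackUnit g.left (e.coord i) = (e.hom.app (op U) g : Fin t → Γ(U.left, ⊤)ˣ) i := by
    intro U g
    have h := congrArg (fun f => f.hom (𝟙 T)) (e.hom.naturality g.op)
    have h' := congrArg (fun f : Fin t → Γ(U.left, ⊤)ˣ => f i) h
    refine Eq.trans h'.symm ?_
    change (e.hom.app (op U) (g ≫ 𝟙 T) : Fin t → Γ(U.left, ⊤)ˣ) i = _
    rw [Category.comp_id]
  intro U g h
  rw [key, key, key]
  exact congrArg (fun f : Fin t → Γ(U.left, ⊤)ˣ => f i) (map_mul (e.hom.app (op U)).hom g h)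

/-- The character `(u_1, …, u_t) ↦ u_1 ^ w_1 ⋯ u_t ^ w_t` of a split torus. -/
def Splitting.char (e : Splitting T t) (w : Fin t → ℤ) : Γ(T.left, ⊤)ˣ :=
  ∏ i, e.coord i ^ w i

lemma Splitting.isCharacter_char (e : Splitting T t) (w : Fin t → ℤ) :
    IsCharacter T (e.char w) := by
  intro U g h
  simp only [Splitting.char, map_prod, map_zpow, e.isCharacter_coord _ U g h, mul_zpow,
    Finset.prod_mul_distrib]

/-- For a scheme `X` over `S` with trivial action of the split torus `T`, the equivariant vector
bundle `E(λ)`, that is, the vector bundle `E` placed in weight `λ = w ∈ ℤ^t`. -/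
def Splitting.inWeight (e : Splitting T t) {X : Over S} {a : ModObj T X}
    (ha : IsTrivialAction a) (E : VectorBundle X.left) (w : Fin t → ℤ) : EquivariantBundle a :=
  VectorBundle.twist ha E (e.char w) (e.isCharacter_char w)

/-- The vector bundle `𝒪_X`. -/
def VectorBundle.trivialLine (X : Scheme.{u}) : VectorBundle X where
  obj := structureSheaf X
  isFiniteLocallyFree := by
    intro x
    refine ⟨⊤, trivial, 1, ⟨?_⟩⟩
    refine Scheme.Modules.restrictUnitIso (⊤ : X.Opens).ι ≪≫ ?_
    exact (Limits.coproductUniqueIso (C := (((⊤ : X.Opens) : Scheme.{u})).Modules)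
      (fun _ : ULift.{u} (Fin 1) =>
        SheafOfModules.unit ((⊤ : X.Opens) : Scheme.{u}).ringCatSheaf)).symm

end Torus

end EquivariantKTheory

end

open EquivariantKTheory

/-! Over an affine open U of X, the preimage of U in T × X is the spectrum of the Laurent polynomial
ring 𝒪(U)[ℤ^t] (`Splitting.isIso_toSpec`). Hence, if M is free on U, every section of pr^* M over
this preimage is in a unique way a finite sum ∑ χ_w pr^* s_w (`Splitting.weightSum_bijective`).
Since the action is trivial, an equivariant structure on E amounts to an automorphism φ of pr^* E,
and φ(pr^* s) = ∑ χ_w pr^* σ_w(s) defines operators σ_w. Comparing coefficients of characters in the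
cocycle condition gives σ_w σ_v = δ_{wv} σ_v, and injectivity of φ then gives s = ∑ σ_w(s). So
sections are locally sums of eigensections (`EquivariantBundle.exists_local_decomposition`).

The eigensections of weight w form the kernel of a morphism, hence a submodule E_w that is defined
globally and needs no gluing. Quasi-compactness leaves finitely many weights, so E is the direct sum
of the E_w (`EquivariantBundle.exists_weight_decomposition`), and each E_w is finite locally free as
a direct summand (`IsFiniteLocallyFree.of_retract`).

Equivariant maps preserve weights and weights add under tensor products. Therefore the character ∑
[E_w] w in the group algebra K_0(X)[ℤ^t] respects the relations of K_0^T(X) (`character_exact`,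
`character_tensor`, `character_unit`). In the other direction, [E] w ↦ [E(w)] defines a ring
homomorphism. The two are inverse to each other: E is equivariantly the sum of the E_w(w)
(`Splitting.groupAlgebraHom_character`), and E(w) is concentrated in weight w
(`character_inWeight`). Finally, with u_i = 1 + x_i the relation x_i y_i + x_i + y_i = 0 says that 1
+ y_i is the inverse of u_i, so the quotient ring is this group algebra (`laurentEquiv`).

Modules are handled through sections throughout: a map out of f^* M is determined by its values on
pulled back sections (`pullback_hom_ext`), and finite local freeness is the existence of local bases
(`IsBasisOn`). -/

noncomputable section

namespace EquivariantKTheory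

/-! ### Sections of modules, kernels, and pulled back sections -/

section Sections

variable {X Y Z : Scheme.{u}}

/-- Restriction of sections of a module. -/
def res (M : X.Modules) {V U : X.Opens} (h : V ≤ U) : Γ(M, U) →+ Γ(M, V) :=
  (M.presheaf.map (homOfLE h).op).hom

/-- Restriction of functions. -/
def resO {V U : X.Opens} (h : V ≤ U) : Γ(X, U) →+* Γ(X, V) :=
  (X.presheaf.map (homOfLE h).op).hom

@[simp]
lemma res_res (M : X.Modules) {W V U : X.Opens} (h : V ≤ U) (h' : W ≤ V) (s : Γ(M, U)) :
    res M h' (res M h s) = res M (h'.trans h) s := by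
  simp only [res]
  rw [← AddCommGrpCat.comp_apply, ← Functor.map_comp]
  rfl

@[simp]
lemma res_refl (M : X.Modules) {U : X.Opens} (h : U ≤ U) (s : Γ(M, U)) : res M h s = s := by
  have : (homOfLE h).op = 𝟙 (op U) := rfl
  rw [res, this, (M.presheaf).map_id]
  rfl

@[simp]
lemma resO_resO {W V U : X.Opens} (h : V ≤ U) (h' : W ≤ V) (s : Γ(X, U)) :
    resO h' (resO h s) = resO (h'.trans h) s := by
  simp only [resO]
  rw [← CommRingCat.comp_apply, ← Functor.map_comp]
  rfl

@[simp]
lemma resO_refl {U : X.Opens} (h : U ≤ U) (s : Γ(X, U)) : resO h s = s := by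
  have : (homOfLE h).op = 𝟙 (op U) := rfl
  rw [resO, this, X.presheaf.map_id]
  rfl

@[simp]
lemma res_smul (M : X.Modules) {V U : X.Opens} (h : V ≤ U) (r : Γ(X, U)) (s : Γ(M, U)) :
    res M h (r • s) = resO h r • res M h s :=
  Scheme.Modules.map_smul M (homOfLE h) r s

lemma app_res {M N : X.Modules} (f : M ⟶ N) {V U : X.Opens} (h : V ≤ U) (s : Γ(M, U)) :
    f.app V (res M h s) = res N h (f.app U s) :=
  congrArg (fun g => g.hom s) (f.mapPresheaf.naturality (homOfLE h).op)

lemma app_smul {M N : X.Modules} (f : M ⟶ N) {U : X.Opens} (r : Γ(X, U)) (s : Γ(M, U)) :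
    f.app U (r • s) = r • f.app U s := Scheme.Modules.Hom.app_smul f r s

lemma comp_app_apply {M N P : X.Modules} (f : M ⟶ N) (g : N ⟶ P) {U : X.Opens} (s : Γ(M, U)) :
    (f ≫ g).app U s = g.app U (f.app U s) := rfl

lemma id_app_apply {M : X.Modules} {U : X.Opens} (s : Γ(M, U)) :
    (𝟙 M : M ⟶ M).app U s = s := rfl

lemma iso_inv_app_hom_app {M N : X.Modules} (α : M ≅ N) {U : X.Opens} (s : Γ(M, U)) :
    α.inv.app U (α.hom.app U s) = s := by
  rw [← comp_app_apply, α.hom_inv_id, id_app_apply]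

lemma iso_hom_app_inv_app {M N : X.Modules} (α : M ≅ N) {U : X.Opens} (s : Γ(N, U)) :
    α.hom.app U (α.inv.app U s) = s := by
  rw [← comp_app_apply, α.inv_hom_id, id_app_apply]

lemma zero_app_apply {M N : X.Modules} {U : X.Opens} (s : Γ(M, U)) :
    (0 : M ⟶ N).app U s = 0 := rfl

/-- The action of a morphism on sections over an open set is additive in the morphism. -/
def appAddHom (M N : X.Modules) (U : X.Opens) (s : Γ(M, U)) : (M ⟶ N) →+ Γ(N, U) where
  toFun f := f.app U s
  map_zero' := rfl
  map_add' _ _ := rfl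

lemma sum_app_apply {M N : X.Modules} {J : Type*} (t : Finset J) (f : J → (M ⟶ N)) {U : X.Opens}
    (s : Γ(M, U)) : (∑ i ∈ t, f i).app U s = ∑ i ∈ t, (f i).app U s :=
  map_sum (appAddHom M N U s) f t

lemma hom_ext_sections {M N : X.Modules} {f g : M ⟶ N}
    (h : ∀ (U : X.Opens) (s : Γ(M, U)), f.app U s = g.app U s) : f = g := by
  apply Scheme.Modules.hom_ext
  intro U
  ext s
  exact h U s

/-- A morphism of modules from compatible linear maps on sections. -/
def homMk {M N : X.Modules} (f : ∀ U : X.Opens, Γ(M, U) →ₗ[Γ(X, U)] Γ(N, U))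
    (hf : ∀ {V U : X.Opens} (h : V ≤ U) (s : Γ(M, U)), f V (res M h s) = res N h (f U s)) :
    M ⟶ N :=
  ⟨PresheafOfModules.homMk (M₁ := M.val) (M₂ := N.val)
    { app := fun U => AddCommGrpCat.ofHom (f U.unop).toAddMonoidHom
      naturality := by
        intro U V i
        ext s
        exact hf (leOfHom i.unop) s }
    (fun U r s => (f U.unop).map_smul r s)⟩

@[simp]
lemma homMk_app {M N : X.Modules} (f : ∀ U : X.Opens, Γ(M, U) →ₗ[Γ(X, U)] Γ(N, U))
    (hf : ∀ {V U : X.Opens} (h : V ≤ U) (s : Γ(M, U)), f V (res M h s) = res N h (f U s))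
    (U : X.Opens) (s : Γ(M, U)) : (homMk f hf).app U s = f U s := rfl

/-- A section is determined by its restrictions to the members of a cover. -/
lemma eq_of_locally_eq (M : X.Modules) {V : X.Opens} {s t : Γ(M, V)}
    (h : ∀ x ∈ V, ∃ (W : X.Opens) (hW : W ≤ V), x ∈ W ∧ res M hW s = res M hW t) : s = t := by
  choose W hW hx he using h
  refine TopCat.Sheaf.eq_of_locally_eq' ⟨M.presheaf, M.isSheaf⟩ (fun x : V => W x.1 x.2) V
    (fun x => homOfLE (hW x.1 x.2)) ?_ s t (fun x => he x.1 x.2)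
  intro x hxV
  exact TopologicalSpace.Opens.mem_iSup.2 ⟨⟨x, hxV⟩, hx x hxV⟩

lemma isIso_of_bijective {M N : X.Modules} (f : M ⟶ N)
    (h : ∀ U : X.Opens, Function.Bijective fun s : Γ(M, U) => f.app U s) : IsIso f := by
  rw [Scheme.Modules.Hom.isIso_iff_isIso_app]
  intro U
  exact (ConcreteCategory.isIso_iff_bijective _).2 (h U)

/-- A test morphism killed by `f` has locally vanishing values, and sections that vanish locally
vanish. -/
lemma mono_of_locally_injective {M N : X.Modules} (f : M ⟶ N)
    (h : ∀ x : X, ∃ U : X.Opens, x ∈ U ∧ ∀ V ≤ U, ∀ s : Γ(M, V), f.app V s = 0 → s = 0) :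
    Mono f := by
  refine Preadditive.mono_of_cancel_zero _ fun {G} g hg => hom_ext_sections fun W s => ?_
  refine eq_of_locally_eq M fun x hx => ?_
  obtain ⟨U, hxU, hU⟩ := h x
  refine ⟨W ⊓ U, inf_le_left, ⟨hx, hxU⟩, ?_⟩
  rw [zero_app_apply, map_zero, ← app_res]
  refine hU _ inf_le_right _ ?_
  rw [← comp_app_apply, hg, zero_app_apply]

lemma epi_of_locally_surjective {M N : X.Modules} (f : M ⟶ N)
    (h : ∀ x : X, ∃ U : X.Opens, x ∈ U ∧ ∀ V ≤ U, ∀ s : Γ(N, V), ∃ s', f.app V s' = s) :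
    Epi f := by
  refine Preadditive.epi_of_cancel_zero _ fun {G} g hg => hom_ext_sections fun W s => ?_
  refine eq_of_locally_eq G fun x hx => ?_
  obtain ⟨U, hxU, hU⟩ := h x
  refine ⟨W ⊓ U, inf_le_left, ⟨hx, hxU⟩, ?_⟩
  obtain ⟨s', hs'⟩ := hU (W ⊓ U) inf_le_right (res N inf_le_left s)
  rw [zero_app_apply, map_zero, ← app_res, ← hs', ← comp_app_apply, hg, zero_app_apply]

/-- Sections over an open set, as a functor. -/
def sectionsFunctor (U : X.Opens) : X.Modules ⥤ Ab.{u} where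
  obj M := Γ(M, U)
  map f := f.app U

/-- Left exactness of sections: it lets monomorphisms and kernels of modules be computed on each
open set. -/
instance (U : X.Opens) : Limits.PreservesLimits (sectionsFunctor U) :=
  have : Limits.PreservesLimits ((evaluation (TopologicalSpace.Opens X)ᵒᵖ Ab.{u}).obj (op U)) :=
    inferInstance
  Limits.comp_preservesLimits (Scheme.Modules.toPresheaf X)
    ((evaluation (TopologicalSpace.Opens X)ᵒᵖ Ab.{u}).obj (op U))

instance (U : X.Opens) : (sectionsFunctor U).Additive where
  map_add := rfl

lemma mono_app_injective {M N : X.Modules} (f : M ⟶ N) [Mono f] (U : X.Opens) :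
    Function.Injective fun s : Γ(M, U) => f.app U s := by
  have : Mono ((sectionsFunctor U).map f) := inferInstance
  exact (AddCommGrpCat.mono_iff_injective _).1 this

/-- A section killed by a morphism comes from its kernel. -/
lemma exists_kernel_lift {M N : X.Modules} (f : M ⟶ N) (U : X.Opens) (s : Γ(M, U))
    (hs : f.app U s = 0) : ∃ s' : Γ(Limits.kernel f, U), (Limits.kernel.ι f).app U s' = s := by
  let S := ShortComplex.mk (Limits.kernel.ι f) f (Limits.kernel.condition f)
  have hS : S.Exact := S.exact_of_f_is_kernel (Limits.kernelIsKernel f)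
  have : Mono S.f := inferInstanceAs (Mono (Limits.kernel.ι f))
  have h := hS.map_of_mono_of_preservesKernel (sectionsFunctor U) inferInstance inferInstance
  exact (ShortComplex.ab_exact_iff _).1 h s hs

lemma kernel_ι_app {M N : X.Modules} (f : M ⟶ N) (U : X.Opens) (s : Γ(Limits.kernel f, U)) :
    f.app U ((Limits.kernel.ι f).app U s) = 0 := by
  rw [← comp_app_apply, Limits.kernel.condition, zero_app_apply]

/-! #### Pulled back sections -/

lemma resO_app (f : Y ⟶ X) {V U : X.Opens} (h : V ≤ U) (r : Γ(X, U)) :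
    resO (f.preimage_mono h) (f.app U r) = f.app V (resO h r) := by
  simp only [resO]
  exact congrArg (fun g => g.hom r) (f.naturality (homOfLE h).op).symm

lemma pullbackSection_add (f : Y ⟶ X) {M : X.Modules} {U : X.Opens} (s t : Γ(M, U)) :
    pullbackSection f (s + t) = pullbackSection f s + pullbackSection f t :=
  map_add _ _ _

lemma pullbackSection_smul (f : Y ⟶ X) {M : X.Modules} {U : X.Opens} (r : Γ(X, U)) (s : Γ(M, U)) :
    pullbackSection f (r • s) = f.app U r • pullbackSection f s :=
  app_smul _ r s

lemma pullbackSection_res (f : Y ⟶ X) {M : X.Modules} {V U : X.Opens} (h : V ≤ U) (s : Γ(M, U)) :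
    pullbackSection f (res M h s) = res _ (f.preimage_mono h) (pullbackSection f s) :=
  app_res _ h s

/-- Pulling back sections, as an additive map. -/
def pullbackSectionHom (f : Y ⟶ X) (M : X.Modules) (U : X.Opens) :
    Γ(M, U) →+ Γ((Scheme.Modules.pullback f).obj M, f ⁻¹ᵁ U) where
  toFun := pullbackSection f
  map_zero' := map_zero _
  map_add' := pullbackSection_add f

lemma pullbackSection_zero (f : Y ⟶ X) {M : X.Modules} {U : X.Opens} :
    pullbackSection f (0 : Γ(M, U)) = 0 := (pullbackSectionHom f M U).map_zero

lemma pullbackSection_sum (f : Y ⟶ X) {M : X.Modules} {U : X.Opens} {J : Type*} (t : Finset J)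
    (s : J → Γ(M, U)) : pullbackSection f (∑ i ∈ t, s i) = ∑ i ∈ t, pullbackSection f (s i) :=
  map_sum (pullbackSectionHom f M U) s t

lemma pullback_map_pullbackSection (f : Y ⟶ X) {M N : X.Modules} (g : M ⟶ N) {U : X.Opens}
    (s : Γ(M, U)) :
    ((Scheme.Modules.pullback f).map g).app (f ⁻¹ᵁ U) (pullbackSection f s) =
      pullbackSection f (g.app U s) := by
  have h := (Scheme.Modules.pullbackPushforwardAdjunction f).unit.naturality g
  exact (congrArg (fun k => Scheme.Modules.Hom.app k U s) h).symm

/-- The morphism `f^* M ⟶ Q` adjoint to a morphism `M ⟶ f_* Q`. -/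
def pullbackDesc (f : Y ⟶ X) {M : X.Modules} {Q : Y.Modules}
    (g : M ⟶ (Scheme.Modules.pushforward f).obj Q) : (Scheme.Modules.pullback f).obj M ⟶ Q :=
  ((Scheme.Modules.pullbackPushforwardAdjunction f).homEquiv M Q).symm g

lemma pullbackDesc_pullbackSection (f : Y ⟶ X) {M : X.Modules} {Q : Y.Modules}
    (g : M ⟶ (Scheme.Modules.pushforward f).obj Q) {U : X.Opens} (s : Γ(M, U)) :
    (pullbackDesc f g).app (f ⁻¹ᵁ U) (pullbackSection f s) = g.app U s := by
  have h := ((Scheme.Modules.pullbackPushforwardAdjunction f).homEquiv M Q).apply_symm_apply g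
  rw [Adjunction.homEquiv_unit] at h
  exact congrArg (fun k => Scheme.Modules.Hom.app k U s) h

/-- By adjunction a map out of f^* M is determined by its composite with the unit, and the values of
the unit are the pulled back sections. -/
lemma pullback_hom_ext (f : Y ⟶ X) {M : X.Modules} {Q : Y.Modules}
    {g h : (Scheme.Modules.pullback f).obj M ⟶ Q}
    (H : ∀ (U : X.Opens) (s : Γ(M, U)),
      g.app (f ⁻¹ᵁ U) (pullbackSection f s) = h.app (f ⁻¹ᵁ U) (pullbackSection f s)) : g = h := by
  apply ((Scheme.Modules.pullbackPushforwardAdjunction f).homEquiv M Q).injective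
  rw [Adjunction.homEquiv_unit, Adjunction.homEquiv_unit]
  exact hom_ext_sections H

/-- The comparison of pullbacks is conjugate, under the adjunctions, to the comparison of
pushforwards, which does nothing to sections. -/
lemma pullbackComp_pullbackSection (g : Z ⟶ Y) (f : Y ⟶ X) {M : X.Modules} {U : X.Opens}
    (s : Γ(M, U)) :
    ((Scheme.Modules.pullbackComp g f).hom.app M).app (g ⁻¹ᵁ f ⁻¹ᵁ U)
      (pullbackSection g (pullbackSection f s)) = pullbackSection (g ≫ f) s := by
  have h := unit_conjugateEquiv
    ((Scheme.Modules.pullbackPushforwardAdjunction f).comp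
      (Scheme.Modules.pullbackPushforwardAdjunction g))
    (Scheme.Modules.pullbackPushforwardAdjunction (g ≫ f))
    (Scheme.Modules.pullbackComp g f).inv M
  rw [Scheme.Modules.conjugateEquiv_pullbackComp_inv] at h
  have h' := congrArg (fun k => Scheme.Modules.Hom.app k U s) h
  have h'' : pullbackSection g (pullbackSection f s) =
    ((Scheme.Modules.pullbackComp g f).inv.app M).app (g ⁻¹ᵁ f ⁻¹ᵁ U)
      (pullbackSection (g ≫ f) s) := h'
  rw [h'']
  exact iso_hom_app_inv_app ((Scheme.Modules.pullbackComp g f).app M) (pullbackSection (g ≫ f) s)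

end Sections

/-! ### Morphisms over an open subset, and maps out of a pullback -/

section LocalHom

variable {X Y Z : Scheme.{u}}

lemma ι_image_preimage (V W : X.Opens) : V.ι ''ᵁ V.ι ⁻¹ᵁ W = V ⊓ W := by
  rw [Scheme.Hom.image_preimage_eq_opensRange_inf, Scheme.Opens.opensRange_ι]

/-- The sheaf `W ↦ Γ(Q, V ∩ W)`. -/
def extendRestrict (V : X.Opens) (Q : X.Modules) : X.Modules :=
  (Scheme.Modules.pushforward V.ι).obj (Q.restrict V.ι)

/-- The identification of the sections of `extendRestrict V Q` over `W`. -/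
def toExtend (V : X.Opens) (Q : X.Modules) (W : X.Opens) :
    Γ(Q, V ⊓ W) →+ Γ(extendRestrict V Q, W) :=
  res Q (ι_image_preimage V W).le

/-- The identification of the sections of `extendRestrict V Q` over `W`. -/
def fromExtend (V : X.Opens) (Q : X.Modules) (W : X.Opens) :
    Γ(extendRestrict V Q, W) →+ Γ(Q, V ⊓ W) :=
  res Q (U := V.ι ''ᵁ V.ι ⁻¹ᵁ W) (ι_image_preimage V W).ge

lemma fromExtend_toExtend (V : X.Opens) (Q : X.Modules) (W : X.Opens) (s : Γ(Q, V ⊓ W)) :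
    fromExtend V Q W (toExtend V Q W s) = s := by
  refine (res_res Q _ _ s).trans (res_refl _ _ _)

lemma toExtend_fromExtend (V : X.Opens) (Q : X.Modules) (W : X.Opens)
    (s : Γ(extendRestrict V Q, W)) : toExtend V Q W (fromExtend V Q W s) = s := by
  refine (res_res Q (U := V.ι ''ᵁ V.ι ⁻¹ᵁ W) _ _ s).trans (res_refl _ _ _)

lemma toExtend_smul (V : X.Opens) (Q : X.Modules) (W : X.Opens) (r : Γ(X, W)) (s : Γ(Q, V ⊓ W)) :
    toExtend V Q W (resO (V := V ⊓ W) inf_le_right r • s) = r • toExtend V Q W s := by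
  refine (res_smul Q _ _ s).trans ?_
  rw [resO_resO]
  change _ = (V.ι.appIso (V.ι ⁻¹ᵁ W)).inv (V.ι.app W r) • res Q (ι_image_preimage V W).le s
  rw [Scheme.Opens.ι_appIso, Scheme.Opens.ι_app]
  rfl

lemma toExtend_res (V : X.Opens) (Q : X.Modules) {W' W : X.Opens} (h : W' ≤ W)
    (s : Γ(Q, V ⊓ W)) :
    toExtend V Q W' (res Q (inf_le_inf_left V h) s) =
      res (extendRestrict V Q) h (toExtend V Q W s) := by
  refine (res_res Q _ _ s).trans ?_
  refine Eq.trans ?_ (res_res Q _ (Scheme.Hom.image_mono _ (Scheme.Hom.preimage_mono _ h)) s).symm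
  rfl

lemma fromExtend_smul (V : X.Opens) (Q : X.Modules) (W : X.Opens) (r : Γ(X, W))
    (s : Γ(extendRestrict V Q, W)) :
    fromExtend V Q W (r • s) = resO (V := V ⊓ W) inf_le_right r • fromExtend V Q W s := by
  rw [← toExtend_fromExtend V Q W s, ← toExtend_smul, fromExtend_toExtend, fromExtend_toExtend]

lemma fromExtend_res (V : X.Opens) (Q : X.Modules) {W' W : X.Opens} (h : W' ≤ W)
    (s : Γ(extendRestrict V Q, W)) :
    fromExtend V Q W' (res (extendRestrict V Q) h s) =
      res Q (inf_le_inf_left V h) (fromExtend V Q W s) := by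
  rw [← toExtend_fromExtend V Q W s, ← toExtend_res, fromExtend_toExtend, fromExtend_toExtend]

/-- A morphism of modules over an open subset `V`. -/
@[ext]
structure LocalHom (V : X.Opens) (M N : X.Modules) where
  toFun (W : X.Opens) (hW : W ≤ V) : Γ(M, W) →ₗ[Γ(X, W)] Γ(N, W)
  map_res {W' W : X.Opens} (h : W' ≤ W) (hW : W ≤ V) (s : Γ(M, W)) :
    toFun W' (h.trans hW) (res M h s) = res N h (toFun W hW s)

/-- The morphism over `V` corresponding to a morphism to `extendRestrict V N`. -/
def LocalHom.ofHom {V : X.Opens} {M N : X.Modules} (g : M ⟶ extendRestrict V N) :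
    LocalHom V M N where
  toFun W hW :=
    { toFun := fun s => res N (le_inf hW le_rfl) (fromExtend V N W (g.app W s))
      map_add' := fun s t => by rw [map_add, map_add, map_add]
      map_smul' := fun r s => by
        rw [app_smul, fromExtend_smul, res_smul, resO_resO, resO_refl]; rfl }
  map_res h hW s := by
    simp only [LinearMap.coe_mk, AddHom.coe_mk]
    rw [app_res, fromExtend_res, res_res, res_res]

/-- The morphism to `extendRestrict V N` corresponding to a morphism over `V`. -/
def LocalHom.toHom {V : X.Opens} {M N : X.Modules} (H : LocalHom V M N) :
    M ⟶ extendRestrict V N :=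
  homMk (fun W =>
    { toFun := fun s => toExtend V N W (H.toFun (V ⊓ W) inf_le_left (res M inf_le_right s))
      map_add' := fun s t => by rw [map_add, map_add, map_add]
      map_smul' := fun r s => by
        rw [res_smul, map_smul, toExtend_smul]; rfl })
    (by
      intro W' W h s
      simp only [LinearMap.coe_mk, AddHom.coe_mk]
      rw [← toExtend_res, ← H.map_res, res_res, res_res])

lemma LocalHom.toHom_app {V : X.Opens} {M N : X.Modules} (H : LocalHom V M N) {W : X.Opens}
    (s : Γ(M, W)) : H.toHom.app W s =
      toExtend V N W (H.toFun (V ⊓ W) inf_le_left (res M inf_le_right s)) := rfl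

lemma LocalHom.ofHom_toHom {V : X.Opens} {M N : X.Modules} (H : LocalHom V M N) :
    LocalHom.ofHom H.toHom = H := by
  ext W hW s
  change res N _ (fromExtend V N W (H.toHom.app W s)) = _
  rw [H.toHom_app, fromExtend_toExtend, ← H.map_res, res_res, res_refl]

/-- A semilinear family of maps on sections induces a morphism from the pullback. -/
lemma exists_pullback_lift (f : Y ⟶ X) (V : Y.Opens) (M : X.Modules) (Q : Y.Modules)
    (L : ∀ W : X.Opens, Γ(M, W) →+ Γ(Q, V ⊓ f ⁻¹ᵁ W))
    (hsmul : ∀ (W : X.Opens) (r : Γ(X, W)) (s : Γ(M, W)),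
      L W (r • s) = resO (V := V ⊓ f ⁻¹ᵁ W) inf_le_right (f.app W r) • L W s)
    (hres : ∀ (W' W : X.Opens) (h : W' ≤ W) (s : Γ(M, W)),
      L W' (res M h s) = res Q (inf_le_inf_left V (f.preimage_mono h)) (L W s)) :
    ∃ H : LocalHom V ((Scheme.Modules.pullback f).obj M) Q,
      ∀ (W : X.Opens) (s : Γ(M, W)),
        H.toFun (V ⊓ f ⁻¹ᵁ W) inf_le_left (res _ inf_le_right (pullbackSection f s)) = L W s := by
  -- The family `L` is a morphism from M to f_* of the sheaf W ↦ Γ(Q, V ∩ W), so the adjunction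
  -- applies even though `V` need not be a preimage of an open subset of X.
  let g : M ⟶ (Scheme.Modules.pushforward f).obj (extendRestrict V Q) :=
    homMk (fun W =>
      { toFun := fun s => toExtend V Q (f ⁻¹ᵁ W) (L W s)
        map_add' := fun s t => by rw [map_add, map_add]; rfl
        map_smul' := fun r s => by
          rw [hsmul, toExtend_smul]; rfl })
      (by
        intro W' W h s
        change toExtend V Q (f ⁻¹ᵁ W') (L W' (res M h s)) =
          res (extendRestrict V Q) (f.preimage_mono h) (toExtend V Q (f ⁻¹ᵁ W) (L W s))
        rw [hres, toExtend_res])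
  refine ⟨LocalHom.ofHom (pullbackDesc f g), fun W s => ?_⟩
  change res Q _ (fromExtend V Q (V ⊓ f ⁻¹ᵁ W) ((pullbackDesc f g).app (V ⊓ f ⁻¹ᵁ W)
    (res _ inf_le_right (pullbackSection f s)))) = _
  rw [app_res, fromExtend_res, res_res, pullbackDesc_pullbackSection]
  refine (congrArg _ (fromExtend_toExtend V Q (f ⁻¹ᵁ W) (L W s))).trans (res_refl _ _ _)

/-- Morphisms over `V` correspond to global morphisms to `extendRestrict V Q`, to which
`pullback_hom_ext` applies. -/
lemma LocalHom.ext_pullbackSection (f : Y ⟶ X) {V : Y.Opens} {M : X.Modules} {Q : Y.Modules}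
    {H H' : LocalHom V ((Scheme.Modules.pullback f).obj M) Q}
    (h : ∀ (W : X.Opens) (s : Γ(M, W)),
      H.toFun (V ⊓ f ⁻¹ᵁ W) inf_le_left (res _ inf_le_right (pullbackSection f s)) =
        H'.toFun (V ⊓ f ⁻¹ᵁ W) inf_le_left (res _ inf_le_right (pullbackSection f s))) :
    H = H' := by
  rw [← H.ofHom_toHom, ← H'.ofHom_toHom]
  congr 1
  refine pullback_hom_ext f fun W s => ?_
  rw [H.toHom_app, H'.toHom_app, h]

end LocalHom

/-! ### Local bases of a module, and their pullback -/

section LocalBases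

variable {X Y Z : Scheme.{u}}

/-- Sections of the structure sheaf are functions. -/
def unitSections (U : X.Opens) : Γ(structureSheaf X, U) ≃ₗ[Γ(X, U)] Γ(X, U) where
  toFun s := s
  invFun s := s
  left_inv _ := rfl
  right_inv _ := rfl
  map_add' _ _ := rfl
  map_smul' _ _ := rfl

lemma unitSections_res {V U : X.Opens} (h : V ≤ U) (s : Γ(structureSheaf X, U)) :
    unitSections V (res _ h s) = resO h (unitSections U s) := rfl

lemma unitSections_symm_resO {V U : X.Opens} (h : V ≤ U) (s : Γ(X, U)) :
    (unitSections V).symm (resO h s) = res _ h ((unitSections U).symm s) := rfl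

lemma unitSections_oneSection : unitSections ⊤ (oneSection X) = 1 := rfl

/-- The sections `b j` of `M` over `U` form a basis of `M` over each open subset of `U`. -/
def IsBasisOn (M : X.Modules) (U : X.Opens) {J : Type*} [Fintype J] (b : J → Γ(M, U)) : Prop :=
  ∀ (V : X.Opens) (h : V ≤ U),
    Function.Bijective fun c : J → Γ(X, V) => ∑ j, c j • res M h (b j)

namespace IsBasisOn

variable {M N : X.Modules} {U : X.Opens} {J : Type*} [Fintype J] {b : J → Γ(M, U)}

lemma of_le (hb : IsBasisOn M U b) {V : X.Opens} (h : V ≤ U) :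
    IsBasisOn M V fun j => res M h (b j) := by
  intro W hW
  simp only [res_res]
  exact hb W (hW.trans h)

lemma reindex (hb : IsBasisOn M U b) {K : Type*} [Fintype K] (e : K ≃ J) :
    IsBasisOn M U (b ∘ e) := by
  intro W hW
  have h := (hb W hW).comp (e.arrowCongr (Equiv.refl Γ(X, W))).bijective
  convert h using 1
  ext c
  simp only [Function.comp_apply]
  rw [← Equiv.sum_comp e]
  simp [Equiv.arrowCongr]

/-- The coordinates of a section with respect to a local basis. -/
def coords (hb : IsBasisOn M U b) {V : X.Opens} (h : V ≤ U) (s : Γ(M, V)) : J → Γ(X, V) :=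
  Classical.choose ((hb V h).2 s)

lemma sum_coords (hb : IsBasisOn M U b) {V : X.Opens} (h : V ≤ U) (s : Γ(M, V)) :
    ∑ j, hb.coords h s j • res M h (b j) = s :=
  Classical.choose_spec ((hb V h).2 s)

lemma coords_unique (hb : IsBasisOn M U b) {V : X.Opens} (h : V ≤ U) {s : Γ(M, V)}
    {c : J → Γ(X, V)} (hc : ∑ j, c j • res M h (b j) = s) : hb.coords h s = c :=
  (hb V h).1 ((hb.sum_coords h s).trans hc.symm)

lemma coords_add (hb : IsBasisOn M U b) {V : X.Opens} (h : V ≤ U) (s t : Γ(M, V)) :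
    hb.coords h (s + t) = hb.coords h s + hb.coords h t := by
  apply hb.coords_unique
  simp only [Pi.add_apply, add_smul, Finset.sum_add_distrib, sum_coords]

lemma coords_smul (hb : IsBasisOn M U b) {V : X.Opens} (h : V ≤ U) (r : Γ(X, V)) (s : Γ(M, V)) :
    hb.coords h (r • s) = r • hb.coords h s := by
  apply hb.coords_unique
  simp only [Pi.smul_apply, smul_eq_mul, mul_smul, ← Finset.smul_sum, sum_coords]

lemma coords_res (hb : IsBasisOn M U b) {W V : X.Opens} (h : V ≤ U) (hW : W ≤ V) (s : Γ(M, V))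
    (j : J) : hb.coords (hW.trans h) (res M hW s) j = resO hW (hb.coords h s j) := by
  refine congrFun (hb.coords_unique (hW.trans h)
    (c := fun j => resO hW (hb.coords h s j)) ?_) j
  conv_rhs => rw [← hb.sum_coords h s]
  simp only [map_sum, res_smul, res_res]

lemma coords_basis [DecidableEq J] (hb : IsBasisOn M U b) {V : X.Opens} (h : V ≤ U) (i : J) :
    hb.coords h (res M h (b i)) = Pi.single i 1 := by
  apply hb.coords_unique
  rw [Finset.sum_eq_single i]
  · rw [Pi.single_eq_same, one_smul]
  · intro j _ hj
    rw [Pi.single_eq_of_ne hj, zero_smul]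
  · intro h
    exact absurd (Finset.mem_univ i) h

lemma isIso {M N : X.Modules} {b : J → Γ(M, ⊤)} {b' : J → Γ(N, ⊤)} (hb : IsBasisOn M ⊤ b)
    (hb' : IsBasisOn N ⊤ b') (g : M ⟶ N) (hg : ∀ j, g.app ⊤ (b j) = b' j) : IsIso g := by
  apply isIso_of_bijective
  intro V
  have h : (fun s : Γ(M, V) => g.app V s) ∘ (fun c : J → Γ(X, V) => ∑ j, c j • res M le_top (b j)) =
      fun c => ∑ j, c j • res N le_top (b' j) := by
    funext c
    simp only [Function.comp_apply, map_sum, app_smul, app_res, hg]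
  have h' := hb' V le_top
  rw [← h] at h'
  exact (Function.Bijective.of_comp_iff _ (hb V le_top)).1 h'

lemma map_iso (hb : IsBasisOn M U b) (g : M ≅ N) : IsBasisOn N U fun j => g.hom.app U (b j) := by
  intro V hV
  have h : Function.Bijective fun s : Γ(M, V) => g.hom.app V s := by
    refine ⟨fun s t hst => ?_, fun s => ⟨g.inv.app V s, ?_⟩⟩
    · have := congrArg (fun s => g.inv.app V s) hst
      simp only [← comp_app_apply, Iso.hom_inv_id] at this
      exact this
    · simp only [← comp_app_apply, Iso.inv_hom_id]
      rfl
  have h' := h.comp (hb V hV)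
  convert h' using 1
  funext c
  simp only [Function.comp_apply, map_sum, app_smul, app_res]

/-- The pullback of a local basis is a local basis. -/
lemma pullback (hb : IsBasisOn M U b) (f : Y ⟶ X) :
    IsBasisOn ((Scheme.Modules.pullback f).obj M) (f ⁻¹ᵁ U) fun j => pullbackSection f (b j) := by
  classical
  intro V hV
  have hle : ∀ W : X.Opens, V ⊓ f ⁻¹ᵁ W ≤ f ⁻¹ᵁ (U ⊓ W) := fun W => inf_le_inf_right _ hV
  -- The j-th coordinate function of `M` on U ∩ W, followed by pullback of functions, is semilinear,
  -- so it extends to a functional on f^* M over `V`.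
  have key : ∀ j : J, ∃ H : LocalHom V ((Scheme.Modules.pullback f).obj M) (structureSheaf Y),
      ∀ (W : X.Opens) (s : Γ(M, W)),
        unitSections _
          (H.toFun (V ⊓ f ⁻¹ᵁ W) inf_le_left (res _ inf_le_right (pullbackSection f s))) =
          resO (hle W) (f.app (U ⊓ W) (hb.coords (V := U ⊓ W) inf_le_left
            (res M inf_le_right s) j)) := by
    intro j
    let L : ∀ W : X.Opens, Γ(M, W) →+ Γ(structureSheaf Y, V ⊓ f ⁻¹ᵁ W) := fun W =>
      AddMonoidHom.mk' (fun s => (unitSections _).symm (resO (hle W) (f.app (U ⊓ W)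
        (hb.coords (V := U ⊓ W) inf_le_left (res M inf_le_right s) j)))) (by
          intro s t
          simp only [map_add, coords_add, Pi.add_apply])
    have hL : ∀ W s, L W s = (unitSections _).symm (resO (hle W) (f.app (U ⊓ W)
        (hb.coords (V := U ⊓ W) inf_le_left (res M inf_le_right s) j))) := fun _ _ => rfl
    suffices h : _ ∧ _ by
      obtain ⟨H, hH⟩ := exists_pullback_lift f V M (structureSheaf Y) L h.1 h.2
      exact ⟨H, fun W s => (congrArg _ (hH W s)).trans (LinearEquiv.apply_symm_apply _ _)⟩
    constructor
    · intro W r s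
      rw [hL, hL, ← LinearEquiv.map_smul, res_smul, coords_smul, Pi.smul_apply, smul_eq_mul,
        map_mul, map_mul, ← resO_app, resO_resO, smul_eq_mul]
    · intro W' W h s
      have h1 := hb.coords_res (V := U ⊓ W) inf_le_left (inf_le_inf_left U h)
        (res M inf_le_right s) j
      rw [res_res] at h1
      rw [hL, hL, res_res, h1, ← resO_app, resO_resO, ← unitSections_symm_resO, resO_resO]
  choose H hH using key
  -- The extended functionals are dual to the pulled back basis; this yields linear independence.
  have hHb : ∀ i j, unitSections V ((H i).toFun V le_rfl (res _ hV (pullbackSection f (b j)))) =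
      (Pi.single j 1 : J → Γ(Y, V)) i := by
    intro i j
    have h1 := (H i).map_res (le_inf le_rfl hV : V ≤ V ⊓ f ⁻¹ᵁ U) inf_le_left
      (res _ inf_le_right (pullbackSection f (b j)))
    rw [res_res] at h1
    rw [h1, unitSections_res, hH, hb.coords_basis]
    by_cases hij : i = j
    · subst hij
      simp only [Pi.single_eq_same, map_one]
    · simp only [Pi.single_eq_of_ne hij, map_zero]
  constructor
  · intro c c' hcc
    funext i
    have h := congrArg (fun s => unitSections V ((H i).toFun V le_rfl s)) hcc
    simpa only [map_sum, map_smul, hHb, smul_eq_mul, Pi.single_apply, mul_ite, mul_one, mul_zero,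
      Finset.sum_ite_eq, Finset.mem_univ, if_true] using h
  · intro s
    -- For spanning, the operator s ↦ ∑ H_j(s) f^* b_j is compared with the identity; they agree on
    -- pulled back sections, hence everywhere.
    let R : LocalHom V ((Scheme.Modules.pullback f).obj M) ((Scheme.Modules.pullback f).obj M) :=
      { toFun := fun W hW => ∑ j, LinearMap.smulRight
          ((unitSections W).toLinearMap ∘ₗ (H j).toFun W hW)
          (res _ (hW.trans hV) (pullbackSection f (b j)))
        map_res := by
          intro W' W h hW s
          simp only [LinearMap.coe_sum, Finset.sum_apply, LinearMap.smulRight_apply,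
            LinearMap.comp_apply, LinearEquiv.coe_coe, map_sum, res_smul, res_res]
          exact Finset.sum_congr rfl fun j _ => by rw [(H j).map_res h hW, unitSections_res] }
    have hRapp : ∀ W hW s, R.toFun W hW s = ∑ j, unitSections W ((H j).toFun W hW s) •
        res _ (hW.trans hV) (pullbackSection f (b j)) := by
      intro W hW s
      simp only [R, LinearMap.coe_sum, Finset.sum_apply, LinearMap.smulRight_apply,
            LinearMap.comp_apply, LinearEquiv.coe_coe]
    let I : LocalHom V ((Scheme.Modules.pullback f).obj M) ((Scheme.Modules.pullback f).obj M) :=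
      { toFun := fun W hW => LinearMap.id
        map_res := fun _ _ _ => rfl }
    have hR : R = I := by
      apply LocalHom.ext_pullbackSection f
      intro W s
      have h1 := congrArg (fun m => res _ (hle W) (pullbackSection f m))
        (hb.sum_coords (V := U ⊓ W) inf_le_left (res M inf_le_right s))
      simp only [pullbackSection_sum, map_sum, pullbackSection_smul, res_smul,
        pullbackSection_res, res_res] at h1
      simp only [hRapp, hH]
      exact h1
    refine ⟨fun j => unitSections V ((H j).toFun V le_rfl s), ?_⟩
    have h := congrArg (fun R => LocalHom.toFun R V le_rfl s) hR
    rw [hRapp] at h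
    exact h

end IsBasisOn

end LocalBases

/-! ### Finite local freeness in terms of local bases -/

section LocallyFree

variable {X Y Z : Scheme.{u}}

/-- The free module on a finite set, with its basis. -/
def freeModule (X : Scheme.{u}) (J : Type u) : X.Modules :=
  (SheafOfModules.free (R := X.ringCatSheaf) J : X.Modules)

/-- The inclusions of the summands of a free module. -/
def freeInj (X : Scheme.{u}) {J : Type u} (j : J) : structureSheaf X ⟶ freeModule X J :=
  Limits.Sigma.ι (C := X.Modules) (fun _ : J => structureSheaf X) j

/-- Morphisms from a free module. -/
def freeDesc {J : Type u} {M : X.Modules} (g : J → (structureSheaf X ⟶ M)) : freeModule X J ⟶ M :=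
  Limits.Sigma.desc (C := X.Modules) (f := fun _ : J => structureSheaf X) g

@[simp]
lemma freeInj_freeDesc {J : Type u} {M : X.Modules} (g : J → (structureSheaf X ⟶ M)) (j : J) :
    freeInj X j ≫ freeDesc g = g j :=
  Limits.Sigma.ι_desc (C := X.Modules) (f := fun _ : J => structureSheaf X) g j

lemma freeModule_hom_ext {J : Type u} {M : X.Modules} {g h : freeModule X J ⟶ M}
    (H : ∀ j, freeInj X j ≫ g = freeInj X j ≫ h) : g = h :=
  Limits.Sigma.hom_ext (C := X.Modules) (β := J) (f := fun _ : J => structureSheaf X)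
    (show (∐ fun _ : J => structureSheaf X) ⟶ M from g) h H

/-- The morphism from the structure sheaf given by a global section. -/
def unitDesc {M : X.Modules} (s : Γ(M, ⊤)) : structureSheaf X ⟶ M :=
  homMk (fun U => LinearMap.smulRight (unitSections U).toLinearMap (res M le_top s)) (by
    intro V U h c
    simp only [LinearMap.smulRight_apply, LinearEquiv.coe_coe, res_smul, res_res, unitSections_res])

lemma unitDesc_app {M : X.Modules} (s : Γ(M, ⊤)) {U : X.Opens} (c : Γ(structureSheaf X, U)) :
    (unitDesc s).app U c = unitSections U c • res M le_top s := rfl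

lemma unitDesc_oneSection {M : X.Modules} (s : Γ(M, ⊤)) :
    (unitDesc s).app ⊤ (oneSection X) = s := by
  rw [unitDesc_app, unitSections_oneSection, one_smul, res_refl]

lemma section_eq_smul_one {U : X.Opens} (s : Γ(structureSheaf X, U)) :
    s = unitSections U s • res (structureSheaf X) le_top (oneSection X) := by
  apply (unitSections U).injective
  rw [map_smul, unitSections_res, unitSections_oneSection, map_one, smul_eq_mul, mul_one]

lemma unit_hom_app {M : X.Modules} (g : structureSheaf X ⟶ M) {U : X.Opens}
    (s : Γ(structureSheaf X, U)) :
    g.app U s = unitSections U s • res M le_top (g.app ⊤ (oneSection X)) := by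
  conv_lhs => rw [section_eq_smul_one s]
  rw [app_smul, app_res]

/-- The basis of a free module. -/
def freeBasis (X : Scheme.{u}) {J : Type u} (j : J) : Γ(freeModule X J, ⊤) :=
  (freeInj X j).app ⊤ (oneSection X)

/-- A finite coproduct is a biproduct: the projections `π i` read off coordinates, and ∑ π_i ι_i = 1
shows that the basis spans. -/
lemma freeModule_isBasisOn (X : Scheme.{u}) (J : Type u) [Fintype J] :
    IsBasisOn (freeModule X J) ⊤ (freeBasis X (J := J)) := by
  classical
  let π : J → (freeModule X J ⟶ structureSheaf X) := fun i =>
    freeDesc fun j => if i = j then 𝟙 _ else 0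
  have hπ : ∀ i j, freeInj X j ≫ π i = if i = j then 𝟙 _ else 0 := fun i j =>
    freeInj_freeDesc _ _
  have hsum : ∑ i, π i ≫ freeInj X i = 𝟙 (freeModule X J) := by
    refine freeModule_hom_ext fun j => ?_
    rw [Preadditive.comp_sum, Finset.sum_eq_single j]
    · rw [← Category.assoc, hπ, if_pos rfl, Category.id_comp, Category.comp_id]
    · intro i _ hi
      rw [← Category.assoc, hπ, if_neg hi, Limits.zero_comp]
    · intro h
      exact absurd (Finset.mem_univ j) h
  intro V hV
  constructor
  · intro c c' hcc
    funext i
    have h := congrArg (fun s => unitSections V ((π i).app V s)) hcc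
    have h1 : ∀ j, unitSections V ((π i).app V (res _ hV (freeBasis X j))) =
        if i = j then 1 else 0 := by
      intro j
      rw [app_res, freeBasis, ← comp_app_apply, hπ]
      split_ifs
      · rw [id_app_apply, unitSections_res, unitSections_oneSection, map_one]
      · rw [zero_app_apply, map_zero, map_zero]
    simpa only [map_sum, app_smul, map_smul, h1, smul_eq_mul, mul_ite, mul_one, mul_zero,
      Finset.sum_ite_eq, Finset.mem_univ, if_true] using h
  · intro s
    refine ⟨fun i => unitSections V ((π i).app V s), ?_⟩
    have h := congrArg (fun g => Scheme.Modules.Hom.app g V s) hsum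
    simp only [sum_app_apply, id_app_apply, comp_app_apply] at h
    refine Eq.trans (Finset.sum_congr rfl fun i _ => ?_) h
    rw [unit_hom_app (freeInj X i)]
    rfl

/-- Sections of a restriction. -/
def restrictSections (M : X.Modules) (U : X.Opens) (V : (U : Scheme.{u}).Opens) :
    Γ(M, U.ι ''ᵁ V) ≃+ Γ(M.restrict U.ι, V) := AddEquiv.refl _

lemma restrictSections_smul (M : X.Modules) (U : X.Opens) (V : (U : Scheme.{u}).Opens)
    (r : Γ(X, U.ι ''ᵁ V)) (s : Γ(M, U.ι ''ᵁ V)) :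
    restrictSections M U V (r • s) =
      (show Γ((U : Scheme.{u}), V) from r) • restrictSections M U V s := by
  change _ = (U.ι.appIso V).inv r • s
  rw [Scheme.Opens.ι_appIso]
  rfl

/-- Open subsets of the scheme `U` are the open subsets of `X` inside `U`, with the same sections.
The sections `b` live over `U.ι ''ᵁ ⊤`, which equals `U` but is the form in which sections of the
restriction arise. -/
lemma isBasisOn_restrict_iff {M : X.Modules} {U : X.Opens} {J : Type*} [Fintype J]
    (b : J → Γ(M, U.ι ''ᵁ ⊤)) :
    IsBasisOn (M.restrict U.ι) ⊤ (fun j => restrictSections M U ⊤ (b j)) ↔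
      IsBasisOn M (U.ι ''ᵁ ⊤) b := by
  have key : ∀ (V : (U : Scheme.{u}).Opens),
      (Function.Bijective fun c : J → Γ(X, U.ι ''ᵁ V) =>
        ∑ j, c j • res M (U.ι.image_mono (le_top : V ≤ ⊤)) (b j)) ↔
      (Function.Bijective fun c : J → Γ((U : Scheme.{u}), V) =>
        ∑ j, c j • res (M.restrict U.ι) (le_top : V ≤ ⊤) (restrictSections M U ⊤ (b j))) := by
    intro V
    rw [← Function.Bijective.of_comp_iff' (restrictSections M U V).bijective]
    apply iff_of_eq
    refine congrArg Function.Bijective (funext fun c => ?_)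
    simp only [Function.comp_apply, map_sum, restrictSections_smul]
    rfl
  constructor
  · intro h V hV
    obtain ⟨V', rfl⟩ : ∃ V', V = U.ι ''ᵁ V' := by
      refine ⟨U.ι ⁻¹ᵁ V, ?_⟩
      rw [Scheme.Hom.image_preimage_eq_opensRange_inf, Scheme.Opens.opensRange_ι]
      rw [Scheme.Opens.ι_image_top] at hV
      exact (inf_eq_right.2 hV).symm
    exact (key V').2 (h V' le_top)
  · intro h V hV
    exact (key V).1 (h (U.ι ''ᵁ V) (U.ι.image_mono le_top))

/-- Together with `isFiniteLocallyFree_of_exists_basis` this replaces local isomorphisms with free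
modules by explicit local bases. -/
lemma IsFiniteLocallyFree.exists_basis {M : X.Modules} (hM : IsFiniteLocallyFree M) (x : X) :
    ∃ U : X.Opens, x ∈ U ∧ ∃ (n : ℕ) (b : Fin n → Γ(M, U)), IsBasisOn M U b := by
  obtain ⟨U, hxU, n, ⟨i⟩⟩ := hM x
  refine ⟨U.ι ''ᵁ ⊤, by rwa [Scheme.Opens.ι_image_top], n, ?_⟩
  have h := ((freeModule_isBasisOn U (ULift.{u} (Fin n))).map_iso
    (N := M.restrict U.ι) i.symm).reindex Equiv.ulift.symm
  exact ⟨fun j => (restrictSections M U ⊤).symm (i.inv.app ⊤ (freeBasis _ (Equiv.ulift.symm j))),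
    (isBasisOn_restrict_iff _).1 h⟩

lemma IsBasisOn.nonempty_iso {M : X.Modules} {n : ℕ} {b : Fin n → Γ(M, ⊤)}
    (hb : IsBasisOn M ⊤ b) : Nonempty (M ≅ freeModule X (ULift.{u} (Fin n))) := by
  let g : freeModule X (ULift.{u} (Fin n)) ⟶ M := freeDesc fun j => unitDesc (b j.down)
  have : IsIso g := by
    refine (freeModule_isBasisOn X _).isIso (hb.reindex Equiv.ulift) g fun j => ?_
    rw [freeBasis, ← comp_app_apply, freeInj_freeDesc, unitDesc_oneSection]
    rfl
  exact ⟨(asIso g).symm⟩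

lemma isFiniteLocallyFree_of_exists_basis {M : X.Modules}
    (h : ∀ x : X, ∃ U : X.Opens, x ∈ U ∧ ∃ (n : ℕ) (b : Fin n → Γ(M, U)), IsBasisOn M U b) :
    IsFiniteLocallyFree M := by
  intro x
  obtain ⟨U, hxU, n, b, hb⟩ := h x
  have h1 : IsBasisOn (M.restrict U.ι) ⊤ fun j =>
      restrictSections M U ⊤ (res M (Scheme.Opens.ι_image_top U).le (b j)) :=
    (isBasisOn_restrict_iff _).2 (hb.of_le (Scheme.Opens.ι_image_top U).le)
  exact ⟨U, hxU, n, h1.nonempty_iso⟩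

lemma IsFiniteLocallyFree.exists_affine_basis {M : X.Modules} (hM : IsFiniteLocallyFree M)
    (x : X) : ∃ U : X.Opens, x ∈ U ∧ IsAffineOpen U ∧
      ∃ (n : ℕ) (b : Fin n → Γ(M, U)), IsBasisOn M U b := by
  obtain ⟨U, hxU, n, b, hb⟩ := hM.exists_basis x
  obtain ⟨V, hV, hxV, hVU⟩ := TopologicalSpace.Opens.isBasis_iff_nbhd.1 X.isBasis_affineOpens hxU
  exact ⟨V, hxV, hV, n, _, hb.of_le hVU⟩

end LocallyFree

/-! ### Direct summands of finite locally free modules -/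

section Summand

variable {X Y Z : Scheme.{u}}

/-- Coordinates change by `D`, whose determinant remains a unit after restriction to any smaller
open set. -/
lemma IsBasisOn.of_det {M : X.Modules} {U : X.Opens} {J : Type*} [Fintype J] [DecidableEq J]
    {b : J → Γ(M, U)} (hb : IsBasisOn M U b) (D : Matrix J J Γ(X, U)) (hD : IsUnit D.det) :
    IsBasisOn M U fun j => ∑ i, D i j • b i := by
  intro V hV
  let D' : Matrix J J Γ(X, V) := D.map (resO hV)
  have hD' : IsUnit D' := by
    rw [Matrix.isUnit_iff_isUnit_det]
    have h := hD.map (resO hV)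
    rwa [RingHom.map_det] at h
  have h1 : Function.Bijective D'.mulVec := by
    obtain ⟨u, hu⟩ := hD'
    rw [← hu]
    refine ⟨fun v w h => ?_, fun v => ⟨(u⁻¹ : (Matrix J J Γ(X, V))ˣ).val.mulVec v, ?_⟩⟩
    · have h2 := congrArg (fun v => (u⁻¹ : (Matrix J J Γ(X, V))ˣ).val.mulVec v) h
      simpa only [Matrix.mulVec_mulVec, Units.inv_mul, Matrix.one_mulVec] using h2
    · simp only [Matrix.mulVec_mulVec, Units.mul_inv, Matrix.one_mulVec]
  have h2 := (hb V hV).comp h1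
  convert h2 using 1
  funext c
  simp only [Function.comp_apply, Matrix.mulVec, dotProduct, map_sum, res_smul, Finset.smul_sum,
    Finset.sum_smul, D', Matrix.map_apply, smul_smul]
  rw [Finset.sum_comm]
  simp only [mul_comm]

/-- A spanning family contains a basis, and a basis of K^n has n members. -/
lemma exists_det_ne_zero {K : Type*} [Field K] {n : ℕ} {P : Type*}
    (v : P → (Fin n → K)) (hv : Submodule.span K (Set.range v) = ⊤) :
    ∃ σ : Fin n → P, (Matrix.of fun i j => v (σ j) i).det ≠ 0 := by
  obtain ⟨κ, a, -, hspan, hli⟩ := exists_linearIndependent' K v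
  rw [hv] at hspan
  let B := Module.Basis.mk hli hspan.ge
  let e := (Pi.basisFun K (Fin n)).indexEquiv B
  refine ⟨a ∘ e, ?_⟩
  have h : LinearIndependent K (fun j => v (a (e j))) := hli.comp e e.injective
  have h1 : IsUnit (Matrix.of fun i j => v ((a ∘ e) j) i) :=
    Matrix.linearIndependent_cols_iff_isUnit.1 h
  exact ((Matrix.isUnit_iff_isUnit_det _).1 h1).ne_zero

/-- A direct summand of a finite locally free module is finite locally free. -/
lemma IsFiniteLocallyFree.of_retract {M N : X.Modules} (hM : IsFiniteLocallyFree M)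
    (i : N ⟶ M) (p : M ⟶ N) (hip : i ≫ p = 𝟙 N) : IsFiniteLocallyFree N := by
  classical
  refine isFiniteLocallyFree_of_exists_basis fun x => ?_
  obtain ⟨U, hxU, n, b, hb⟩ := hM.exists_basis x
  have hpi : ∀ (V : X.Opens) (s : Γ(N, V)), p.app V (i.app V s) = s := fun V s => by
    rw [← comp_app_apply, hip, id_app_apply]
  -- The coordinates of the images of the basis under the idempotent p ≫ i of `M`.
  let a : Fin n → Fin n → Γ(X, U) := fun j => hb.coords le_rfl (i.app U (p.app U (b j)))
  have ha : ∀ j, ∑ k, a j k • b k = i.app U (p.app U (b j)) := fun j => by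
    have h := hb.sum_coords le_rfl (i.app U (p.app U (b j)))
    simpa only [res_refl] using h
  -- Coordinate vectors of the images of the basis under the idempotent (left) and under its
  -- complement (right).
  let v : Fin n ⊕ Fin n → (Fin n → Γ(X, U)) := Sum.elim a (fun j => Pi.single j 1 - a j)
  let w : Fin n ⊕ Fin n → Γ(M, U) :=
    Sum.elim (fun j => i.app U (p.app U (b j))) (fun j => b j - i.app U (p.app U (b j)))
  have hvw : ∀ j, ∑ k, v j k • b k = w j := by
    rintro (j | j)
    · exact ha j
    · simp only [v, w, Sum.elim_inr, Pi.sub_apply, sub_smul, Finset.sum_sub_distrib, ha,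
        Pi.single_apply, ite_smul, one_smul, zero_smul, Finset.sum_ite_eq', Finset.mem_univ,
        if_true]
  let ev : Γ(X, U) →+* X.residueField x := (X.evaluation U x hxU).hom
  -- Each unit vector is the sum of a left and a right vector, so these 2n vectors span over the
  -- residue field at x, and n of them form a basis there.
  obtain ⟨σ, hσ⟩ := exists_det_ne_zero (fun j k => ev (v j k)) (by
    rw [← top_le_iff, ← (Pi.basisFun (X.residueField x) (Fin n)).span_eq, Submodule.span_le]
    rintro _ ⟨j, rfl⟩
    have h : Pi.basisFun (X.residueField x) (Fin n) j =
        (fun k => ev (v (Sum.inl j) k)) + (fun k => ev (v (Sum.inr j) k)) := by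
      funext k
      simp only [Pi.basisFun_apply, Pi.add_apply, v, Sum.elim_inl, Sum.elim_inr, Pi.sub_apply,
        map_sub, add_sub_cancel, Pi.single_apply]
      split_ifs <;> simp
    rw [h]
    exact Submodule.add_mem _ (Submodule.subset_span ⟨_, rfl⟩) (Submodule.subset_span ⟨_, rfl⟩))
  let D : Matrix (Fin n) (Fin n) Γ(X, U) := Matrix.of fun k j => v (σ j) k
  have hD : ev D.det ≠ 0 := by
    rw [RingHom.map_det]
    exact hσ
  -- The determinant is nonzero at x, hence invertible on this neighbourhood, where the n selected
  -- sections therefore form a basis of `M`.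
  let V := X.basicOpen D.det
  have hVU : V ≤ U := X.basicOpen_le D.det
  have hxV : x ∈ V := (Scheme.evaluation_ne_zero_iff_mem_basicOpen X x hxU D.det).1 hD
  have hw : IsBasisOn M V fun j => res M hVU (w (σ j)) := by
    have h := (hb.of_le hVU).of_det (D.map (resO hVU)) (by
      have h := X.toRingedSpace.isUnit_res_basicOpen D.det
      have h1 : (D.map (resO hVU)).det = resO hVU D.det := (RingHom.map_det _ _).symm
      rw [h1]
      exact h)
    simpa only [Matrix.map_apply, ← res_smul, ← map_sum, D, Matrix.of_apply, hvw] using h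
  -- The selected sections that come from the image of the idempotent. They give the basis of `N`,
  -- because `p` kills all the other selected sections.
  let J := {j : Fin n // (σ j).isLeft}
  have hwJ : ∀ j : J, ∃ k, σ j.1 = Sum.inl k := fun j => Sum.isLeft_iff.1 j.2
  have hN : IsBasisOn N V fun j : J => res N hVU (p.app U (w (σ j.1))) := by
    intro W hW
    simp only [res_res]
    have hiw : ∀ j : J, i.app W (res N (hW.trans hVU) (p.app U (w (σ j.1)))) =
        res M (hW.trans hVU) (w (σ j.1)) := by
      intro j
      obtain ⟨k, hk⟩ := hwJ j
      rw [app_res]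
      simp only [hk, w, Sum.elim_inl, hpi]
    have hpw : ∀ j : Fin n, ¬ (σ j).isLeft → p.app U (w (σ j)) = 0 := by
      intro j hj
      obtain ⟨k, hk⟩ := Sum.isRight_iff.1 (Sum.not_isLeft.1 hj)
      simp only [hk, w, Sum.elim_inr, map_sub, hpi, sub_self]
    have hext : ∀ {A : Type u} [AddCommGroup A] (g : Fin n → A),
        (∀ j, ¬ (σ j).isLeft → g j = 0) → ∑ j, g j = ∑ j : J, g j.1 := by
      intro A _ g hg
      rw [← Finset.sum_filter_of_ne (p := fun j => (σ j).isLeft)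
        (fun j _ h => by_contra fun h' => h (hg j h'))]
      exact Finset.sum_subtype _ (by simp) g
    constructor
    · intro c c' hcc
      have h1 := congrArg (fun s => i.app W s) hcc
      simp only [map_sum, app_smul, hiw] at h1
      let ex : (J → Γ(X, W)) → Fin n → Γ(X, W) := fun c j =>
        if h : (σ j).isLeft then c ⟨j, h⟩ else 0
      have hex : ∀ c, ∑ j, ex c j • res M hW (res M hVU (w (σ j))) =
          ∑ j : J, c j • res M (hW.trans hVU) (w (σ j.1)) := by
        intro c
        rw [hext]
        · refine Finset.sum_congr rfl fun j _ => ?_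
          simp only [ex, dif_pos j.2, res_res]
          rfl
        · intro j hj
          simp only [ex, dif_neg hj, zero_smul]
      have h2 := (hw W hW).1 (a₁ := ex c) (a₂ := ex c') (by
        simp only [hex, h1])
      funext j
      have h3 := congrFun h2 j.1
      simpa only [ex, dif_pos j.2] using h3
    · intro s
      refine ⟨fun j => hw.coords hW (i.app W s) j.1, ?_⟩
      have h1 := congrArg (fun s => p.app W s) (hw.sum_coords hW (i.app W s))
      simp only [map_sum, app_smul, hpi, app_res, res_res] at h1
      rw [hext] at h1
      · exact h1
      · intro j hj
        rw [hpw j hj, map_zero, smul_zero]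
  exact ⟨V, hxV, Fintype.card J, _, hN.reindex (Fintype.equivFin J).symm⟩

end Summand

/-! ### Pullback of bilinear maps -/

section PairingPullback

variable {X Y Z : Scheme.{u}}

lemma Pairing.res_toFun {M N P : X.Modules} (β : Pairing M N P) {V U : X.Opens} (h : V ≤ U)
    (m : Γ(M, U)) (n : Γ(N, U)) :
    res P h (β.toFun U m n) = β.toFun V (res M h m) (res N h n) :=
  β.map_restrict (homOfLE h) m n

/-- The pullback of a bilinear map with the first variable a pulled back section. -/
lemma Pairing.exists_partial_pullback (f : Y ⟶ X) {M N P : X.Modules} (β : Pairing M N P)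
    {W : X.Opens} (m : Γ(M, W)) :
    ∃ H : LocalHom (f ⁻¹ᵁ W) ((Scheme.Modules.pullback f).obj N)
        ((Scheme.Modules.pullback f).obj P),
      ∀ (W' : X.Opens) (n : Γ(N, W')),
        H.toFun (f ⁻¹ᵁ W ⊓ f ⁻¹ᵁ W') inf_le_left (res _ inf_le_right (pullbackSection f n)) =
          pullbackSection f (U := W ⊓ W')
            (β.toFun (W ⊓ W') (res M inf_le_left m) (res N inf_le_right n)) := by
  let L : ∀ W' : X.Opens, Γ(N, W') →+
      Γ((Scheme.Modules.pullback f).obj P, f ⁻¹ᵁ W ⊓ f ⁻¹ᵁ W') := fun W' =>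
    AddMonoidHom.mk' (fun n => pullbackSection f (U := W ⊓ W')
      (β.toFun (W ⊓ W') (res M inf_le_left m) (res N inf_le_right n))) (by
        intro s t
        simp only [map_add]
        exact pullbackSection_add f _ _)
  have hL : ∀ W' n, L W' n = pullbackSection f (U := W ⊓ W')
      (β.toFun (W ⊓ W') (res M inf_le_left m) (res N inf_le_right n)) := fun _ _ => rfl
  refine exists_pullback_lift f (f ⁻¹ᵁ W) N _ L ?_ ?_
  · intro W' r s
    rw [hL, hL, res_smul, map_smul]
    refine (pullbackSection_smul f _ _).trans ?_
    rw [← resO_app]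
    rfl
  · intro W₁ W₂ h s
    rw [hL, hL, res_res]
    refine Eq.trans ?_ (pullbackSection_res f (inf_le_inf_left W h) _)
    rw [Pairing.res_toFun, res_res, res_res]

/-- The restriction of a morphism over an open set to a smaller one. -/
def LocalHom.restrict {V : X.Opens} {M N : X.Modules} (H : LocalHom V M N) {V' : X.Opens}
    (h : V' ≤ V) : LocalHom V' M N where
  toFun W hW := H.toFun W (hW.trans h)
  map_res h' hW s := H.map_res h' (hW.trans h) s

/-- Linear combinations of morphisms over an open set. -/
def LocalHom.lin {V : X.Opens} {M N : X.Modules} (H H' : LocalHom V M N) (r : Γ(X, V)) :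
    LocalHom V M N where
  toFun W hW := H.toFun W hW + resO hW r • H'.toFun W hW
  map_res h' hW s := by
    simp only [LinearMap.add_apply, LinearMap.smul_apply, map_add, res_smul, resO_resO,
      LocalHom.map_res _ h' hW]

lemma LocalHom.lin_toFun {V : X.Opens} {M N : X.Modules} (H H' : LocalHom V M N) (r : Γ(X, V))
    (W : X.Opens) (hW : W ≤ V) (s : Γ(M, W)) :
    (H.lin H' r).toFun W hW s = H.toFun W hW s + resO hW r • H'.toFun W hW s := rfl

/-- The pullback of a bilinear map of modules. -/
lemma Pairing.exists_pullback (f : Y ⟶ X) {M N P : X.Modules} (β : Pairing M N P) :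
    ∃ β' : Pairing ((Scheme.Modules.pullback f).obj M) ((Scheme.Modules.pullback f).obj N)
      ((Scheme.Modules.pullback f).obj P), β.IsPullback f β' := by
  -- The pullback is built one variable at a time: `A W m` is the map f^* N → f^* P obtained by
  -- pairing with the fixed section `m`.
  choose A hA using fun (W : X.Opens) (m : Γ(M, W)) => β.exists_partial_pullback f m
  have hA_lin : ∀ (W : X.Opens) (r : Γ(X, W)) (m m' : Γ(M, W)),
      A W (m + r • m') = (A W m).lin (A W m') (f.app W r) := by
    intro W r m m'
    apply LocalHom.ext_pullbackSection f
    intro W' n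
    rw [LocalHom.lin_toFun, hA, hA, hA, map_add, res_smul, map_add, map_smul]
    refine (pullbackSection_add f _ _).trans ?_
    congr 1
    refine (pullbackSection_smul f _ _).trans ?_
    rw [← resO_app]
    rfl
  have hA_res : ∀ (W' W : X.Opens) (h : W' ≤ W) (m : Γ(M, W)),
      A W' (res M h m) = (A W m).restrict (f.preimage_mono h) := by
    intro W₁ W h m
    apply LocalHom.ext_pullbackSection f
    intro W' n
    rw [hA, res_res]
    have h1 := (A W m).map_res (W' := f ⁻¹ᵁ W₁ ⊓ f ⁻¹ᵁ W')
      (inf_le_inf_right _ (f.preimage_mono h)) inf_le_left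
      (res _ inf_le_right (pullbackSection f n))
    rw [res_res, hA] at h1
    refine Eq.trans ?_ h1.symm
    refine Eq.trans ?_ (pullbackSection_res f (inf_le_inf_right W' h) _)
    rw [Pairing.res_toFun, res_res, res_res]
  -- Now an arbitrary section `n` of f^* N is fixed, and `m ↦ A W m n`, which is semilinear in `m`,
  -- is extended to f^* M.
  have key : ∀ (V : Y.Opens) (n : Γ((Scheme.Modules.pullback f).obj N, V)),
      ∃ H : LocalHom V ((Scheme.Modules.pullback f).obj M) ((Scheme.Modules.pullback f).obj P),
      ∀ (W : X.Opens) (m : Γ(M, W)),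
        H.toFun (V ⊓ f ⁻¹ᵁ W) inf_le_left (res _ inf_le_right (pullbackSection f m)) =
          (A W m).toFun (V ⊓ f ⁻¹ᵁ W) inf_le_right (res _ inf_le_left n) := by
    intro V n
    let L : ∀ W : X.Opens, Γ(M, W) →+ Γ((Scheme.Modules.pullback f).obj P, V ⊓ f ⁻¹ᵁ W) :=
      fun W => AddMonoidHom.mk'
        (fun m => (A W m).toFun (V ⊓ f ⁻¹ᵁ W) inf_le_right (res _ inf_le_left n)) (by
          intro s t
          have h := hA_lin W 1 s t
          rw [one_smul] at h
          rw [h, LocalHom.lin_toFun, map_one, map_one, one_smul])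
    have hL : ∀ W m, L W m =
      (A W m).toFun (V ⊓ f ⁻¹ᵁ W) inf_le_right (res _ inf_le_left n) := fun _ _ => rfl
    refine exists_pullback_lift f V M _ L ?_ ?_
    · intro W r s
      have h := hA_lin W r 0 s
      have h0 : L W 0 = 0 := map_zero _
      rw [hL] at h0
      rw [zero_add] at h
      rw [hL, hL, h, LocalHom.lin_toFun, h0, zero_add]
    · intro W' W h s
      rw [hL, hL, hA_res W' W h, ← LocalHom.map_res, res_res]
      rfl
  choose B hB using key
  have hB_lin : ∀ (V : Y.Opens) (r : Γ(Y, V)) (n n' : Γ((Scheme.Modules.pullback f).obj N, V)),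
      B V (n + r • n') = (B V n).lin (B V n') r := by
    intro V r n n'
    apply LocalHom.ext_pullbackSection f
    intro W m
    rw [LocalHom.lin_toFun, hB, hB, hB, map_add, res_smul, map_add, map_smul]
  have hB_res : ∀ (V' V : Y.Opens) (h : V' ≤ V) (n : Γ((Scheme.Modules.pullback f).obj N, V)),
      B V' (res _ h n) = (B V n).restrict h := by
    intro V' V h n
    apply LocalHom.ext_pullbackSection f
    intro W m
    have h1 := (B V n).map_res (W' := V' ⊓ f ⁻¹ᵁ W) (inf_le_inf_right _ h) inf_le_left
      (res _ inf_le_right (pullbackSection f m))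
    rw [res_res, hB, ← LocalHom.map_res, res_res] at h1
    rw [hB, res_res]
    exact h1.symm
  refine ⟨⟨fun V => LinearMap.mk₂ Γ(Y, V) (fun m n => (B V n).toFun V le_rfl m)
    (fun m m' n => map_add _ _ _) (fun r m n => map_smul _ _ _) (fun m n n' => ?_)
    (fun r m n => ?_), fun {V' V} i m n => ?_⟩, fun U m n => ?_⟩
  · have h := hB_lin V 1 n n'
    rw [one_smul] at h
    rw [h, LocalHom.lin_toFun, map_one, one_smul]
  · have h := hB_lin V r 0 n
    -- Linearity at zero sections reads B(0) = B(0) + B(0), so B(0) = 0.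
    have h0 := congrArg (fun H => LocalHom.toFun H V le_rfl m) (hB_lin V 1 0 0)
    simp only [LocalHom.lin_toFun, one_smul, add_zero, map_one, left_eq_add] at h0
    rw [zero_add] at h
    rw [h, LocalHom.lin_toFun, h0, zero_add, resO_refl]
  · simp only [LinearMap.mk₂_apply]
    change res _ (leOfHom i) ((B V n).toFun V le_rfl m) =
      (B V' (res _ (leOfHom i) n)).toFun V' le_rfl (res _ (leOfHom i) m)
    rw [hB_res V' V (leOfHom i) n, ← LocalHom.map_res]
    rfl
  · simp only [LinearMap.mk₂_apply]
    have hle : f ⁻¹ᵁ U ≤ f ⁻¹ᵁ U ⊓ f ⁻¹ᵁ U := le_inf le_rfl le_rfl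
    have h := (hB (f ⁻¹ᵁ U) (pullbackSection f n) U m).trans (hA U m U n)
    have h1 := congrArg (res _ hle) h
    rw [← LocalHom.map_res, res_res, res_refl] at h1
    refine h1.trans ?_
    refine (pullbackSection_res f (le_inf le_rfl le_rfl : U ≤ U ⊓ U) _).symm.trans ?_
    rw [Pairing.res_toFun, res_res, res_res, res_refl, res_refl]

end PairingPullback

/-! ### Points and characters of a split torus -/

section TorusPoints

variable {S : Scheme.{u}} {T : Over S} [GrpObj T] {t : ℕ} (e : Splitting T t)

/-- Yoneda: the coordinates are the image of the identity point, and naturality along `g` moves them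
to `U`. -/
lemma Splitting.pullbackUnit_coord {U : Over S} (g : U ⟶ T) (i : Fin t) :
    pullbackUnit g.left (e.coord i) = (e.hom.app (op U) g : Fin t → Γ(U.left, ⊤)ˣ) i := by
  have h := congrArg (fun f => f.hom (𝟙 T)) (e.hom.naturality g.op)
  have h' := congrArg (fun f : Fin t → Γ(U.left, ⊤)ˣ => f i) h
  refine Eq.trans h'.symm ?_
  change (e.hom.app (op U) (g ≫ 𝟙 T) : Fin t → Γ(U.left, ⊤)ˣ) i = _
  rw [Category.comp_id]

lemma Splitting.bijective_app (U : Over S) :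
    Function.Bijective fun g : U ⟶ T => (e.hom.app (op U) g : Fin t → Γ(U.left, ⊤)ˣ) := by
  let E : GrpCat.of (U ⟶ T) ≅ GrpCat.of (Fin t → Γ(U.left, ⊤)ˣ) := e.app (op U)
  exact (ConcreteCategory.isIso_iff_bijective E.hom).1 inferInstance

lemma Splitting.exists_hom {U : Over S} (v : Fin t → Γ(U.left, ⊤)ˣ) :
    ∃ g : U ⟶ T, ∀ i, pullbackUnit g.left (e.coord i) = v i := by
  obtain ⟨g, hg⟩ := (e.bijective_app U).2 v
  exact ⟨g, fun i => by rw [e.pullbackUnit_coord, ← hg]⟩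

lemma Splitting.hom_ext {U : Over S} {g h : U ⟶ T}
    (H : ∀ i, pullbackUnit g.left (e.coord i) = pullbackUnit h.left (e.coord i)) : g = h := by
  apply (e.bijective_app U).1
  funext i
  have := H i
  rwa [e.pullbackUnit_coord, e.pullbackUnit_coord] at this

lemma Splitting.char_add (w w' : Fin t → ℤ) : e.char (w + w') = e.char w * e.char w' := by
  simp only [Splitting.char, Pi.add_apply, zpow_add, Finset.prod_mul_distrib]

lemma Splitting.char_zero : e.char 0 = 1 := by
  simp only [Splitting.char, Pi.zero_apply, zpow_zero, Finset.prod_const_one]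

/-- The characters, as a monoid homomorphism. -/
def Splitting.charHom : Multiplicative (Fin t → ℤ) →* Γ(T.left, ⊤)ˣ where
  toFun w := e.char w.toAdd
  map_one' := e.char_zero
  map_mul' _ _ := e.char_add _ _

/-- The monomial units of a group algebra. -/
def monomialUnit (A : Type*) [CommRing A] (G : Type*) [AddCommGroup G] (g : G) :
    (AddMonoidAlgebra A G)ˣ where
  val := AddMonoidAlgebra.single g 1
  inv := AddMonoidAlgebra.single (-g) 1
  val_inv := by
    rw [AddMonoidAlgebra.single_mul_single, add_neg_cancel, mul_one, AddMonoidAlgebra.one_def]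
  inv_val := by
    rw [AddMonoidAlgebra.single_mul_single, neg_add_cancel, mul_one, AddMonoidAlgebra.one_def]

/-- The monomials, as a monoid homomorphism to the units. -/
def monomialHom (A : Type*) [CommRing A] (G : Type*) [AddCommGroup G] :
    Multiplicative G →* (AddMonoidAlgebra A G)ˣ where
  toFun g := monomialUnit A G g.toAdd
  map_one' := by
    ext1
    rfl
  map_mul' g h := by
    ext1
    simp only [monomialUnit, Units.val_mul, AddMonoidAlgebra.single_mul_single, mul_one, toAdd_mul]

/-- A homomorphism out of ℤ^t is determined by the unit vectors; this reduces identities between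
characters to identities between coordinates. -/
lemma monoidHom_intPow_apply {G : Type*} [CommGroup G] {t : ℕ}
    (f : Multiplicative (Fin t → ℤ) →* G) (w : Fin t → ℤ) :
    f (.ofAdd w) = ∏ i, f (.ofAdd (Pi.single i 1)) ^ w i := by
  have h : Multiplicative.ofAdd w =
      ∏ i, Multiplicative.ofAdd (Pi.single i (1 : ℤ) : Fin t → ℤ) ^ w i := by
    apply Multiplicative.toAdd.injective
    rw [toAdd_prod]
    simp only [toAdd_ofAdd, toAdd_zpow]
    funext j
    simp [Finset.sum_apply, Pi.single_apply]
  rw [h, map_prod]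
  simp only [map_zpow]

lemma Splitting.char_single (i : Fin t) : e.char (Pi.single i 1) = e.coord i := by
  rw [Splitting.char, Finset.prod_eq_single i]
  · simp
  · intro j _ hj
    simp [Pi.single_eq_of_ne hj]
  · intro h
    exact absurd (Finset.mem_univ i) h

lemma topIso_inv_resO {Y : Scheme.{u}} (V : Y.Opens) (r : Γ(Y, ⊤)) :
    V.topIso.inv (resO le_top r) = V.ι.appTop r := by
  rw [Scheme.Opens.ι_appTop]
  simp only [resO, Scheme.Opens.topIso_inv]
  exact congrArg (fun k => k.hom r) (Y.presheaf.map_comp (homOfLE (le_top : V ≤ ⊤)).op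
    (homOfLE (Scheme.Opens.ι_image_top V).le).op).symm

lemma toSpecΓ_SpecMap_appTop {Y : Scheme.{u}} (V : Y.Opens) {R : CommRingCat.{u}}
    (θ : R ⟶ Γ(Y, V)) (r : R) :
    (V.toSpecΓ ≫ Spec.map θ).appTop ((Scheme.ΓSpecIso R).inv r) = V.topIso.inv (θ r) := by
  have h : (Scheme.ΓSpecIso R).inv ≫ (V.toSpecΓ ≫ Spec.map θ).appTop = θ ≫ V.topIso.inv := by
    rw [Scheme.Hom.comp_appTop, Scheme.Opens.toSpecΓ_appTop, ← Scheme.ΓSpecIso_inv_naturality_assoc,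
      Iso.inv_hom_id_assoc]
  exact congrArg (fun k => k.hom r) h

lemma SpecMap_appTop_ΓSpecIso_inv {R R' : CommRingCat.{u}} (f : R ⟶ R') (r : R) :
    (Spec.map f).appTop ((Scheme.ΓSpecIso R).inv r) = (Scheme.ΓSpecIso R').inv (f r) :=
  congrArg (fun k => k.hom r) (Scheme.ΓSpecIso_inv_naturality f).symm

lemma hom_Spec_ext {Z : Scheme.{u}} {R : CommRingCat.{u}} {f g : Z ⟶ Spec R}
    (h : ∀ r : R, f.appTop ((Scheme.ΓSpecIso R).inv r) = g.appTop ((Scheme.ΓSpecIso R).inv r)) :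
    f = g := by
  apply ext_of_isAffine
  rw [← cancel_epi (Scheme.ΓSpecIso R).inv]
  ext r
  exact h r

end TorusPoints

/-! ### The preimage of an affine open set in T × X -/

section TorusAffine

variable {S : Scheme.{u}} {T : Over S} [GrpObj T] {t : ℕ} (e : Splitting T t) (X : Over S)

/-- The pullback to `T × X` of a character of `T`, as a function. -/
def Splitting.charOn (w : Fin t → ℤ) : Γ((T ⊗ X).left, ⊤)ˣ :=
  pullbackUnit (fst T X).left (e.char w)

lemma Splitting.charOn_add (w w' : Fin t → ℤ) :
    e.charOn X (w + w') = e.charOn X w * e.charOn X w' := by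
  rw [Splitting.charOn, e.char_add, map_mul]
  rfl

lemma Splitting.charOn_zero : e.charOn X 0 = 1 := by
  rw [Splitting.charOn, e.char_zero, map_one]

/-- The functions on the preimage of `U` in `T × X` given by Laurent polynomials. -/
def Splitting.laurent (U : X.left.Opens) :
    AddMonoidAlgebra Γ(X.left, U) (Fin t → ℤ) →+* Γ((T ⊗ X).left, (snd T X).left ⁻¹ᵁ U) :=
  AddMonoidAlgebra.liftNCRingHom ((snd T X).left.app U).hom
    ((resO le_top).toMonoidHom.comp ((Units.coeHom _).comp
      ((pullbackUnit (fst T X).left).comp e.charHom))) (fun _ _ => Commute.all _ _)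

lemma Splitting.laurent_single (U : X.left.Opens) (w : Fin t → ℤ) (r : Γ(X.left, U)) :
    e.laurent X U (AddMonoidAlgebra.single w r) =
      (snd T X).left.app U r * resO le_top (e.charOn X w : Γ((T ⊗ X).left, ⊤)) :=
  AddMonoidAlgebra.liftNCRingHom_single _ _ _ _ _

/-- The preimage in `T × X` of an affine open set `U` is the spectrum of the ring of Laurent
polynomials. -/
lemma Splitting.isIso_toSpec {U : X.left.Opens} (hU : IsAffineOpen U) :
    IsIso (((snd T X).left ⁻¹ᵁ U).toSpecΓ ≫ Spec.map (CommRingCat.ofHom (e.laurent X U))) := by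
  let A := Γ(X.left, U)
  let R : CommRingCat.{u} := CommRingCat.of (AddMonoidAlgebra A (Fin t → ℤ))
  let V := (snd T X).left ⁻¹ᵁ U
  let p := (snd T X).left
  let θ : R ⟶ Γ((T ⊗ X).left, V) := CommRingCat.ofHom (e.laurent X U)
  let al : A ⟶ R := CommRingCat.ofHom AddMonoidAlgebra.singleZeroRingHom
  let g : V.toScheme ⟶ Spec R := V.toSpecΓ ≫ Spec.map θ
  have hal : al ≫ θ = p.app U := by
    ext r
    change e.laurent X U (AddMonoidAlgebra.single 0 r) = _
    rw [e.laurent_single, e.charOn_zero, Units.val_one, map_one, mul_one]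
  -- The candidate isomorphism `g` is compatible with the maps to X, and by `key2` it pulls
  -- monomials back to characters.
  have key1 : g ≫ Spec.map al ≫ hU.fromSpec = V.ι ≫ p := by
    simp only [g, Category.assoc]
    rw [← Spec.map_comp_assoc, hal, Scheme.Opens.toSpecΓ_naturality_assoc,
      IsAffineOpen.toSpecΓ_fromSpec, morphismRestrict_ι]
  have key2 : ∀ w, pullbackUnit g (Units.map (Scheme.ΓSpecIso R).inv.hom.toMonoidHom
      (monomialUnit A _ w)) = pullbackUnit V.ι (e.charOn X w) := by
    intro w
    ext
    refine (toSpecΓ_SpecMap_appTop V θ _).trans ?_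
    change V.topIso.inv (e.laurent X U (AddMonoidAlgebra.single w 1)) = _
    rw [e.laurent_single, map_one, one_mul, topIso_inv_resO]
    rfl
  -- The inverse comes from the universal property of T × X: Spec R maps to X through U, and to T by
  -- the point whose coordinates are the monomials of the unit vectors.
  let Z : Over S := Over.mk (Spec.map al ≫ hU.fromSpec ≫ X.hom)
  let gX : Z ⟶ X := Over.homMk (Spec.map al ≫ hU.fromSpec) (Category.assoc _ _ _)
  obtain ⟨gT, hgT⟩ := e.exists_hom (U := Z) fun i =>
    Units.map (Scheme.ΓSpecIso R).inv.hom.toMonoidHom (monomialUnit A _ (Pi.single i 1))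
  let h : Spec R ⟶ (T ⊗ X).left := (lift gT gX).left
  have hp : h ≫ p = Spec.map al ≫ hU.fromSpec := by
    change ((lift gT gX) ≫ snd T X).left = _
    rw [lift_snd]
    rfl
  have hchar : ∀ w, pullbackUnit h (e.charOn X w) =
      Units.map (Scheme.ΓSpecIso R).inv.hom.toMonoidHom (monomialUnit A _ w) := by
    intro w
    have h1 := monoidHom_intPow_apply
      ((pullbackUnit h).comp ((pullbackUnit (fst T X).left).comp e.charHom)) w
    have h2 := monoidHom_intPow_apply
      ((Units.map (Scheme.ΓSpecIso R).inv.hom.toMonoidHom).comp (monomialHom A (Fin t → ℤ))) w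
    refine h1.trans (Eq.trans ?_ h2.symm)
    refine Finset.prod_congr rfl fun i _ => congrArg (· ^ w i) ?_
    refine Eq.trans ?_ (hgT i)
    change pullbackUnit h (pullbackUnit (fst T X).left (e.char (Pi.single i 1))) = _
    rw [e.char_single, ← pullbackUnit_comp]
    congr 2
    change ((lift gT gX) ≫ fst T X).left = _
    rw [lift_fst]
  -- The composite of `h` with the projection to X factors through U, so `h` lands in the preimage
  -- of U.
  have hrange : Set.range h ⊆ Set.range V.ι := by
    rw [Scheme.Opens.range_ι]
    rintro _ ⟨z, rfl⟩
    change p (h z) ∈ U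
    have h1 : p (h z) = (h ≫ p) z := rfl
    rw [h1, hp]
    have h2 : (Spec.map al ≫ hU.fromSpec) z = hU.fromSpec (Spec.map al z) := rfl
    rw [h2]
    have h3 := hU.range_fromSpec
    exact h3.le ⟨_, rfl⟩
  let h' : Spec R ⟶ V.toScheme := IsOpenImmersion.lift V.ι h hrange
  have hh' : h' ≫ V.ι = h := IsOpenImmersion.lift_fac _ _ _
  -- Two maps to T × X agree if their T-points have the same coordinates and their components in X
  -- agree.
  have hgh : g ≫ h = V.ι := by
    let VS : Over S := Over.mk (V.ι ≫ (T ⊗ X).hom)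
    let gS : VS ⟶ Z := Over.homMk g (by
      change g ≫ Spec.map al ≫ hU.fromSpec ≫ X.hom = V.ι ≫ (T ⊗ X).hom
      have h1 := congrArg (· ≫ X.hom) key1
      simp only [Category.assoc] at h1
      rw [h1]
      exact congrArg (V.ι ≫ ·) (Over.w (snd T X)))
    let iS : VS ⟶ T ⊗ X := Over.homMk V.ι rfl
    suffices H : gS ≫ lift gT gX = iS from congrArg (fun k => k.left) H
    apply CartesianMonoidalCategory.hom_ext
    · apply e.hom_ext
      intro i
      rw [Category.assoc, lift_fst]
      refine (pullbackUnit_comp g gT.left _).trans ?_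
      rw [hgT, key2]
      refine Eq.trans ?_ (pullbackUnit_comp V.ι (fst T X).left _).symm
      rw [Splitting.charOn, e.char_single]
    · rw [Category.assoc, lift_snd]
      ext1
      exact key1
  have hg1 : g ≫ h' = 𝟙 _ := by
    rw [← cancel_mono V.ι, Category.assoc, hh', hgh, Category.id_comp]
  -- An endomorphism of Spec R is determined by the images of the coefficients (`hA`) and of the
  -- monomials (`hchar`).
  have hg2 : h' ≫ g = 𝟙 _ := by
    have hA : (h' ≫ g) ≫ Spec.map al = Spec.map al := by
      rw [← cancel_mono hU.fromSpec, Category.assoc, Category.assoc, key1, reassoc_of% hh', hp]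
    refine hom_Spec_ext fun r => ?_
    let f₁ : R ⟶ Γ(Spec R, ⊤) := (Scheme.ΓSpecIso R).inv ≫ (h' ≫ g).appTop
    have hf : f₁.hom = (Scheme.ΓSpecIso R).inv.hom := by
      refine AddMonoidAlgebra.ringHom_ext (fun r => ?_) (fun w => ?_)
      · have h1 := congrArg (fun k : Spec R ⟶ Spec A => k.appTop ((Scheme.ΓSpecIso A).inv r)) hA
        refine Eq.trans ?_ (h1.trans (SpecMap_appTop_ΓSpecIso_inv al r))
        rw [Scheme.Hom.comp_appTop (h' ≫ g) (Spec.map al)]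
        exact congrArg (h' ≫ g).appTop.hom (SpecMap_appTop_ΓSpecIso_inv al r).symm
      · have h1 := congrArg (pullbackUnit h') (key2 w)
        rw [← pullbackUnit_comp, ← pullbackUnit_comp, hh', hchar] at h1
        exact congrArg Units.val h1
    have h1 := congrArg (fun k => k r) hf
    refine h1.trans ?_
    rw [Scheme.Hom.id_appTop]
    rfl
  exact ⟨h', hg1, hg2⟩

lemma Splitting.isAffineOpen_preimage (e : Splitting T t) (X : Over S) {U : X.left.Opens} (hU : IsAffineOpen U) :
    IsAffineOpen ((snd T X).left ⁻¹ᵁ U) :=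
  have := e.isIso_toSpec X hU
  IsAffine.of_isIso (((snd T X).left ⁻¹ᵁ U).toSpecΓ ≫
    Spec.map (CommRingCat.ofHom (e.laurent X U)))

/-- The preimage of `U` is affine, so its canonical map to the spectrum of its functions can be
cancelled from the isomorphism `isIso_toSpec`. -/
lemma Splitting.laurent_bijective {U : X.left.Opens} (hU : IsAffineOpen U) :
    Function.Bijective (e.laurent X U) := by
  have h1 := e.isIso_toSpec X hU
  have h2 : IsIso ((snd T X).left ⁻¹ᵁ U).toSpecΓ := by
    rw [← (e.isAffineOpen_preimage X hU).isoSpec_hom]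
    infer_instance
  have h3 : IsIso (Spec.map (CommRingCat.ofHom (e.laurent X U))) := IsIso.of_isIso_comp_left
    ((snd T X).left ⁻¹ᵁ U).toSpecΓ _
  rw [isIso_SpecMap_iff] at h3
  exact h3

end TorusAffine

/-! ### Expansion of sections of pr^* M in characters -/

section WeightSum

variable {S : Scheme.{u}} {T : Over S} [GrpObj T] {t : ℕ} (e : Splitting T t) (X : Over S)

/-- A character as a function on an open subset of `T × X`. -/
def Splitting.charRes (V : (T ⊗ X).left.Opens) (w : Fin t → ℤ) : Γ((T ⊗ X).left, V) :=
  resO le_top (e.charOn X w : Γ((T ⊗ X).left, ⊤))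

variable {X}

/-- The section `∑ χ_w p^* s_w` of the pullback of `M` to `T × X`. -/
def Splitting.weightSum (M : X.left.Modules) (U : X.left.Opens) :
    ((Fin t → ℤ) →₀ Γ(M, U)) →+
      Γ((Scheme.Modules.pullback (snd T X).left).obj M, (snd T X).left ⁻¹ᵁ U) :=
  Finsupp.liftAddHom fun w => (DistribSMul.toAddMonoidHom _ (e.charRes X ((snd T X).left ⁻¹ᵁ U) w)).comp
    (pullbackSectionHom (snd T X).left M U)

lemma Splitting.weightSum_single (M : X.left.Modules) (U : X.left.Opens) (w : Fin t → ℤ)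
    (s : Γ(M, U)) : e.weightSum M U (Finsupp.single w s) =
      e.charRes X ((snd T X).left ⁻¹ᵁ U) w • pullbackSection (snd T X).left s := by
  rw [Splitting.weightSum, Finsupp.liftAddHom_apply_single]
  rfl

lemma Splitting.weightSum_apply (M : X.left.Modules) (U : X.left.Opens)
    (m : (Fin t → ℤ) →₀ Γ(M, U)) : e.weightSum M U m =
      m.sum fun w s => e.charRes X ((snd T X).left ⁻¹ᵁ U) w • pullbackSection (snd T X).left s := rfl

lemma IsBasisOn.coords_zero {Y : Scheme.{u}} {M : Y.Modules} {U : Y.Opens} {J : Type*} [Fintype J]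
    {b : J → Γ(M, U)} (hb : IsBasisOn M U b) {V : Y.Opens} (h : V ≤ U) :
    hb.coords h (0 : Γ(M, V)) = 0 := by
  apply hb.coords_unique
  simp only [Pi.zero_apply, zero_smul, Finset.sum_const_zero]

/-- Over an affine open set on which `M` is free, the sections of the pullback of `M` to `T × X`
are uniquely sums of sections of `M` multiplied by characters. -/
lemma Splitting.weightSum_bijective {M : X.left.Modules} {U : X.left.Opens}
    (hU : IsAffineOpen U) {J : Type*} [Fintype J] {b : J → Γ(M, U)} (hb : IsBasisOn M U b) :
    Function.Bijective (e.weightSum M U) := by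
  let R := AddMonoidAlgebra Γ(X.left, U) (Fin t → ℤ)
  -- Multiplying every coefficient of a Laurent polynomial by the basis section `b j` gives a
  -- finitely supported family of sections.
  let G : J → R →+ ((Fin t → ℤ) →₀ Γ(M, U)) := fun j =>
    (Finsupp.mapRange.addMonoidHom ((smulAddHom Γ(X.left, U) Γ(M, U)).flip (b j))).comp
      AddMonoidAlgebra.coeffAddEquiv.toAddMonoidHom
  have hG : ∀ j (r : R), e.weightSum M U (G j r) =
      e.laurent X U r • pullbackSection (snd T X).left (b j) := by
    intro j
    let H₁ : R →+ _ := (e.weightSum M U).comp (G j)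
    let H₂ : R →+ _ := ((smulAddHom _ _).flip (pullbackSection (snd T X).left (b j))).comp
      (e.laurent X U).toAddMonoidHom
    suffices h : H₁ = H₂ from fun r => congrArg (fun k => k r) h
    refine AddMonoidAlgebra.addMonoidHom_ext fun w r => ?_
    have h1 : G j (AddMonoidAlgebra.single w r) = Finsupp.single w (r • b j) :=
      Finsupp.mapRange_single (hf := map_zero _)
    change e.weightSum M U (G j (AddMonoidAlgebra.single w r)) =
      e.laurent X U (AddMonoidAlgebra.single w r) • _
    rw [h1, e.weightSum_single, e.laurent_single, pullbackSection_smul, smul_smul, mul_comm]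
    rfl
  let GG : (J → R) → ((Fin t → ℤ) →₀ Γ(M, U)) := fun r => ∑ j, G j (r j)
  have hGG : Function.Bijective (e.weightSum M U ∘ GG) := by
    have h1 := (hb.pullback (snd T X).left) _ le_rfl
    have h2 : Function.Bijective fun (r : J → R) j => e.laurent X U (r j) :=
      Function.Bijective.piMap fun _ => e.laurent_bijective X hU
    convert h1.comp h2 using 1
    funext r
    simp only [Function.comp_apply, GG, map_sum, hG, res_refl]
  -- The composite with `GG` is bijective by the pulled back basis and `laurent_bijective`. Once
  -- `GG` is surjective, both halves of the claim for `weightSum` follow.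
  have hsurj : Function.Surjective GG := by
    intro m
    refine ⟨fun j => AddMonoidAlgebra.ofCoeff (m.mapRange (fun s => hb.coords le_rfl s j)
      (by rw [hb.coords_zero]; rfl)), ?_⟩
    ext w
    simp only [GG, Finsupp.finsetSum_apply]
    have h := hb.sum_coords le_rfl (m w)
    simp only [res_refl] at h
    exact h
  refine ⟨fun m m' h => ?_, fun s => ?_⟩
  · obtain ⟨r, rfl⟩ := hsurj m
    obtain ⟨r', rfl⟩ := hsurj m'
    rw [hGG.1 h]
  · obtain ⟨r, hr⟩ := hGG.2 s
    exact ⟨GG r, hr⟩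

end WeightSum

/-! ### The cocycle condition on pulled back sections -/

section CocycleSections

variable {X Y Z : Scheme.{u}}

/-- An isomorphism `f^* M ≅ g^* M` for equal maps `f = g`, as an automorphism of `f^* M`. -/
def selfIso {f g : Y ⟶ X} (h : f = g) {M : X.Modules}
    (φ : (Scheme.Modules.pullback f).obj M ≅ (Scheme.Modules.pullback g).obj M) :
    (Scheme.Modules.pullback f).obj M ≅ (Scheme.Modules.pullback f).obj M :=
  φ ≪≫ (Scheme.Modules.pullbackCongr h.symm).app M

lemma selfIso_rfl {f : Y ⟶ X} {M : X.Modules}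
    (φ : (Scheme.Modules.pullback f).obj M ≅ (Scheme.Modules.pullback f).obj M) :
    selfIso rfl φ = φ := by
  ext1
  simp [selfIso, Scheme.Modules.pullbackCongr]

lemma pullbackComp_inv_pullbackSection (g : Z ⟶ Y) (f : Y ⟶ X) {M : X.Modules} {U : X.Opens}
    (s : Γ(M, U)) :
    ((Scheme.Modules.pullbackComp g f).inv.app M).app (g ⁻¹ᵁ f ⁻¹ᵁ U)
      (pullbackSection (g ≫ f) s) = pullbackSection g (pullbackSection f s) := by
  rw [← pullbackComp_pullbackSection]
  exact iso_inv_app_hom_app ((Scheme.Modules.pullbackComp g f).app M)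
    (pullbackSection g (pullbackSection f s))

lemma resO_appTop (k : Z ⟶ Y) (V : Y.Opens) (c : Γ(Y, ⊤)) :
    k.app V (resO le_top c) = resO le_top (k.appTop c) :=
  (resO_app k (le_top : V ≤ ⊤) c).symm

/-- The comparison isomorphisms match pulled back sections, so an expansion of φ(f^* s) pulls back
along `k` with only its coefficients changed. -/
lemma baseChange_pullbackSection (k : Z ⟶ Y) {f g : Y ⟶ X} (h : f = g) {f' g' : Z ⟶ X}
    (hf : k ≫ f = f') (hg : k ≫ g = g') {M : X.Modules}
    (φ : (Scheme.Modules.pullback f).obj M ≅ (Scheme.Modules.pullback g).obj M)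
    {U : X.Opens} (s : Γ(M, U)) {W : Type*} (I : Finset W) (c : W → Γ(Y, ⊤)) (σ : W → Γ(M, U))
    (hs : (selfIso h φ).hom.app (f ⁻¹ᵁ U) (pullbackSection f s) =
      ∑ i ∈ I, resO (V := f ⁻¹ᵁ U) le_top (c i) • pullbackSection f (σ i)) :
    (baseChange k hf hg φ).hom.app (f' ⁻¹ᵁ U) (pullbackSection f' s) =
      ∑ i ∈ I, resO (V := f' ⁻¹ᵁ U) le_top (k.appTop (c i)) •
        res _ (by rw [← hf, ← hg, h]) (pullbackSection g' (σ i)) := by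
  subst h
  subst hf
  subst hg
  rw [selfIso_rfl] at hs
  have h1 : (baseChange k rfl rfl φ).hom.app ((k ≫ f) ⁻¹ᵁ U) (pullbackSection (k ≫ f) s) =
      ((Scheme.Modules.pullbackComp k f).hom.app M).app (k ⁻¹ᵁ f ⁻¹ᵁ U)
        (((Scheme.Modules.pullback k).map φ.hom).app (k ⁻¹ᵁ f ⁻¹ᵁ U)
          (((Scheme.Modules.pullbackComp k f).inv.app M).app (k ⁻¹ᵁ f ⁻¹ᵁ U)
            (pullbackSection (k ≫ f) s))) := by
    simp only [baseChange, Scheme.Modules.pullbackCongr, eqToIso_refl, Iso.trans_hom,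
      Iso.app_hom, Iso.symm_hom, Functor.mapIso_hom, Iso.refl_symm, Iso.refl_hom,
      NatTrans.id_app, Category.comp_id, Category.id_comp]
    rfl
  rw [h1, pullbackComp_inv_pullbackSection, pullback_map_pullbackSection, hs, pullbackSection_sum,
    map_sum]
  refine Finset.sum_congr rfl fun i _ => ?_
  rw [pullbackSection_smul, app_smul, resO_appTop, res_refl, pullbackComp_pullbackSection]
  rfl

/-- The identity is moved from (p ≫ f)^* M to p^* f^* M and regrouped by the functions `a j`, so
that their coefficients become sections of f^* M that can be compared. -/
lemma sum_smul_pullbackSection_comp (p : Z ⟶ Y) (f : Y ⟶ X) {M : X.Modules} {U : X.Opens}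
    {W : Type*} (I : Finset W) (b a : W → Γ(Z, ⊤)) (c : W → Γ(Y, ⊤))
    (hb : ∀ i, b i = p.appTop (c i)) (σ : W → Γ(M, U)) (τ : W → W → Γ(M, U))
    (e4 : ∑ i ∈ I, resO (V := (p ≫ f) ⁻¹ᵁ U) le_top (b i) •
        ∑ j ∈ I, resO (V := (p ≫ f) ⁻¹ᵁ U) le_top (a j) • pullbackSection (p ≫ f) (τ i j) =
      ∑ i ∈ I, resO (V := (p ≫ f) ⁻¹ᵁ U) le_top (b i * a i) • pullbackSection (p ≫ f) (σ i)) :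
    ∑ j ∈ I, resO (V := p ⁻¹ᵁ f ⁻¹ᵁ U) le_top (a j) •
        pullbackSection p (resO (V := f ⁻¹ᵁ U) le_top (c j) • pullbackSection f (σ j)) =
      ∑ j ∈ I, resO (V := p ⁻¹ᵁ f ⁻¹ᵁ U) le_top (a j) •
        pullbackSection p
          (∑ i ∈ I, resO (V := f ⁻¹ᵁ U) le_top (c i) • pullbackSection f (τ i j)) := by
  let L : Γ((Scheme.Modules.pullback (p ≫ f)).obj M, (p ≫ f) ⁻¹ᵁ U) →+
      Γ((Scheme.Modules.pullback p).obj ((Scheme.Modules.pullback f).obj M), p ⁻¹ᵁ f ⁻¹ᵁ U) :=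
    (((Scheme.Modules.pullbackComp p f).inv.app M).app (p ⁻¹ᵁ f ⁻¹ᵁ U)).hom
  have hL : ∀ s : Γ(M, U), L (pullbackSection (p ≫ f) s) =
      pullbackSection p (pullbackSection f s) := pullbackComp_inv_pullbackSection p f
  have hL_smul : ∀ (r : Γ(Z, (p ≫ f) ⁻¹ᵁ U)) s, L (r • s) =
      (show Γ(Z, p ⁻¹ᵁ f ⁻¹ᵁ U) from r) • L s := fun r s =>
    app_smul ((Scheme.Modules.pullbackComp p f).inv.app M) (U := p ⁻¹ᵁ f ⁻¹ᵁ U) r s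
  have e5 := congrArg L e4
  simp only [map_sum, hL_smul, hL] at e5
  have e6 : ∀ (r : Γ(Z, ⊤)), (show Γ(Z, p ⁻¹ᵁ f ⁻¹ᵁ U) from
      resO (V := (p ≫ f) ⁻¹ᵁ U) le_top r) = resO (V := p ⁻¹ᵁ f ⁻¹ᵁ U) le_top r := fun _ => rfl
  simp only [e6] at e5
  simp only [pullbackSection_sum, pullbackSection_smul, resO_appTop, Finset.smul_sum, smul_smul,
    ← map_mul]
  rw [Finset.sum_comm]
  simp only [Finset.smul_sum, smul_smul, ← map_mul] at e5
  simp only [mul_comm (a _), ← hb]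
  exact e5.symm

/-- The cocycle condition evaluated on a section. -/
lemma cocycle_pullbackSection {f g : Y ⟶ X} (h : f = g) {t₁ t₂ t₃ : Z ⟶ X}
    (m p a : Z ⟶ Y) (hm₁ : m ≫ f = t₁) (hm₃ : m ≫ g = t₃) (hp₁ : p ≫ f = t₁) (hp₂ : p ≫ g = t₂)
    (ha₂ : a ≫ f = t₂) (ha₃ : a ≫ g = t₃) {M : X.Modules}
    (φ : (Scheme.Modules.pullback f).obj M ≅ (Scheme.Modules.pullback g).obj M)
    (hφ : (baseChange m hm₁ hm₃ φ).hom =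
      (baseChange p hp₁ hp₂ φ).hom ≫ (baseChange a ha₂ ha₃ φ).hom)
    {U : X.Opens} (s : Γ(M, U)) {W : Type*} (I : Finset W) (c : W → Γ(Y, ⊤))
    (hc : ∀ i, m.appTop (c i) = p.appTop (c i) * a.appTop (c i))
    (σ : W → Γ(M, U)) (τ : W → W → Γ(M, U))
    (hs : (selfIso h φ).hom.app (f ⁻¹ᵁ U) (pullbackSection f s) =
      ∑ i ∈ I, resO (V := f ⁻¹ᵁ U) le_top (c i) • pullbackSection f (σ i))
    (hσ : ∀ i ∈ I, (selfIso h φ).hom.app (f ⁻¹ᵁ U) (pullbackSection f (σ i)) =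
      ∑ j ∈ I, resO (V := f ⁻¹ᵁ U) le_top (c j) • pullbackSection f (τ i j)) :
    ∑ j ∈ I, resO (V := p ⁻¹ᵁ f ⁻¹ᵁ U) le_top (a.appTop (c j)) •
        pullbackSection p (resO (V := f ⁻¹ᵁ U) le_top (c j) • pullbackSection f (σ j)) =
      ∑ j ∈ I, resO (V := p ⁻¹ᵁ f ⁻¹ᵁ U) le_top (a.appTop (c j)) •
        pullbackSection p
          (∑ i ∈ I, resO (V := f ⁻¹ᵁ U) le_top (c i) • pullbackSection f (τ i j)) := by
  have h12 : t₁ = t₂ := by rw [← hp₁, ← hp₂, h]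
  have h13 : t₁ = t₃ := by rw [← hm₁, ← hm₃, h]
  subst h12
  subst h13
  have e1 := baseChange_pullbackSection m h hm₁ hm₃ φ s I c σ hs
  have e2 := baseChange_pullbackSection p h hp₁ hp₂ φ s I c σ hs
  have e3 := fun i hi => baseChange_pullbackSection a h ha₂ ha₃ φ (σ i) I c (τ i) (hσ i hi)
  generalize (baseChange m hm₁ hm₃ φ).hom = C at hφ e1
  generalize (baseChange p hp₁ hp₂ φ).hom = B at hφ e2
  generalize (baseChange a ha₂ ha₃ φ).hom = A at hφ e3
  simp only [res_refl] at e1 e2 e3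
  simp only [hc] at e1
  -- The right side is the pullback of φ along `m`, with coefficients split by `hc`; the left side
  -- applies the pullbacks along `p` and then `a`.
  have e4 : ∑ i ∈ I, resO (V := t₁ ⁻¹ᵁ U) le_top (p.appTop (c i)) •
      ∑ j ∈ I, resO (V := t₁ ⁻¹ᵁ U) le_top (a.appTop (c j)) • pullbackSection t₁ (τ i j) =
        ∑ i ∈ I, resO (V := t₁ ⁻¹ᵁ U) le_top (p.appTop (c i) * a.appTop (c i)) •
          pullbackSection t₁ (σ i) := by
    rw [← e1, hφ, comp_app_apply, e2]
    obtain ⟨z, hz⟩ : ∃ z : W → Γ((Scheme.Modules.pullback t₁).obj M, t₁ ⁻¹ᵁ U), ∀ i,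
      resO (V := t₁ ⁻¹ᵁ U) le_top (p.appTop (c i)) • pullbackSection t₁ (σ i) = z i :=
        ⟨_, fun _ => rfl⟩
    simp only [hz]
    rw [map_sum]
    refine Finset.sum_congr rfl fun i hi => ?_
    rw [← hz, app_smul, e3 i hi]
  subst hp₁
  exact sum_smul_pullbackSection_comp p f I (fun i => p.appTop (c i)) (fun i => a.appTop (c i))
    (fun i => c i) (fun _ => rfl) σ τ e4

end CocycleSections

/-! ### Eigensections and the submodule they form -/

section Eigensections

variable {X Y : Scheme.{u}}

lemma app_sum {M N : X.Modules} (f : M ⟶ N) {U : X.Opens} {J : Type*} (t : Finset J)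
    (s : J → Γ(M, U)) : f.app U (∑ i ∈ t, s i) = ∑ i ∈ t, f.app U (s i) :=
  map_sum (f.app U).hom s t

/-- The endomorphism `g` of `f^* M` acts on the pullback of `s` as multiplication by `c`. -/
def IsEigensection (f : Y ⟶ X) {M : X.Modules}
    (g : (Scheme.Modules.pullback f).obj M ⟶ (Scheme.Modules.pullback f).obj M) (c : Γ(Y, ⊤))
    {U : X.Opens} (s : Γ(M, U)) : Prop :=
  g.app (f ⁻¹ᵁ U) (pullbackSection f s) = resO (V := f ⁻¹ᵁ U) le_top c • pullbackSection f s

namespace IsEigensection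

variable {f : Y ⟶ X} {M : X.Modules}
  {g : (Scheme.Modules.pullback f).obj M ⟶ (Scheme.Modules.pullback f).obj M} {c : Γ(Y, ⊤)}
  {U V : X.Opens}

lemma res {s : Γ(M, U)} (hs : IsEigensection f g c s) (h : V ≤ U) :
    IsEigensection f g c (res M h s) := by
  have h1 := congrArg (EquivariantKTheory.res _ (f.preimage_mono h)) hs
  rw [res_smul, resO_resO, ← app_res, ← pullbackSection_res] at h1
  exact h1

lemma zero : IsEigensection f g c (0 : Γ(M, U)) := by
  rw [IsEigensection, pullbackSection_zero, map_zero, smul_zero]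

lemma smul {s : Γ(M, U)} (hs : IsEigensection f g c s) (r : Γ(X, U)) :
    IsEigensection f g c (r • s) := by
  rw [IsEigensection, pullbackSection_smul, app_smul, hs, smul_comm]

lemma sum {J : Type*} (I : Finset J) {s : J → Γ(M, U)}
    (hs : ∀ i ∈ I, IsEigensection f g c (s i)) : IsEigensection f g c (∑ i ∈ I, s i) := by
  rw [IsEigensection, pullbackSection_sum, app_sum, Finset.smul_sum]
  exact Finset.sum_congr rfl hs

lemma sub {s s' : Γ(M, U)} (hs : IsEigensection f g c s) (hs' : IsEigensection f g c s') :
    IsEigensection f g c (s - s') := by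
  have h : pullbackSection f (s - s') = pullbackSection f s - pullbackSection f s' :=
    map_sub (pullbackSectionHom f M U) s s'
  rw [IsEigensection, h, map_sub, smul_sub, hs, hs']

lemma app_sum_eq {J : Type*} (I : Finset J) {s : J → Γ(M, U)} {c : J → Γ(Y, ⊤)}
    (hs : ∀ i ∈ I, IsEigensection f g (c i) (s i)) :
    g.app (f ⁻¹ᵁ U) (pullbackSection f (∑ i ∈ I, s i)) =
      ∑ i ∈ I, resO (V := f ⁻¹ᵁ U) le_top (c i) • pullbackSection f (s i) := by
  rw [pullbackSection_sum, app_sum]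
  exact Finset.sum_congr rfl hs

end IsEigensection

/-- The submodule of eigensections. -/
lemma exists_eigenmodule (f : Y ⟶ X) {M : X.Modules}
    (g : (Scheme.Modules.pullback f).obj M ⟶ (Scheme.Modules.pullback f).obj M) (c : Γ(Y, ⊤)) :
    ∃ (N : X.Modules) (i : N ⟶ M), Mono i ∧
      (∀ (U : X.Opens) (s : Γ(N, U)), IsEigensection f g c (i.app U s)) ∧
      (∀ (U : X.Opens) (s : Γ(M, U)), IsEigensection f g c s → ∃ s', i.app U s' = s) ∧
      (∀ (N' : X.Modules) (k : N' ⟶ M),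
        (∀ (U : X.Opens) (s : Γ(N', U)), IsEigensection f g c (k.app U s)) →
          ∃ l : N' ⟶ N, l ≫ i = k) := by
  -- The map s ↦ (g - c)(f^* s) is linear over functions on X, so the eigensections are the sections
  -- of its kernel.
  let q : M ⟶ (Scheme.Modules.pushforward f).obj ((Scheme.Modules.pullback f).obj M) :=
    (Scheme.Modules.pullbackPushforwardAdjunction f).unit.app M ≫
      (Scheme.Modules.pushforward f).map (g - scalar _ c)
  have hq : ∀ (U : X.Opens) (s : Γ(M, U)), q.app U s = 0 ↔ IsEigensection f g c s := by
    intro U s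
    have h : q.app U s = (show Γ((Scheme.Modules.pullback f).obj M, f ⁻¹ᵁ U) from
      g.app (f ⁻¹ᵁ U) (pullbackSection f s) -
        resO (V := f ⁻¹ᵁ U) le_top c • pullbackSection f s) := rfl
    rw [h]
    exact sub_eq_zero
  refine ⟨Limits.kernel q, Limits.kernel.ι q, inferInstance,
    fun U s => (hq U _).1 (kernel_ι_app q U s),
    fun U s hs => exists_kernel_lift q U s ((hq U s).2 hs), fun N' k hk => ?_⟩
  refine ⟨Limits.kernel.lift q k (hom_ext_sections fun U s => ?_), Limits.kernel.lift_ι _ _ _⟩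
  rw [comp_app_apply, zero_app_apply]
  exact (hq U _).2 (hk U s)

end Eigensections

/-! ### Local weight decomposition -/

section LocalWeights

variable {S : Scheme.{u}} {T : Over S} [GrpObj T] {t : ℕ} {X : Over S} {a : ModObj T X}

/-- Injectivity of `weightSum`, in the form of comparing coefficients of characters over a given
finite set. -/
lemma Splitting.sum_charRes_injective (e : Splitting T t) {M : X.left.Modules} {U : X.left.Opens}
    (hU : IsAffineOpen U) {J : Type*} [Fintype J] {b : J → Γ(M, U)} (hb : IsBasisOn M U b)
    (I : Finset (Fin t → ℤ)) (v v' : (Fin t → ℤ) → Γ(M, U))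
    (h : ∑ i ∈ I, e.charRes X ((snd T X).left ⁻¹ᵁ U) i • pullbackSection (snd T X).left (v i) =
      ∑ i ∈ I, e.charRes X ((snd T X).left ⁻¹ᵁ U) i • pullbackSection (snd T X).left (v' i)) :
    ∀ i ∈ I, v i = v' i := by
  classical
  have key : ∀ v : (Fin t → ℤ) → Γ(M, U), e.weightSum M U (∑ i ∈ I, Finsupp.single i (v i)) =
      ∑ i ∈ I, e.charRes X ((snd T X).left ⁻¹ᵁ U) i • pullbackSection (snd T X).left (v i) := by
    intro v
    simp only [map_sum, e.weightSum_single]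
  rw [← key, ← key] at h
  have h' := (e.weightSum_bijective hU hb).1 h
  intro i hi
  have h'' := DFunLike.congr_fun h' i
  simpa only [Finsupp.finsetSum_apply, Finsupp.single_apply, Finset.sum_ite_eq', hi, if_true]
    using h''

lemma Splitting.pullbackSection_injective (e : Splitting T t) {M : X.left.Modules}
    {U : X.left.Opens} (hU : IsAffineOpen U) {J : Type*} [Fintype J] {b : J → Γ(M, U)}
    (hb : IsBasisOn M U b) :
    Function.Injective (pullbackSection (snd T X).left : Γ(M, U) → _) := by
  intro s s' h
  refine e.sum_charRes_injective hU hb {0} (fun _ => s) (fun _ => s') ?_ 0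
    (Finset.mem_singleton_self _)
  simp only [Finset.sum_singleton]
  rw [h]

lemma EquivariantBundle.exists_auto (E : EquivariantBundle a) (ha : IsTrivialAction a) :
    ∃ ψ : (Scheme.Modules.pullback (snd T X).left).obj E.obj ≅
      (Scheme.Modules.pullback (snd T X).left).obj E.obj,
      ψ = selfIso (congrArg Over.Hom.left ha.symm) E.φ := ⟨_, rfl⟩

/-- For a trivial action, the equivariant structure as an automorphism of the pullback along the
projection. -/
def EquivariantBundle.auto (E : EquivariantBundle a) (ha : IsTrivialAction a) :
    (Scheme.Modules.pullback (snd T X).left).obj E.obj ≅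
      (Scheme.Modules.pullback (snd T X).left).obj E.obj :=
  (E.exists_auto ha).choose

lemma EquivariantBundle.auto_eq (E : EquivariantBundle a) (ha : IsTrivialAction a) :
    E.auto ha = selfIso (congrArg Over.Hom.left ha.symm) E.φ := (E.exists_auto ha).choose_spec

/-- The section `s` has weight `w`. -/
def EquivariantBundle.HasWeight (E : EquivariantBundle a) (ha : IsTrivialAction a)
    (e : Splitting T t) (w : Fin t → ℤ) {U : X.left.Opens} (s : Γ(E.obj, U)) : Prop :=
  IsEigensection (snd T X).left (E.auto ha).hom (e.charOn X w : Γ((T ⊗ X).left, ⊤)) s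

lemma EquivariantBundle.exists_finset_sum (E : EquivariantBundle a) (ha : IsTrivialAction a)
    (e : Splitting T t) {U : X.left.Opens} (hU : IsAffineOpen U) {J : Type*} [Fintype J]
    {b : J → Γ(E.obj, U)} (hb : IsBasisOn E.obj U b) (s : Γ(E.obj, U)) :
    ∃ (m : (Fin t → ℤ) →₀ Γ(E.obj, U)), ∀ I, m.support ⊆ I →
      (E.auto ha).hom.app ((snd T X).left ⁻¹ᵁ U) (pullbackSection (snd T X).left s) =
        ∑ i ∈ I, e.charRes X ((snd T X).left ⁻¹ᵁ U) i • pullbackSection (snd T X).left (m i) := by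
  obtain ⟨m, hm⟩ := (e.weightSum_bijective hU hb).2
    ((E.auto ha).hom.app ((snd T X).left ⁻¹ᵁ U) (pullbackSection (snd T X).left s))
  refine ⟨m, fun I hI => ?_⟩
  rw [← hm, e.weightSum_apply]
  refine Finsupp.sum_of_support_subset m hI _ fun i _ => ?_
  rw [pullbackSection_zero, smul_zero]

/-- Over an affine open set on which the bundle is free, sections decompose by weight. -/
lemma EquivariantBundle.exists_local_decomposition (E : EquivariantBundle a)
    (ha : IsTrivialAction a) (e : Splitting T t) {U : X.left.Opens} (hU : IsAffineOpen U)
    {J : Type*} [Fintype J] {b : J → Γ(E.obj, U)} (hb : IsBasisOn E.obj U b) (s : Γ(E.obj, U)) :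
    ∃ (I : Finset (Fin t → ℤ)) (m : (Fin t → ℤ) → Γ(E.obj, U)),
      (∀ i ∈ I, E.HasWeight ha e i (m i)) ∧ s = ∑ i ∈ I, m i := by
  classical
  obtain ⟨σ, hσ⟩ := E.exists_finset_sum ha e hU hb s
  choose τ hτ using fun s => E.exists_finset_sum ha e hU hb s
  -- One finite set of weights that carries the expansion of `s` and the expansions of all its
  -- components.
  let I : Finset (Fin t → ℤ) := σ.support ∪ σ.support.biUnion fun i => (τ (σ i)).support
  have hσI : σ.support ⊆ I := Finset.subset_union_left
  have hτI : ∀ i, i ∈ σ.support → (τ (σ i)).support ⊆ I := fun i hi =>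
    (Finset.subset_biUnion_of_mem (fun i => (τ (σ i)).support) hi).trans Finset.subset_union_right
  have hτI' : ∀ i, ∃ τ' : (Fin t → ℤ) → Γ(E.obj, U),
      (E.auto ha).hom.app ((snd T X).left ⁻¹ᵁ U) (pullbackSection (snd T X).left (σ i)) =
        ∑ j ∈ I, e.charRes X ((snd T X).left ⁻¹ᵁ U) j •
          pullbackSection (snd T X).left (τ' j) := by
    intro i
    by_cases hi : i ∈ σ.support
    · exact ⟨_, hτ (σ i) I (hτI i hi)⟩
    · refine ⟨0, ?_⟩
      rw [Finsupp.notMem_support_iff.1 hi]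
      simp only [pullbackSection_zero, map_zero, Pi.zero_apply, smul_zero, Finset.sum_const_zero]
  choose τ' hτ' using hτI'
  -- Multiplicativity of characters on T × T × X, which is the coefficient condition needed to
  -- evaluate the cocycle identity.
  have hc : ∀ i, (mulMap T X).left.appTop (e.charOn X i : Γ((T ⊗ X).left, ⊤)) =
      (snd T (T ⊗ X)).left.appTop (e.charOn X i : Γ((T ⊗ X).left, ⊤)) *
        (T ◁ actMap a).left.appTop (e.charOn X i : Γ((T ⊗ X).left, ⊤)) := fun i =>
    congrArg Units.val ((e.isCharacter_char i).pullback_mulMap (T ◁ actMap a)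
      (whiskerLeft_fst T (actMap a)))
  have ha' : ∀ i, (T ◁ actMap a).left.appTop (e.charOn X i : Γ((T ⊗ X).left, ⊤)) =
      (e.charOn (T ⊗ X) i : Γ((T ⊗ (T ⊗ X)).left, ⊤)) := by
    intro i
    have h := pullbackUnit_comp (T ◁ actMap a).left (fst T X).left (e.char i)
    rw [← Over.comp_left, whiskerLeft_fst] at h
    exact congrArg Units.val h.symm
  have hψ := E.auto_eq ha
  have hσ' := hσ I hσI
  simp only [hψ] at hσ' hτ'
  have key := cocycle_pullbackSection (congrArg Over.Hom.left ha.symm)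
    (mulMap T X).left (snd T (T ⊗ X)).left (T ◁ actMap a).left _ _ _ _ _ _ E.φ E.cocycle s I
    (fun i => (e.charOn X i : Γ((T ⊗ X).left, ⊤))) hc σ τ' hσ' (fun i _ => hτ' i)
  simp only [ha'] at key
  simp only [← hψ] at hτ'
  -- Coefficients of the characters of the outer factor T of T × (T × X) are compared first, leaving
  -- χ_j σ_j = ∑_i χ_i τ_ij on T × X.
  have h1 := e.sum_charRes_injective (X := T ⊗ X) (e.isAffineOpen_preimage X hU)
    (hb.pullback (snd T X).left) I _ _ key
  -- Comparing coefficients again on T × X: the weight operators are orthogonal idempotents.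
  have h2 : ∀ i ∈ I, ∀ j ∈ I, τ' i j = if i = j then σ j else 0 := by
    intro i hi j hj
    refine e.sum_charRes_injective hU hb I (fun i => τ' i j) (fun i => if i = j then σ j else 0)
      ?_ i hi
    refine (h1 j hj).symm.trans ?_
    rw [Finset.sum_eq_single j]
    · rw [if_pos rfl]
      rfl
    · intro k _ hk
      rw [if_neg hk, pullbackSection_zero, smul_zero]
    · exact fun h => absurd hj h
  have h3 : ∀ i ∈ I, E.HasWeight ha e i (σ i) := by
    intro i hi
    refine (hτ' i).trans ?_
    rw [Finset.sum_eq_single i]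
    · rw [h2 i hi i hi, if_pos rfl]
      rfl
    · intro k hk hki
      rw [h2 i hi k hk, if_neg hki.symm, pullbackSection_zero, smul_zero]
    · exact fun h => absurd hi h
  refine ⟨I, σ, h3, ?_⟩
  -- Pullback to T × X and the automorphism are both injective, and they send `s` and ∑ σ_i to the
  -- same expansion ∑ χ_i σ_i.
  apply e.pullbackSection_injective hU hb
  have h4 : Function.Injective fun x =>
      (E.auto ha).hom.app ((snd T X).left ⁻¹ᵁ U) x := by
    intro x y hxy
    rw [← iso_inv_app_hom_app (E.auto ha) x, ← iso_inv_app_hom_app (E.auto ha) y]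
    exact congrArg _ hxy
  apply h4
  exact (hσ I hσI).trans (IsEigensection.app_sum_eq I h3).symm

end LocalWeights

/-! ### Weight modules and the global weight decomposition -/

section WeightModules

variable {S : Scheme.{u}} {T : Over S} [GrpObj T] {t : ℕ} {X : Over S} {a : ModObj T X}

namespace EquivariantBundle

section HasWeight

variable {E : EquivariantBundle a} {ha : IsTrivialAction a} {e : Splitting T t} {w : Fin t → ℤ}
  {U V : X.left.Opens}

/-- Sections of different weights are independent. -/
lemma eq_zero_of_sum_eq_zero (I : Finset (Fin t → ℤ)) {m : (Fin t → ℤ) → Γ(E.obj, U)}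
    (hm : ∀ i ∈ I, E.HasWeight ha e i (m i)) (h : ∑ i ∈ I, m i = 0) : ∀ i ∈ I, m i = 0 := by
  intro i hi
  refine eq_of_locally_eq E.obj fun x hx => ?_
  obtain ⟨V, hxV, hV, n, b, hb⟩ := E.isFiniteLocallyFree.exists_affine_basis x
  obtain ⟨W, hW, hxW, hWV⟩ := TopologicalSpace.Opens.isBasis_iff_nbhd.1 X.left.isBasis_affineOpens
    (show x ∈ U ⊓ V from ⟨hx, hxV⟩)
  have hWU : W ≤ U := hWV.trans inf_le_left
  refine ⟨W, hWU, hxW, ?_⟩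
  rw [map_zero]
  refine e.sum_charRes_injective hW (hb.of_le (hWV.trans inf_le_right)) I
    (fun i => EquivariantKTheory.res E.obj hWU (m i)) (fun _ => 0) ?_ i hi
  simp only [pullbackSection_zero, smul_zero, Finset.sum_const_zero]
  -- The automorphism turns ∑ m_i = 0 into ∑ χ_i m_i = 0, where coefficients can be compared.
  refine (IsEigensection.app_sum_eq I fun i hi => (hm i hi).res hWU).symm.trans ?_
  rw [← map_sum, h, map_zero, pullbackSection_zero, map_zero]

end HasWeight

variable (E : EquivariantBundle a) (ha : IsTrivialAction a) (e : Splitting T t)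

/-- The submodule of sections of weight `w`. -/
def weightModule (w : Fin t → ℤ) : X.left.Modules :=
  (exists_eigenmodule (snd T X).left (E.auto ha).hom
    (e.charOn X w : Γ((T ⊗ X).left, ⊤))).choose

/-- The inclusion of the submodule of sections of weight `w`. -/
def weightι (w : Fin t → ℤ) : E.weightModule ha e w ⟶ E.obj :=
  (exists_eigenmodule (snd T X).left (E.auto ha).hom
    (e.charOn X w : Γ((T ⊗ X).left, ⊤))).choose_spec.choose

instance (w : Fin t → ℤ) : Mono (E.weightι ha e w) :=
  (exists_eigenmodule (snd T X).left (E.auto ha).hom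
    (e.charOn X w : Γ((T ⊗ X).left, ⊤))).choose_spec.choose_spec.1

lemma weightι_hasWeight (w : Fin t → ℤ) {U : X.left.Opens} (s : Γ(E.weightModule ha e w, U)) :
    E.HasWeight ha e w ((E.weightι ha e w).app U s) :=
  (exists_eigenmodule (snd T X).left (E.auto ha).hom
    (e.charOn X w : Γ((T ⊗ X).left, ⊤))).choose_spec.choose_spec.2.1 U s

lemma HasWeight.exists_weightι {E : EquivariantBundle a} {ha : IsTrivialAction a}
    {e : Splitting T t} {w : Fin t → ℤ} {U : X.left.Opens} {s : Γ(E.obj, U)}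
    (hs : E.HasWeight ha e w s) : ∃ s', (E.weightι ha e w).app U s' = s :=
  (exists_eigenmodule (snd T X).left (E.auto ha).hom
    (e.charOn X w : Γ((T ⊗ X).left, ⊤))).choose_spec.choose_spec.2.2.1 U s hs

/-- A morphism to `E` with values of weight `w` factors through the weight module. -/
lemma exists_lift_weightι {w : Fin t → ℤ} {N : X.left.Modules} (f : N ⟶ E.obj)
    (hf : ∀ (U : X.left.Opens) (s : Γ(N, U)), E.HasWeight ha e w (f.app U s)) :
    ∃ g : N ⟶ E.weightModule ha e w, g ≫ E.weightι ha e w = f :=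
  (exists_eigenmodule (snd T X).left (E.auto ha).hom
    (e.charOn X w : Γ((T ⊗ X).left, ⊤))).choose_spec.choose_spec.2.2.2 N f hf

/-- The finitely many members of a local basis involve finitely many weights, multiplication by
functions on X preserves weights, and finitely many such neighbourhoods cover X. -/
lemma exists_finset_weights [CompactSpace X.left] : ∃ Λ : Finset (Fin t → ℤ),
    ∀ x : X.left, ∃ U : X.left.Opens, x ∈ U ∧ ∀ V ≤ U, ∀ s : Γ(E.obj, V),
      ∃ m : (Fin t → ℤ) → Γ(E.obj, V), (∀ i ∈ Λ, E.HasWeight ha e i (m i)) ∧ s = ∑ i ∈ Λ, m i := by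
  classical
  have h1 : ∀ x : X.left, ∃ U : X.left.Opens, x ∈ U ∧ ∃ I : Finset (Fin t → ℤ),
      ∀ V ≤ U, ∀ s : Γ(E.obj, V), ∃ m : (Fin t → ℤ) → Γ(E.obj, V),
        (∀ i, E.HasWeight ha e i (m i)) ∧ (∀ i, i ∉ I → m i = 0) ∧ s = ∑ i ∈ I, m i := by
    intro x
    obtain ⟨U, hxU, hU, n, b, hb⟩ := E.isFiniteLocallyFree.exists_affine_basis x
    choose I m hm hbm using fun k => E.exists_local_decomposition ha e hU hb (b k)
    refine ⟨U, hxU, Finset.univ.biUnion I, fun V hV s => ⟨fun i => ∑ k, hb.coords hV s k •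
      (if i ∈ I k then res E.obj hV (m k i) else 0), fun i => ?_, fun i hi => ?_, ?_⟩⟩
    · refine IsEigensection.sum _ fun k _ => IsEigensection.smul ?_ _
      split_ifs with h
      · exact (hm k i h).res hV
      · exact IsEigensection.zero
    · refine Finset.sum_eq_zero fun k _ => ?_
      rw [if_neg, smul_zero]
      exact fun h => hi (Finset.mem_biUnion.2 ⟨k, Finset.mem_univ k, h⟩)
    · rw [Finset.sum_comm]
      conv_lhs => rw [← hb.sum_coords hV s]
      refine Finset.sum_congr rfl fun k _ => ?_
      rw [← Finset.smul_sum]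
      congr 1
      conv_lhs => rw [hbm k, map_sum]
      rw [← Finset.sum_filter]
      refine Finset.sum_congr ?_ fun _ _ => rfl
      ext i
      rw [Finset.mem_filter, Finset.mem_biUnion]
      exact ⟨fun h => ⟨⟨k, Finset.mem_univ k, h⟩, h⟩, fun h => h.2⟩
  choose U hxU I hI using h1
  obtain ⟨F, hF⟩ := isCompact_univ.elim_finite_subcover (fun x : X.left => (U x : Set X.left))
    (fun x => (U x).isOpen) (fun x _ => Set.mem_iUnion.2 ⟨x, hxU x⟩)
  refine ⟨F.biUnion I, fun x => ?_⟩
  obtain ⟨y, hy, hxy⟩ := Set.mem_iUnion₂.1 (hF (Set.mem_univ x))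
  refine ⟨U y, hxy, fun V hV s => ?_⟩
  obtain ⟨m, hm, hm0, hs⟩ := hI y V hV s
  refine ⟨m, fun i _ => hm i, hs.trans ?_⟩
  exact Finset.sum_subset (Finset.subset_biUnion_of_mem I hy) fun i _ hi => hm0 i hi

/-- The bundle `E` is the direct sum of its weight modules. -/
lemma exists_weight_decomposition [CompactSpace X.left] : ∃ (Λ : Finset (Fin t → ℤ))
    (π : ∀ w, E.obj ⟶ E.weightModule ha e w),
      (∑ w ∈ Λ, π w ≫ E.weightι ha e w = 𝟙 E.obj) ∧ (∀ w ∉ Λ, π w = 0) ∧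
      (∀ w, E.weightι ha e w ≫ π w = 𝟙 _) ∧ (∀ w v, w ≠ v → E.weightι ha e w ≫ π v = 0) := by
  classical
  obtain ⟨Λ, hΛ⟩ := E.exists_finset_weights ha e
  let W : Λ → X.left.Modules := fun i => E.weightModule ha e i
  have : Limits.HasFiniteBiproducts X.left.Modules := Abelian.hasFiniteBiproducts
  -- This map is mono by independence of weights and epi by local decomposition, hence an
  -- isomorphism; the projections come from its inverse.
  let d : (Limits.biproduct W) ⟶ E.obj := Limits.biproduct.desc fun i => E.weightι ha e i
  have hd' : d = ∑ i : Λ, Limits.biproduct.π W i ≫ E.weightι ha e i := by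
    rw [← Category.id_comp d, ← Limits.biproduct.total, Preadditive.sum_comp]
    refine Finset.sum_congr rfl fun i _ => ?_
    rw [Category.assoc, Limits.biproduct.ι_desc]
  have hd : ∀ (V : X.left.Opens) (s : Γ(Limits.biproduct W, V)), d.app V s =
      ∑ i : Λ, (E.weightι ha e i).app V ((Limits.biproduct.π W i).app V s) := by
    intro V s
    rw [hd', sum_app_apply]
    rfl
  have h1 : Mono d := by
    refine mono_of_locally_injective d fun x => ⟨⊤, trivial, fun V _ s hs => ?_⟩
    rw [hd] at hs
    let m : (Fin t → ℤ) → Γ(E.obj, V) := fun w => if h : w ∈ Λ then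
      (E.weightι ha e w).app V ((Limits.biproduct.π W ⟨w, h⟩).app V s) else 0
    have hm : ∀ i : Λ, m i =
        (E.weightι ha e i).app V ((Limits.biproduct.π W i).app V s) := fun i => dif_pos i.2
    have h2 := eq_zero_of_sum_eq_zero (E := E) (ha := ha) (e := e) Λ (m := m)
      (fun w hw => by rw [hm ⟨w, hw⟩]; exact E.weightι_hasWeight ha e w _)
      (by rw [← Finset.sum_coe_sort]; simpa only [hm] using hs)
    have h3 : ∀ i, (Limits.biproduct.π W i).app V s = 0 := by
      intro i
      apply mono_app_injective (E.weightι ha e i) V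
      refine ((hm i).symm.trans (h2 i i.2)).trans (map_zero ((E.weightι ha e i).app V).hom).symm
    rw [← id_app_apply s, ← Limits.biproduct.total, sum_app_apply]
    refine Finset.sum_eq_zero fun i _ => ?_
    rw [comp_app_apply, h3, map_zero]
  have h2 : Epi d := by
    refine epi_of_locally_surjective d fun x => ?_
    obtain ⟨U, hxU, hU⟩ := hΛ x
    refine ⟨U, hxU, fun V hV s => ?_⟩
    obtain ⟨m, hm, hs⟩ := hU V hV s
    choose n hn using fun i : Λ => (hm i i.2).exists_weightι
    refine ⟨∑ i : Λ, (Limits.biproduct.ι W i).app V (n i), ?_⟩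
    rw [app_sum, hs, ← Finset.sum_coe_sort Λ]
    refine Finset.sum_congr rfl fun i _ => ?_
    rw [← comp_app_apply, Limits.biproduct.ι_desc, hn]
  have h3 : IsIso d := isIso_of_mono_of_epi d
  let π : ∀ w, E.obj ⟶ E.weightModule ha e w := fun w =>
    if h : w ∈ Λ then inv d ≫ Limits.biproduct.π W ⟨w, h⟩ else 0
  have hπ : ∀ i : Λ, π i = inv d ≫ Limits.biproduct.π W i := fun i => dif_pos i.2
  have hπ0 : ∀ w, w ∉ Λ → π w = 0 := fun w hw => dif_neg hw
  have hsum : ∑ w ∈ Λ, π w ≫ E.weightι ha e w = 𝟙 E.obj := by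
    rw [← Finset.sum_coe_sort]
    simp only [hπ, Category.assoc]
    rw [← Preadditive.comp_sum, ← hd', IsIso.inv_hom_id]
  have hsum' : ∀ (V : X.left.Opens) (s : Γ(E.obj, V)) (Λ' : Finset (Fin t → ℤ)), Λ ⊆ Λ' →
      ∑ w ∈ Λ', (E.weightι ha e w).app V ((π w).app V s) = s := by
    intro V s Λ' h
    rw [← Finset.sum_subset h]
    · conv_rhs => rw [← id_app_apply s, ← hsum, sum_app_apply]
      rfl
    · intro w _ hw
      rw [hπ0 w hw, zero_app_apply, map_zero]
  have key : ∀ (w : Fin t → ℤ) (V : X.left.Opens) (s : Γ(E.weightModule ha e w, V))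
      (v : Fin t → ℤ), (E.weightι ha e v).app V ((π v).app V ((E.weightι ha e w).app V s)) =
        if v = w then (E.weightι ha e w).app V s else 0 := by
    intro w V s v
    -- Neither weight is assumed to lie in `Λ`. Over the enlarged set, the weight components of a
    -- section of weight w are unique, hence concentrated in w.
    let Λ' := insert v (insert w Λ)
    have hΛ' : Λ ⊆ Λ' := (Finset.subset_insert _ _).trans (Finset.subset_insert _ _)
    refine sub_eq_zero.1 (eq_zero_of_sum_eq_zero (E := E) (ha := ha) (e := e) Λ'
      (m := fun v => (E.weightι ha e v).app V ((π v).app V ((E.weightι ha e w).app V s)) -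
        if v = w then (E.weightι ha e w).app V s else 0) (fun i _ => ?_) ?_ v
        (Finset.mem_insert_self _ _))
    · refine (E.weightι_hasWeight ha e i _).sub ?_
      split_ifs with h
      · rw [h]
        exact E.weightι_hasWeight ha e w s
      · exact IsEigensection.zero
    · rw [Finset.sum_sub_distrib, hsum' V _ _ hΛ', Finset.sum_ite_eq', if_pos, sub_self]
      exact Finset.mem_insert_of_mem (Finset.mem_insert_self _ _)
  refine ⟨Λ, π, hsum, hπ0, fun w => ?_, fun w v hwv => ?_⟩
  · rw [← cancel_mono (E.weightι ha e w)]
    refine hom_ext_sections fun V s => ?_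
    rw [Category.id_comp]
    exact (key w V s w).trans (if_pos rfl)
  · rw [← cancel_mono (E.weightι ha e v)]
    refine hom_ext_sections fun V s => ?_
    rw [Limits.zero_comp, zero_app_apply]
    exact (key w V s v).trans (if_neg (Ne.symm hwv))

end EquivariantBundle

end WeightModules

/-! ### Universal property of the Grothendieck ring -/

section GrothendieckRing

variable {A B : Type*} [CommRing B] {exact : A → A → A → Prop} {tensor : A → A → A → Prop}
  {unit : A → Prop}

/-- A function satisfying the relations of a Grothendieck ring induces a ring homomorphism. -/
def grothendieckLift (c : A → B) (hexact : ∀ E' E E'', exact E' E E'' → c E = c E' + c E'')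
    (htensor : ∀ E F P, tensor E F P → c P = c E * c F) (hunit : ∀ E, unit E → c E = 1) :
    FreeCommRing A ⧸ grothendieckRelations exact tensor unit →+* B :=
  Ideal.Quotient.lift _ (FreeCommRing.lift c) (by
    change grothendieckRelations exact tensor unit ≤ RingHom.ker (FreeCommRing.lift c)
    refine Ideal.span_le.2 ?_
    rintro r ((⟨E', E, E'', h, rfl⟩ | ⟨E, F, P, h, rfl⟩) | ⟨E, h, rfl⟩)
    · change FreeCommRing.lift c _ = 0
      simp only [map_sub, map_add, FreeCommRing.lift_of, hexact _ _ _ h, sub_self]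
    · change FreeCommRing.lift c _ = 0
      simp only [map_sub, map_mul, FreeCommRing.lift_of, htensor _ _ _ h, sub_self]
    · change FreeCommRing.lift c _ = 0
      simp only [map_sub, map_one, FreeCommRing.lift_of, hunit _ h, sub_self])

lemma grothendieckLift_mk (c : A → B)
    (hexact : ∀ E' E E'', exact E' E E'' → c E = c E' + c E'')
    (htensor : ∀ E F P, tensor E F P → c P = c E * c F) (hunit : ∀ E, unit E → c E = 1) (E : A) :
    grothendieckLift c hexact htensor hunit (Ideal.Quotient.mk _ (FreeCommRing.of E)) = c E := by
  rw [grothendieckLift, Ideal.Quotient.lift_mk, FreeCommRing.lift_of]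

lemma grothendieck_exact {E' E E'' : A} (h : exact E' E E'') :
    Ideal.Quotient.mk (grothendieckRelations exact tensor unit) (FreeCommRing.of E) =
      Ideal.Quotient.mk _ (FreeCommRing.of E') + Ideal.Quotient.mk _ (FreeCommRing.of E'') := by
  rw [← map_add, Ideal.Quotient.mk_eq_mk_iff_sub_mem]
  exact Ideal.subset_span (Or.inl (Or.inl ⟨E', E, E'', h, rfl⟩))

lemma grothendieck_tensor {E F P : A} (h : tensor E F P) :
    Ideal.Quotient.mk (grothendieckRelations exact tensor unit) (FreeCommRing.of P) =
      Ideal.Quotient.mk _ (FreeCommRing.of E) * Ideal.Quotient.mk _ (FreeCommRing.of F) := by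
  rw [← map_mul, Ideal.Quotient.mk_eq_mk_iff_sub_mem]
  exact Ideal.subset_span (Or.inl (Or.inr ⟨E, F, P, h, rfl⟩))

lemma grothendieck_unit {E : A} (h : unit E) :
    Ideal.Quotient.mk (grothendieckRelations exact tensor unit) (FreeCommRing.of E) = 1 := by
  rw [← map_one (Ideal.Quotient.mk _), Ideal.Quotient.mk_eq_mk_iff_sub_mem]
  exact Ideal.subset_span (Or.inr ⟨E, h, rfl⟩)

lemma grothendieck_ringHom_ext
    {f g : FreeCommRing A ⧸ grothendieckRelations exact tensor unit →+* B}
    (h : ∀ E, f (Ideal.Quotient.mk _ (FreeCommRing.of E)) =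
      g (Ideal.Quotient.mk _ (FreeCommRing.of E))) : f = g := by
  refine Ideal.Quotient.ringHom_ext ?_
  exact FreeCommRing.hom_ext h

end GrothendieckRing

/-! ### From split short exact sequences to finite direct sums -/

section SplitInduction

/-- A function on objects that is additive on split short exact sequences is additive on finite
direct sum decompositions. -/
lemma eq_sum_of_split {C : Type*} [Category* C] [Preadditive C] {B : Type*} (o : B → C)
    (adm : ∀ E F : B, (o E ⟶ o F) → Prop) (hid : ∀ E, adm E E (𝟙 _))
    (hcomp : ∀ E F G f g, adm E F f → adm F G g → adm E G (f ≫ g))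
    (hsub : ∀ E F f g, adm E F f → adm E F g → adm E F (f - g))
    (hret : ∀ (M : B) (p : o M ⟶ o M), p ≫ p = p → adm M M p → ∃ (N : B) (i : o N ⟶ o M)
      (q : o M ⟶ o N), adm N M i ∧ adm M N q ∧ i ≫ q = 𝟙 _ ∧ q ≫ i = p)
    {G : Type*} [AddCommGroup G] (cls : B → G)
    (hadd : ∀ (L M N : B) (i : o L ⟶ o M) (p : o M ⟶ o N) (r : o M ⟶ o L) (k : o N ⟶ o M),
      adm L M i → adm M N p → i ≫ r = 𝟙 _ → k ≫ p = 𝟙 _ → i ≫ p = 0 → r ≫ i + p ≫ k = 𝟙 _ →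
        cls M = cls L + cls N)
    {J : Type*} (I : Finset J) (M : B) (N : J → B) (ι' : ∀ j, o (N j) ⟶ o M)
    (π : ∀ j, o M ⟶ o (N j)) (hι : ∀ j ∈ I, adm _ _ (ι' j)) (hπ : ∀ j ∈ I, adm _ _ (π j))
    (hιπ : ∀ j ∈ I, ι' j ≫ π j = 𝟙 _) (hιπ' : ∀ j ∈ I, ∀ k ∈ I, j ≠ k → ι' j ≫ π k = 0)
    (hsum : ∑ j ∈ I, π j ≫ ι' j = 𝟙 (o M)) : cls M = ∑ j ∈ I, cls (N j) := by
  classical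
  induction I using Finset.induction_on generalizing M with
  | empty =>
    rw [Finset.sum_empty] at hsum ⊢
    -- The identity of M is zero, so M → M → M with all maps the identity is split exact and cls M =
    -- cls M + cls M.
    have h := hadd M M M (𝟙 _) (𝟙 _) (𝟙 _) (𝟙 _) (hid M) (hid M) (Category.id_comp _)
      (Category.id_comp _) (by rw [Category.id_comp, ← hsum])
      (by rw [Category.id_comp, ← hsum, add_zero])
    exact left_eq_add.1 h
  | insert w I hw ih =>
    have hwI : w ∈ insert w I := Finset.mem_insert_self w I
    have hI : ∀ {j}, j ∈ I → j ∈ insert w I := fun h => Finset.mem_insert_of_mem h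
    have hne : ∀ {j}, j ∈ I → j ≠ w := fun h h' => hw (h' ▸ h)
    rw [Finset.sum_insert hw] at hsum ⊢
    have hcol : ∑ j ∈ I, π j ≫ ι' j = 𝟙 (o M) - π w ≫ ι' w := by
      rw [← hsum, add_sub_cancel_left]
    -- `K` is the complement of the summand indexed by `w`; the remaining summands decompose it,
    -- which feeds the induction.
    obtain ⟨K, κ, ρ, hκ, hρ, hκρ, hρκ⟩ := hret M (𝟙 _ - π w ≫ ι' w) (by
      simp only [Preadditive.comp_sub, Preadditive.sub_comp, Category.id_comp, Category.comp_id,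
        Category.assoc, reassoc_of% hιπ w hwI, sub_self, sub_zero])
      (hsub _ _ _ _ (hid M) (hcomp _ _ _ _ _ (hπ w hwI) (hι w hwI)))
    have hιρ : ι' w ≫ ρ = 0 := by
      have h : ι' w ≫ ρ ≫ κ = 0 := by
        rw [hρκ, Preadditive.comp_sub, Category.comp_id, ← Category.assoc, hιπ w hwI,
          Category.id_comp, sub_self]
      rw [← Category.comp_id (ι' w ≫ ρ), ← hκρ, Category.assoc, ← Category.assoc ρ,
        ← Category.assoc, h, Limits.zero_comp]
    have hρκι : ∀ j ∈ I, ι' j ≫ ρ ≫ κ = ι' j := fun j hj => by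
      rw [hρκ, Preadditive.comp_sub, Category.comp_id, ← Category.assoc,
        hιπ' j (hI hj) w hwI (hne hj), Limits.zero_comp, sub_zero]
    rw [hadd (N w) M K (ι' w) ρ (π w) κ (hι w hwI) hρ (hιπ w hwI) hκρ hιρ
      (by rw [hρκ, add_sub_cancel]), ih K (fun j => ι' j ≫ ρ) (fun j => κ ≫ π j)
      (fun j hj => hcomp _ _ _ _ _ (hι j (hI hj)) hρ)
      (fun j hj => hcomp _ _ _ _ _ hκ (hπ j (hI hj)))
      (fun j hj => by
        rw [Category.assoc, ← Category.assoc ρ, ← Category.assoc, hρκι j hj, hιπ j (hI hj)])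
      (fun j hj k hk hjk => by
        rw [Category.assoc, ← Category.assoc ρ, ← Category.assoc, hρκι j hj,
          hιπ' j (hI hj) k (hI hk) hjk])
      (by
        have h : ∑ j ∈ I, (κ ≫ π j) ≫ ι' j ≫ ρ = κ ≫ (∑ j ∈ I, π j ≫ ι' j) ≫ ρ := by
          simp only [Preadditive.sum_comp, Preadditive.comp_sum, Category.assoc]
        rw [h, hcol, ← hρκ, Category.assoc, hκρ, Category.comp_id, hκρ])]

end SplitInduction

/-! ### Classes of vector bundles and direct sums -/

section VectorBundleClasses

variable {X : Scheme.{u}}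

lemma K0.mk_exact {E' E E'' : VectorBundle X} (h : VectorBundle.Exact E' E E'') :
    K0.mk E = K0.mk E' + K0.mk E'' := grothendieck_exact h

lemma K0.mk_tensor {E F P : VectorBundle X} (h : VectorBundle.IsTensor E F P) :
    K0.mk P = K0.mk E * K0.mk F := grothendieck_tensor h

lemma K0.mk_unit {E : VectorBundle X} (h : E.IsTrivialLine) : K0.mk E = 1 := grothendieck_unit h

lemma shortExact_of_split {C : Type*} [Category* C] [Preadditive C] [Limits.HasZeroObject C] {L M N : C} (i : L ⟶ M)
    (p : M ⟶ N) (r : M ⟶ L) (k : N ⟶ M) (hir : i ≫ r = 𝟙 _) (hkp : k ≫ p = 𝟙 _)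
    (hip : i ≫ p = 0) (h : r ≫ i + p ≫ k = 𝟙 _) : (ShortComplex.mk i p hip).ShortExact :=
  (ShortComplex.Splitting.mk (S := ShortComplex.mk i p hip) r k hir hkp h).shortExact

lemma exists_retract_of_idempotent {M : X.Modules} (p : M ⟶ M) (hp : p ≫ p = p) :
    ∃ (N : X.Modules) (i : N ⟶ M) (q : M ⟶ N), i ≫ q = 𝟙 _ ∧ q ≫ i = p := by
  obtain ⟨N, i, q, h1, h2⟩ := IsIdempotentComplete.idempotents_split M p hp
  exact ⟨N, i, q, h1, h2⟩

/-- Classes in `K_0` are additive on direct sum decompositions. -/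
lemma K0.mk_eq_sum {J : Type*} (I : Finset J) (M : VectorBundle X) (N : J → VectorBundle X)
    (ι' : ∀ j, (N j).obj ⟶ M.obj) (π : ∀ j, M.obj ⟶ (N j).obj)
    (hιπ : ∀ j ∈ I, ι' j ≫ π j = 𝟙 _) (hιπ' : ∀ j ∈ I, ∀ k ∈ I, j ≠ k → ι' j ≫ π k = 0)
    (hsum : ∑ j ∈ I, π j ≫ ι' j = 𝟙 M.obj) : K0.mk M = ∑ j ∈ I, K0.mk (N j) := by
  refine eq_sum_of_split VectorBundle.obj (fun _ _ _ => True) (fun _ => trivial)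
    (fun _ _ _ _ _ _ _ => trivial) (fun _ _ _ _ _ _ => trivial) ?_ K0.mk ?_ I M N ι' π
    (fun _ _ => trivial) (fun _ _ => trivial) hιπ hιπ' hsum
  · intro M p hp _
    obtain ⟨N, i, q, h1, h2⟩ := exists_retract_of_idempotent p hp
    exact ⟨⟨N, M.isFiniteLocallyFree.of_retract i q h1⟩, i, q, trivial, trivial, h1, h2⟩
  · intro L M N i p r k _ _ h1 h2 h3 h4
    exact K0.mk_exact ⟨i, p, h3, shortExact_of_split i p r k h1 h2 h3 h4⟩

end VectorBundleClasses

/-! ### Equivariant structures on retracts -/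

section EquivariantRetracts

variable {X Y Z : Scheme.{u}}

instance (f : Y ⟶ X) : (Scheme.Modules.pullback f).Additive :=
  (Scheme.Modules.pullbackPushforwardAdjunction f).left_adjoint_additive

lemma baseChange_naturality (k : Z ⟶ Y) {f g : Y ⟶ X} {f' g' : Z ⟶ X} (hf : k ≫ f = f')
    (hg : k ≫ g = g') {M N : X.Modules}
    (φM : (Scheme.Modules.pullback f).obj M ≅ (Scheme.Modules.pullback g).obj M)
    (φN : (Scheme.Modules.pullback f).obj N ≅ (Scheme.Modules.pullback g).obj N) (v : M ⟶ N)
    (h : φM.hom ≫ (Scheme.Modules.pullback g).map v =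
      (Scheme.Modules.pullback f).map v ≫ φN.hom) :
    (baseChange k hf hg φM).hom ≫ (Scheme.Modules.pullback g').map v =
      (Scheme.Modules.pullback f').map v ≫ (baseChange k hf hg φN).hom := by
  subst hf
  subst hg
  simp only [baseChange, Scheme.Modules.pullbackCongr, eqToIso_refl, Iso.trans_hom,
    Iso.app_hom, Iso.symm_hom, Functor.mapIso_hom, Iso.refl_symm, Iso.refl_hom,
    NatTrans.id_app, Category.comp_id, Category.id_comp, Category.assoc]
  have h1 := (Scheme.Modules.pullbackComp k g).hom.naturality v
  have h2 := (Scheme.Modules.pullbackComp k f).inv.naturality v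
  have h3 := congrArg (Scheme.Modules.pullback k).map h
  rw [Functor.map_comp, Functor.map_comp] at h3
  change (Scheme.Modules.pullback k).map ((Scheme.Modules.pullback g).map v) ≫ _ = _ at h1
  change _ = _ ≫ (Scheme.Modules.pullback k).map ((Scheme.Modules.pullback f).map v) at h2
  rw [← h1, reassoc_of% h3, reassoc_of% h2]

/-- Compressing φ and its inverse by `i` and `q` gives mutually inverse maps because φ commutes with
the idempotent q ≫ i. -/
lemma exists_iso_of_retract {f g : Y ⟶ X} {M N : X.Modules}
    (φ : (Scheme.Modules.pullback f).obj M ≅ (Scheme.Modules.pullback g).obj M)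
    (i : N ⟶ M) (q : M ⟶ N) (hiq : i ≫ q = 𝟙 _)
    (h : φ.hom ≫ (Scheme.Modules.pullback g).map (q ≫ i) =
      (Scheme.Modules.pullback f).map (q ≫ i) ≫ φ.hom) :
    ∃ φN : (Scheme.Modules.pullback f).obj N ≅ (Scheme.Modules.pullback g).obj N,
      φN.hom ≫ (Scheme.Modules.pullback g).map i = (Scheme.Modules.pullback f).map i ≫ φ.hom ∧
      φ.hom ≫ (Scheme.Modules.pullback g).map q =
        (Scheme.Modules.pullback f).map q ≫ φN.hom := by
  have hf : (Scheme.Modules.pullback f).map i ≫ (Scheme.Modules.pullback f).map q = 𝟙 _ := by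
    rw [← Functor.map_comp, hiq, CategoryTheory.Functor.map_id]
  have hg : (Scheme.Modules.pullback g).map i ≫ (Scheme.Modules.pullback g).map q = 𝟙 _ := by
    rw [← Functor.map_comp, hiq, CategoryTheory.Functor.map_id]
  rw [Functor.map_comp, Functor.map_comp, Category.assoc] at h
  have h' : φ.inv ≫ (Scheme.Modules.pullback f).map q ≫ (Scheme.Modules.pullback f).map i =
      (Scheme.Modules.pullback g).map q ≫ (Scheme.Modules.pullback g).map i ≫ φ.inv := by
    rw [Iso.inv_comp_eq, ← Category.assoc (Scheme.Modules.pullback g |>.map q),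
      ← Category.assoc φ.hom, h]
    simp
  refine ⟨⟨(Scheme.Modules.pullback f).map i ≫ φ.hom ≫ (Scheme.Modules.pullback g).map q,
    (Scheme.Modules.pullback g).map i ≫ φ.inv ≫ (Scheme.Modules.pullback f).map q, ?_, ?_⟩, ?_, ?_⟩
  · simp only [Category.assoc]
    rw [reassoc_of% h, Iso.hom_inv_id_assoc, reassoc_of% hf, hf]
  · simp only [Category.assoc]
    rw [reassoc_of% h', Iso.inv_hom_id_assoc, reassoc_of% hg, hg]
  · simp only [Category.assoc]
    rw [h, reassoc_of% hf]
  · change _ = (Scheme.Modules.pullback f).map q ≫ (Scheme.Modules.pullback f).map i ≫ φ.hom ≫ _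
    rw [← reassoc_of% h, hg, Category.comp_id]

end EquivariantRetracts

/-! ### Classes of equivariant bundles and direct sums -/

section EquivariantClasses

variable {S : Scheme.{u}} {G X : Over S} [GrpObj G] {a : ModObj G X}

lemma EquivariantK0.mk_exact {E' E E'' : EquivariantBundle a}
    (h : EquivariantBundle.Exact E' E E'') :
    EquivariantK0.mk E = EquivariantK0.mk E' + EquivariantK0.mk E'' := grothendieck_exact h

lemma EquivariantK0.mk_tensor {E F P : EquivariantBundle a}
    (h : EquivariantBundle.IsTensor E F P) :
    EquivariantK0.mk P = EquivariantK0.mk E * EquivariantK0.mk F := grothendieck_tensor h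

lemma EquivariantK0.mk_unit {E : EquivariantBundle a} (h : E.IsTrivialLine) :
    EquivariantK0.mk E = 1 := grothendieck_unit h

/-- The cocycle condition for a submodule with a retraction. -/
lemma IsCocycle.of_retract {M N : X.left.Modules}
    {φ : (Scheme.Modules.pullback (snd G X).left).obj M ≅
      (Scheme.Modules.pullback (actMap a).left).obj M} (hφ : IsCocycle a M φ)
    (φN : (Scheme.Modules.pullback (snd G X).left).obj N ≅
      (Scheme.Modules.pullback (actMap a).left).obj N) (i : N ⟶ M) (q : M ⟶ N)
    (hiq : i ≫ q = 𝟙 _)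
    (h : φN.hom ≫ (Scheme.Modules.pullback (actMap a).left).map i =
      (Scheme.Modules.pullback (snd G X).left).map i ≫ φ.hom) : IsCocycle a N φN := by
  have : Mono ((Scheme.Modules.pullback (G ◁ actMap a ≫ actMap a).left).map i) := by
    have : IsSplitMono i := ⟨⟨⟨q, hiq⟩⟩⟩
    infer_instance
  rw [IsCocycle, ← cancel_mono ((Scheme.Modules.pullback (G ◁ actMap a ≫ actMap a).left).map i)]
  rw [baseChange_naturality _ _ _ φN φ i h, Category.assoc,
    baseChange_naturality (G ◁ actMap a).left _ _ φN φ i h, hφ, ← Category.assoc,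
    ← Category.assoc, baseChange_naturality (snd G (G ⊗ X)).left _ _ φN φ i h]

/-- The image of an equivariant idempotent inherits the isomorphism, the cocycle condition and local
freeness. This supplies the complements in `eq_sum_of_split`. -/
lemma EquivariantBundle.exists_retract (M : EquivariantBundle a) (p : M.obj ⟶ M.obj)
    (hp : p ≫ p = p) (h : EquivariantBundle.IsEquivariantHom M M p) :
    ∃ (N : EquivariantBundle a) (i : N.obj ⟶ M.obj) (q : M.obj ⟶ N.obj),
      EquivariantBundle.IsEquivariantHom N M i ∧ EquivariantBundle.IsEquivariantHom M N q ∧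
      i ≫ q = 𝟙 _ ∧ q ≫ i = p := by
  obtain ⟨N, i, q, h1, h2⟩ := exists_retract_of_idempotent p hp
  obtain ⟨φN, h3, h4⟩ := exists_iso_of_retract M.φ i q h1 (by rw [h2]; exact h)
  exact ⟨⟨N, M.isFiniteLocallyFree.of_retract i q h1, φN, M.cocycle.of_retract φN i q h1 h3⟩,
    i, q, h3, h4, h1, h2⟩

/-- Classes in the equivariant `K_0` are additive on equivariant direct sum decompositions. -/
lemma EquivariantK0.mk_eq_sum {J : Type*} (I : Finset J) (M : EquivariantBundle a)
    (N : J → EquivariantBundle a)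
    (ι' : ∀ j, (N j).obj ⟶ M.obj) (π : ∀ j, M.obj ⟶ (N j).obj)
    (hι : ∀ j ∈ I, EquivariantBundle.IsEquivariantHom (N j) M (ι' j))
    (hπ : ∀ j ∈ I, EquivariantBundle.IsEquivariantHom M (N j) (π j))
    (hιπ : ∀ j ∈ I, ι' j ≫ π j = 𝟙 _) (hιπ' : ∀ j ∈ I, ∀ k ∈ I, j ≠ k → ι' j ≫ π k = 0)
    (hsum : ∑ j ∈ I, π j ≫ ι' j = 𝟙 M.obj) :
    EquivariantK0.mk M = ∑ j ∈ I, EquivariantK0.mk (N j) := by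
  refine eq_sum_of_split EquivariantBundle.obj EquivariantBundle.IsEquivariantHom ?_ ?_ ?_
    EquivariantBundle.exists_retract EquivariantK0.mk ?_ I M N ι' π hι hπ hιπ hιπ' hsum
  · intro E
    rw [EquivariantBundle.IsEquivariantHom, CategoryTheory.Functor.map_id, CategoryTheory.Functor.map_id, Category.comp_id,
      Category.id_comp]
  · intro E F G f g hf hg
    rw [EquivariantBundle.IsEquivariantHom] at hf hg ⊢
    rw [Functor.map_comp, Functor.map_comp, reassoc_of% hf, hg, Category.assoc]
  · intro E F f g hf hg
    rw [EquivariantBundle.IsEquivariantHom] at hf hg ⊢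
    rw [Functor.map_sub, Functor.map_sub, Preadditive.comp_sub, Preadditive.sub_comp, hf, hg]
  · intro L M N i p r k h1 h2 h3 h4 h5 h6
    exact EquivariantK0.mk_exact ⟨i, p, h5, h1, h2, shortExact_of_split i p r k h3 h4 h5 h6⟩

end EquivariantClasses

/-! ### Retracts of short exact sequences -/

section RetractExact

/-- In the middle, an element killed by `g₀` is included by `i`, lifted along `f` after a
refinement, and projected back by `p'`. -/
lemma shortExact_of_retract {C : Type*} [Category* C] [Abelian C] {A' A A'' B' B B'' : C}
    {f : A' ⟶ A} {g : A ⟶ A''} {w : f ≫ g = 0} (h : (ShortComplex.mk f g w).ShortExact)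
    {i' : B' ⟶ A'} {i : B ⟶ A} {i'' : B'' ⟶ A''} {p' : A' ⟶ B'} {p : A ⟶ B} {p'' : A'' ⟶ B''}
    (h' : i' ≫ p' = 𝟙 _) (hi : i ≫ p = 𝟙 _) (h'' : i'' ≫ p'' = 𝟙 _)
    (f₀ : B' ⟶ B) (g₀ : B ⟶ B'') (hfi : f₀ ≫ i = i' ≫ f) (hgi : g₀ ≫ i'' = i ≫ g)
    (hfp : p' ≫ f₀ = f ≫ p) (hgp : p ≫ g₀ = g ≫ p'') :
    ∃ w₀ : f₀ ≫ g₀ = 0, (ShortComplex.mk f₀ g₀ w₀).ShortExact := by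
  have hf : Mono f := h.mono_f
  have hg : Epi g := h.epi_g
  have hmono : Mono i' := mono_of_mono_fac h'
  have hmono'' : Mono i'' := mono_of_mono_fac h''
  have hepi'' : Epi p'' := epi_of_epi_fac h''
  have w₀ : f₀ ≫ g₀ = 0 := by
    rw [← cancel_mono i'', Category.assoc, hgi, reassoc_of% hfi, w, Limits.comp_zero,
      Limits.zero_comp]
  have h1 : Mono f₀ := by
    have : Mono (f₀ ≫ i) := by rw [hfi]; infer_instance
    exact mono_of_mono f₀ i
  have h2 : Epi g₀ := by
    have : Epi (p ≫ g₀) := by rw [hgp]; infer_instance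
    exact epi_of_epi p g₀
  refine ⟨w₀, ?_⟩
  have hex : (ShortComplex.mk f₀ g₀ w₀).Exact := by
    rw [ShortComplex.exact_iff_exact_up_to_refinements]
    intro A₀ x hx
    change A₀ ⟶ B at x
    change x ≫ g₀ = 0 at hx
    obtain ⟨A₁, q, hq, y, hy⟩ := (ShortComplex.exact_iff_exact_up_to_refinements _).1 h.exact
      (x ≫ i) (by
        change (x ≫ i) ≫ g = 0
        rw [Category.assoc, ← hgi, reassoc_of% hx, Limits.zero_comp])
    change A₁ ⟶ A' at y
    change q ≫ x ≫ i = y ≫ f at hy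
    refine ⟨A₁, q, hq, y ≫ p', ?_⟩
    change q ≫ x = (y ≫ p') ≫ f₀
    rw [Category.assoc, hfp, ← reassoc_of% hy, hi, Category.comp_id]
  exact ShortComplex.ShortExact.mk' hex h1 h2

end RetractExact

/-! ### Eigensections under morphisms and bilinear maps -/

section EigensectionFunctoriality

variable {X Y : Scheme.{u}}

lemma IsEigensection.map {f g : Y ⟶ X} (h : f = g) {M N : X.Modules}
    (φM : (Scheme.Modules.pullback f).obj M ≅ (Scheme.Modules.pullback g).obj M)
    (φN : (Scheme.Modules.pullback f).obj N ≅ (Scheme.Modules.pullback g).obj N) (v : M ⟶ N)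
    (hv : φM.hom ≫ (Scheme.Modules.pullback g).map v =
      (Scheme.Modules.pullback f).map v ≫ φN.hom) {c : Γ(Y, ⊤)} {U : X.Opens} {s : Γ(M, U)}
    (hs : IsEigensection f (selfIso h φM).hom c s) :
    IsEigensection f (selfIso h φN).hom c (v.app U s) := by
  subst h
  rw [selfIso_rfl] at hs ⊢
  rw [IsEigensection, ← pullback_map_pullbackSection, ← comp_app_apply, ← hv, comp_app_apply,
    hs, app_smul]

/-- The isomorphisms act diagonally through the pulled back bilinear maps, so eigenvalues multiply;
for characters this says that weights add. -/
lemma IsEigensection.pairing {f g : Y ⟶ X} (h : f = g) {M N P : X.Modules}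
    (φM : (Scheme.Modules.pullback f).obj M ≅ (Scheme.Modules.pullback g).obj M)
    (φN : (Scheme.Modules.pullback f).obj N ≅ (Scheme.Modules.pullback g).obj N)
    (φP : (Scheme.Modules.pullback f).obj P ≅ (Scheme.Modules.pullback g).obj P)
    (β : Pairing M N P)
    (β₁ : Pairing ((Scheme.Modules.pullback f).obj M) ((Scheme.Modules.pullback f).obj N)
      ((Scheme.Modules.pullback f).obj P))
    (β₂ : Pairing ((Scheme.Modules.pullback g).obj M) ((Scheme.Modules.pullback g).obj N)
      ((Scheme.Modules.pullback g).obj P))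
    (hβ₁ : β.IsPullback f β₁) (hβ₂ : β.IsPullback g β₂)
    (H : ∀ (U : Y.Opens) (m : Γ((Scheme.Modules.pullback f).obj M, U))
      (n : Γ((Scheme.Modules.pullback f).obj N, U)),
      φP.hom.app U (β₁.toFun U m n) = β₂.toFun U (φM.hom.app U m) (φN.hom.app U n))
    {c d : Γ(Y, ⊤)} {U : X.Opens} {m : Γ(M, U)} {n : Γ(N, U)}
    (hm : IsEigensection f (selfIso h φM).hom c m)
    (hn : IsEigensection f (selfIso h φN).hom d n) :
    IsEigensection f (selfIso h φP).hom (c * d) (β.toFun U m n) := by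
  subst h
  rw [selfIso_rfl] at hm hn ⊢
  rw [IsEigensection, ← hβ₁, H, hm, hn, map_smul, map_smul, LinearMap.smul_apply, hβ₁, hβ₂,
    smul_smul, ← map_mul, mul_comm d c]

lemma isEigensection_scalarCongr {f g : Y ⟶ X} (h : f = g) (M : X.Modules) (r : Γ(Y, ⊤)ˣ)
    {U : X.Opens} (s : Γ(M, U)) :
    IsEigensection f (selfIso h (scalarCongr h M r)).hom (r : Γ(Y, ⊤)) s := by
  subst h
  rw [selfIso_rfl]
  simp only [scalarCongr, scalarIso, Scheme.Modules.pullbackCongr, eqToIso_refl, Iso.trans_hom,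
    Iso.app_hom, Iso.refl_hom, NatTrans.id_app, Category.comp_id]
  rfl

lemma isEigensection_one_of_eq {f g : Y ⟶ X} (h : f = g) {M : X.Modules}
    (φ : (Scheme.Modules.pullback f).obj M ≅ (Scheme.Modules.pullback g).obj M) {s : Γ(M, ⊤)}
    (hs : φ.hom.app ⊤ (pullbackSection f (U := ⊤) s) = pullbackSection g (U := ⊤) s) :
    IsEigensection f (selfIso h φ).hom 1 s := by
  subst h
  rw [selfIso_rfl, IsEigensection, map_one, one_smul]
  exact hs

/-- A morphism whose values are eigensections intertwines the equivariant structures. -/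
lemma comp_map_eq_of_isEigensection {f g : Y ⟶ X} (h : f = g) {M N : X.Modules}
    (φ : (Scheme.Modules.pullback f).obj M ≅ (Scheme.Modules.pullback g).obj M) (v : N ⟶ M)
    (r : Γ(Y, ⊤)ˣ) (hv : ∀ (U : X.Opens) (s : Γ(N, U)),
      IsEigensection f (selfIso h φ).hom (r : Γ(Y, ⊤)) (v.app U s)) :
    (scalarCongr h N r).hom ≫ (Scheme.Modules.pullback g).map v =
      (Scheme.Modules.pullback f).map v ≫ φ.hom := by
  subst h
  rw [selfIso_rfl] at hv
  refine pullback_hom_ext f fun U s => ?_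
  have h1 : (scalarCongr rfl N r).hom = scalar ((Scheme.Modules.pullback f).obj N) r := by
    simp only [scalarCongr, scalarIso, Scheme.Modules.pullbackCongr, eqToIso_refl, Iso.trans_hom,
      Iso.app_hom, Iso.refl_hom, NatTrans.id_app, Category.comp_id]
  rw [h1, scalar_comp, comp_app_apply, comp_app_apply, pullback_map_pullbackSection, hv U s]
  rfl

end EigensectionFunctoriality

/-! ### The character of an equivariant bundle -/

section Character

variable {S : Scheme.{u}} {T : Over S} [GrpObj T] {t : ℕ} {X : Over S} {a : ModObj T X}

namespace EquivariantBundle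

lemma HasWeight.map {E F : EquivariantBundle a} {ha : IsTrivialAction a} {e : Splitting T t}
    {w : Fin t → ℤ} {v : E.obj ⟶ F.obj} (hv : IsEquivariantHom E F v) {U : X.left.Opens}
    {s : Γ(E.obj, U)} (hs : E.HasWeight ha e w s) : F.HasWeight ha e w (v.app U s) := by
  rw [HasWeight, auto_eq] at hs ⊢
  exact hs.map (congrArg Over.Hom.left ha.symm) E.φ F.φ v hv

variable [CompactSpace X.left] (E F : EquivariantBundle a) (ha : IsTrivialAction a)
  (e : Splitting T t)

/-- A finite set containing the weights of `E`. -/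
def weights : Finset (Fin t → ℤ) := (E.exists_weight_decomposition ha e).choose

/-- The projection to the sections of weight `w`. -/
def weightπ (w : Fin t → ℤ) : E.obj ⟶ E.weightModule ha e w :=
  (E.exists_weight_decomposition ha e).choose_spec.choose w

lemma sum_weightπ : ∑ w ∈ E.weights ha e, E.weightπ ha e w ≫ E.weightι ha e w = 𝟙 E.obj :=
  (E.exists_weight_decomposition ha e).choose_spec.choose_spec.1

lemma weightπ_eq_zero {w : Fin t → ℤ} (hw : w ∉ E.weights ha e) : E.weightπ ha e w = 0 :=
  (E.exists_weight_decomposition ha e).choose_spec.choose_spec.2.1 w hw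

lemma weightι_weightπ (w : Fin t → ℤ) : E.weightι ha e w ≫ E.weightπ ha e w = 𝟙 _ :=
  (E.exists_weight_decomposition ha e).choose_spec.choose_spec.2.2.1 w

lemma weightι_weightπ_ne {w v : Fin t → ℤ} (h : w ≠ v) :
    E.weightι ha e w ≫ E.weightπ ha e v = 0 :=
  (E.exists_weight_decomposition ha e).choose_spec.choose_spec.2.2.2 w v h

/-- The bundle of sections of weight `w`. -/
def weightBundle (w : Fin t → ℤ) : VectorBundle X.left where
  obj := E.weightModule ha e w
  isFiniteLocallyFree := E.isFiniteLocallyFree.of_retract _ _ (E.weightι_weightπ ha e w)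

lemma comp_weightπ_eq_zero {w v : Fin t → ℤ} (h : w ≠ v) {N : X.left.Modules} (k : N ⟶ E.obj)
    (hk : ∀ (U : X.left.Opens) (s : Γ(N, U)), E.HasWeight ha e w (k.app U s)) :
    k ≫ E.weightπ ha e v = 0 := by
  obtain ⟨l, rfl⟩ := E.exists_lift_weightι ha e k hk
  rw [Category.assoc, E.weightι_weightπ_ne ha e h, Limits.comp_zero]

lemma comp_weightπ_weightι {w : Fin t → ℤ} {N : X.left.Modules} (k : N ⟶ E.obj)
    (hk : ∀ v, v ≠ w → k ≫ E.weightπ ha e v = 0) :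
    k ≫ E.weightπ ha e w ≫ E.weightι ha e w = k := by
  conv_rhs => rw [← Category.comp_id k, ← E.sum_weightπ ha e, Preadditive.comp_sum]
  symm
  refine Finset.sum_eq_single w (fun v _ hv => ?_) fun hw => ?_
  · rw [← Category.assoc, hk v hv, Limits.zero_comp]
  · rw [E.weightπ_eq_zero ha e hw, Limits.zero_comp, Limits.comp_zero]

lemma weightπ_comp_eq {w : Fin t → ℤ} {N : X.left.Modules} (k : E.obj ⟶ N)
    (hk : ∀ v, v ≠ w → E.weightι ha e v ≫ k = 0) :
    E.weightπ ha e w ≫ E.weightι ha e w ≫ k = k := by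
  conv_rhs => rw [← Category.id_comp k, ← E.sum_weightπ ha e, Preadditive.sum_comp]
  symm
  refine (Finset.sum_eq_single w (fun v _ hv => ?_) fun hw => ?_).trans (Category.assoc _ _ _)
  · rw [Category.assoc, hk v hv, Limits.comp_zero]
  · rw [E.weightπ_eq_zero ha e hw, Limits.zero_comp, Limits.zero_comp]

/-- The identity of this weight module factors through a zero projection, so the bundle is the empty
direct sum. -/
lemma mk_weightBundle_eq_zero {w : Fin t → ℤ} (hw : w ∉ E.weights ha e) :
    K0.mk (E.weightBundle ha e w) = 0 := by
  have h : 𝟙 (E.weightBundle ha e w).obj = 0 := by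
    change 𝟙 (E.weightModule ha e w) = 0
    rw [← E.weightι_weightπ ha e w, E.weightπ_eq_zero ha e hw, Limits.comp_zero]
  exact (K0.mk_eq_sum (∅ : Finset PUnit.{1}) (E.weightBundle ha e w)
    (fun _ => E.weightBundle ha e w) (fun _ => 𝟙 _) (fun _ => 𝟙 _) (by simp) (by simp)
    (by rw [Finset.sum_empty, h])).trans Finset.sum_empty

/-- The character of `E`, the formal sum of the classes of its weight bundles. -/
def character : AddMonoidAlgebra (K0 X.left) (Fin t → ℤ) :=
  ∑ w ∈ E.weights ha e, AddMonoidAlgebra.single w (K0.mk (E.weightBundle ha e w))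

/-- No condition on `w` is needed, since the class vanishes outside the chosen set; hence the
character does not depend on that choice. -/
lemma coeff_character (w : Fin t → ℤ) :
    (E.character ha e).coeff w = K0.mk (E.weightBundle ha e w) := by
  classical
  rw [character, AddMonoidAlgebra.coeff_sum, Finsupp.finsetSum_apply]
  simp only [AddMonoidAlgebra.coeff_single, Finsupp.single_apply, Finset.sum_ite_eq']
  split_ifs with h
  · rfl
  · exact (E.mk_weightBundle_eq_zero ha e h).symm

/-- The character can be computed from a decomposition into summands of a given weight. -/
lemma character_eq_sum {J : Type*} (I : Finset J) (N : J → VectorBundle X.left)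
    (ι' : ∀ j, (N j).obj ⟶ E.obj) (π : ∀ j, E.obj ⟶ (N j).obj)
    (hιπ : ∀ j ∈ I, ι' j ≫ π j = 𝟙 _) (hιπ' : ∀ j ∈ I, ∀ k ∈ I, j ≠ k → ι' j ≫ π k = 0)
    (hsum : ∑ j ∈ I, π j ≫ ι' j = 𝟙 E.obj) (deg : J → (Fin t → ℤ))
    (hdeg : ∀ j ∈ I, ∀ w, w ≠ deg j → ι' j ≫ E.weightπ ha e w = 0) :
    E.character ha e = ∑ j ∈ I, AddMonoidAlgebra.single (deg j) (K0.mk (N j)) := by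
  classical
  ext w
  rw [E.coeff_character ha e, AddMonoidAlgebra.coeff_sum, Finsupp.finsetSum_apply]
  simp only [AddMonoidAlgebra.coeff_single, Finsupp.single_apply]
  rw [← Finset.sum_filter]
  -- The summands of degree w lie inside the weight module of w, and they decompose it.
  have key : ∀ j ∈ I.filter (fun j => deg j = w),
      ι' j ≫ E.weightπ ha e w ≫ E.weightι ha e w = ι' j := by
    intro j hj
    rw [Finset.mem_filter] at hj
    refine E.comp_weightπ_weightι ha e _ fun v hv => hdeg j hj.1 v ?_
    rwa [hj.2]
  refine K0.mk_eq_sum _ (E.weightBundle ha e w) N (fun j => ι' j ≫ E.weightπ ha e w)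
    (fun j => E.weightι ha e w ≫ π j) (fun j hj => ?_) (fun j hj k hk hjk => ?_) ?_
  · change (ι' j ≫ E.weightπ ha e w) ≫ E.weightι ha e w ≫ π j = _
    rw [Category.assoc, ← Category.assoc (E.weightπ ha e w), ← Category.assoc, key j hj,
      hιπ j (Finset.mem_of_mem_filter j hj)]
  · change (ι' j ≫ E.weightπ ha e w) ≫ E.weightι ha e w ≫ π k = _
    rw [Category.assoc, ← Category.assoc (E.weightπ ha e w), ← Category.assoc, key j hj,
      hιπ' j (Finset.mem_of_mem_filter j hj) k (Finset.mem_of_mem_filter k hk) hjk]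
  · change ∑ j ∈ I.filter (fun j => deg j = w),
      (E.weightι ha e w ≫ π j) ≫ ι' j ≫ E.weightπ ha e w = 𝟙 (E.weightModule ha e w)
    rw [Finset.sum_filter_of_ne]
    · have h : ∑ j ∈ I, (E.weightι ha e w ≫ π j) ≫ ι' j ≫ E.weightπ ha e w =
          E.weightι ha e w ≫ (∑ j ∈ I, π j ≫ ι' j) ≫ E.weightπ ha e w := by
        simp only [Preadditive.sum_comp, Preadditive.comp_sum, Category.assoc]
      rw [h, hsum, Category.id_comp, E.weightι_weightπ ha e w]
    · intro j hj hne
      by_contra h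
      refine hne ?_
      rw [hdeg j hj w (Ne.symm h), Limits.comp_zero]

variable {E F} in
-- Equivariant maps preserve weights, hence commute with the inclusions and projections of weight
-- modules. The weight w part is thus a retract of the given exact sequence.
lemma weight_exact {E' E E'' : EquivariantBundle a} (h : Exact E' E E'') (w : Fin t → ℤ) :
    VectorBundle.Exact (E'.weightBundle ha e w) (E.weightBundle ha e w)
      (E''.weightBundle ha e w) := by
  obtain ⟨f, g, hfg, hf, hg, hex⟩ := h
  have key : ∀ {E F : EquivariantBundle a} (k : E.obj ⟶ F.obj) (hk : IsEquivariantHom E F k)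
      {w v : Fin t → ℤ}, w ≠ v → E.weightι ha e w ≫ k ≫ F.weightπ ha e v = 0 := by
    intro E F k hk w v hwv
    rw [← Category.assoc]
    exact F.comp_weightπ_eq_zero ha e hwv _ fun U s => (E.weightι_hasWeight ha e w s).map hk
  have key₁ : ∀ {E F : EquivariantBundle a} (k : E.obj ⟶ F.obj) (hk : IsEquivariantHom E F k),
      (E.weightι ha e w ≫ k ≫ F.weightπ ha e w) ≫ F.weightι ha e w = E.weightι ha e w ≫ k := by
    intro E F k hk
    simp only [Category.assoc]
    rw [← Category.assoc]
    refine F.comp_weightπ_weightι ha e _ fun v hv => ?_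
    rw [Category.assoc, key k hk hv.symm]
  have key₂ : ∀ {E F : EquivariantBundle a} (k : E.obj ⟶ F.obj) (hk : IsEquivariantHom E F k),
      E.weightπ ha e w ≫ E.weightι ha e w ≫ k ≫ F.weightπ ha e w = k ≫ F.weightπ ha e w := by
    intro E F k hk
    exact E.weightπ_comp_eq ha e _ fun v hv => key k hk hv
  obtain ⟨w₀, h₀⟩ := shortExact_of_retract hex (E'.weightι_weightπ ha e w)
    (E.weightι_weightπ ha e w) (E''.weightι_weightπ ha e w) _ _ (key₁ f hf) (key₁ g hg)
    (key₂ f hf) (key₂ g hg)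
  exact ⟨_, _, w₀, h₀⟩

lemma character_exact {E' E E'' : EquivariantBundle a} (h : Exact E' E E'') :
    E.character ha e = E'.character ha e + E''.character ha e := by
  ext w
  rw [AddMonoidAlgebra.coeff_add, Finsupp.add_apply, E.coeff_character, E'.coeff_character,
    E''.coeff_character]
  exact K0.mk_exact (weight_exact ha e h w)

lemma character_of_iso (N : VectorBundle X.left) (i : N.obj ≅ E.obj) (w : Fin t → ℤ)
    (h : ∀ (U : X.left.Opens) (s : Γ(N.obj, U)), E.HasWeight ha e w (i.hom.app U s)) :
    E.character ha e = AddMonoidAlgebra.single w (K0.mk N) := by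
  refine (E.character_eq_sum ha e (Finset.univ : Finset PUnit.{1}) (fun _ => N) (fun _ => i.hom)
    (fun _ => i.inv) (fun _ _ => i.hom_inv_id) (fun j _ k _ hjk => absurd rfl hjk) ?_ (fun _ => w)
    (fun _ _ v hv => E.comp_weightπ_eq_zero ha e hv.symm _ h)).trans ?_
  · rw [Finset.sum_const, Finset.card_univ, Fintype.card_punit, one_smul, i.inv_hom_id]
  · rw [Finset.sum_const, Finset.card_univ, Fintype.card_punit, one_smul]

lemma character_inWeight (N : VectorBundle X.left) (w : Fin t → ℤ) :
    (e.inWeight ha N w).character ha e = AddMonoidAlgebra.single w (K0.mk N) := by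
  refine (e.inWeight ha N w).character_of_iso ha e N (Iso.refl _) w fun U s => ?_
  rw [HasWeight, auto_eq]
  exact isEigensection_scalarCongr (congrArg Over.Hom.left ha.symm) N.obj (e.charOn X w) s

/-- Every section is a function times the invariant generator, so the whole bundle has weight 0. -/
lemma character_unit (h : E.IsTrivialLine) : E.character ha e = 1 := by
  obtain ⟨i, hi⟩ := h
  rw [E.character_of_iso ha e (VectorBundle.trivialLine X.left) i 0, K0.mk_unit ⟨Iso.refl _⟩,
    AddMonoidAlgebra.one_def]
  intro U s
  refine (congrArg (fun s => E.HasWeight ha e 0 s) (unit_hom_app i.hom s)).mpr ?_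
  refine IsEigensection.smul (IsEigensection.res ?_ _) _
  rw [e.charOn_zero, Units.val_one, auto_eq]
  exact isEigensection_one_of_eq (congrArg Over.Hom.left ha.symm) E.φ hi

end EquivariantBundle

end Character

/-! ### Tensor products and idempotents -/

section TensorDecomposition

variable {X : Scheme.{u}}

/-- The composite of a bilinear map with morphisms of modules. -/
def Pairing.comp {M N P M' N' P' : X.Modules} (β : Pairing M N P) (f : M' ⟶ M) (g : N' ⟶ N)
    (h : P ⟶ P') : Pairing M' N' P' where
  toFun U := LinearMap.mk₂ Γ(X, U) (fun m n => h.app U (β.toFun U (f.app U m) (g.app U n)))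
    (fun m m' n => by rw [map_add, map_add, LinearMap.add_apply, map_add])
    (fun r m n => by rw [app_smul, map_smul, LinearMap.smul_apply, app_smul])
    (fun m n n' => by rw [map_add, map_add, map_add])
    (fun r m n => by rw [app_smul, map_smul, app_smul])
  map_restrict {U V} i m n := by
    change res P' i.le (h.app V (β.toFun V (f.app V m) (g.app V n))) =
      h.app U (β.toFun U (f.app U (res M' i.le m)) (g.app U (res N' i.le n)))
    rw [← app_res, β.res_toFun, app_res, app_res]

lemma Pairing.comp_toFun {M N P M' N' P' : X.Modules} (β : Pairing M N P) (f : M' ⟶ M)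
    (g : N' ⟶ N) (h : P ⟶ P') {U : X.Opens} (m : Γ(M', U)) (n : Γ(N', U)) :
    (β.comp f g h).toFun U m n = h.app U (β.toFun U (f.app U m) (g.app U n)) := rfl

lemma Pairing.IsTensorProduct.hom_ext {M N P : X.Modules} {β : Pairing M N P}
    (hβ : β.IsTensorProduct) {Q : X.Modules} {h h' : P ⟶ Q}
    (H : ∀ (U : X.Opens) (m : Γ(M, U)) (n : Γ(N, U)),
      h.app U (β.toFun U m n) = h'.app U (β.toFun U m n)) : h = h' :=
  (hβ Q (β.comp (𝟙 _) (𝟙 _) h)).unique (fun _ _ _ => rfl) fun U m n => (H U m n).symm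

/-- The morphism of tensor products induced by morphisms of the factors. -/
def Pairing.IsTensorProduct.map {M N P M' N' P' : X.Modules} {β : Pairing M N P}
    (hβ : β.IsTensorProduct) (β' : Pairing M' N' P') (f : M ⟶ M') (g : N ⟶ N') : P ⟶ P' :=
  (hβ P' (β'.comp f g (𝟙 _))).choose

lemma Pairing.IsTensorProduct.map_app {M N P M' N' P' : X.Modules} {β : Pairing M N P}
    (hβ : β.IsTensorProduct) (β' : Pairing M' N' P') (f : M ⟶ M') (g : N ⟶ N') {U : X.Opens}
    (m : Γ(M, U)) (n : Γ(N, U)) : (hβ.map β' f g).app U (β.toFun U m n) =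
      β'.toFun U (f.app U m) (g.app U n) :=
  (hβ P' (β'.comp f g (𝟙 _))).choose_spec.1 U m n

/-- The image of the tensor product of two idempotents is the tensor product of the images. -/
lemma Pairing.IsTensorProduct.of_retract {M N P M' N' P' : X.Modules} {β : Pairing M N P}
    (hβ : β.IsTensorProduct) {i : M' ⟶ M} {p : M ⟶ M'} {j : N' ⟶ N} {q : N ⟶ N'}
    {k : P' ⟶ P} {r : P ⟶ P'} (hip : i ≫ p = 𝟙 _) (hjq : j ≫ q = 𝟙 _) (hkr : k ≫ r = 𝟙 _)
    (hrk : r ≫ k = hβ.map β (p ≫ i) (q ≫ j)) : (β.comp i j r).IsTensorProduct := by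
  have hip' : ∀ {U : X.Opens} (m : Γ(M', U)), p.app U (i.app U m) = m := fun m => by
    rw [← comp_app_apply, hip, id_app_apply]
  have hjq' : ∀ {U : X.Opens} (n : Γ(N', U)), q.app U (j.app U n) = n := fun n => by
    rw [← comp_app_apply, hjq, id_app_apply]
  have key : ∀ {U : X.Opens} (m : Γ(M', U)) (n : Γ(N', U)),
      k.app U (r.app U (β.toFun U (i.app U m) (j.app U n))) =
        β.toFun U (i.app U m) (j.app U n) := by
    intro U m n
    rw [← comp_app_apply, hrk, hβ.map_app, comp_app_apply, comp_app_apply, hip', hjq']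
  intro Q α
  obtain ⟨h, hh, -⟩ := hβ Q (α.comp p q (𝟙 _))
  have hh' : ∀ (U : X.Opens) (m : Γ(M, U)) (n : Γ(N, U)),
      h.app U (β.toFun U m n) = α.toFun U (p.app U m) (q.app U n) := hh
  refine ⟨k ≫ h, fun U m n => ?_, fun h₂ hh₂ => ?_⟩
  · rw [Pairing.comp_toFun, comp_app_apply, key, hh', hip', hjq']
  · rw [← Category.id_comp h₂, ← hkr, Category.assoc]
    congr 1
    refine hβ.hom_ext fun U m n => ?_
    have h3 : r = (r ≫ k) ≫ r := by rw [Category.assoc, hkr, Category.comp_id]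
    rw [h3, hrk, comp_app_apply, comp_app_apply, hβ.map_app, comp_app_apply, comp_app_apply]
    refine (hh₂ U (p.app U m) (q.app U n)).trans (hh' U m n).symm

end TensorDecomposition

/-! ### Multiplicativity of the character -/

section CharacterTensor

variable {S : Scheme.{u}} {T : Over S} [GrpObj T] {t : ℕ} {X : Over S} {a : ModObj T X}
  [CompactSpace X.left] (ha : IsTrivialAction a) (e : Splitting T t)

namespace EquivariantBundle

/-- The tensor products of the weight idempotents of `E` and `F` are orthogonal idempotents of `P`
with sum 1. Their images are tensor products of weight bundles, placed in the sum of the two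
weights. -/
lemma character_tensor {E F P : EquivariantBundle a} (h : IsTensor E F P) :
    P.character ha e = E.character ha e * F.character ha e := by
  classical
  obtain ⟨β, β₁, β₂, hβ, hβ₁, hβ₂, hφ⟩ := h
  let J := (Fin t → ℤ) × (Fin t → ℤ)
  let ε : ∀ w, E.obj ⟶ E.obj := fun w => E.weightπ ha e w ≫ E.weightι ha e w
  let δ : ∀ w, F.obj ⟶ F.obj := fun w => F.weightπ ha e w ≫ F.weightι ha e w
  have hε : ∀ w v, ε w ≫ ε v = if w = v then ε w else 0 := by
    intro w v
    split_ifs with h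
    · subst h
      simp only [ε, Category.assoc]
      rw [← Category.assoc (E.weightι ha e w), E.weightι_weightπ ha e, Category.id_comp]
    · simp only [ε, Category.assoc]
      rw [← Category.assoc (E.weightι ha e w), E.weightι_weightπ_ne ha e h, Limits.zero_comp,
        Limits.comp_zero]
  have hδ : ∀ w v, δ w ≫ δ v = if w = v then δ w else 0 := by
    intro w v
    split_ifs with h
    · subst h
      simp only [δ, Category.assoc]
      rw [← Category.assoc (F.weightι ha e w), F.weightι_weightπ ha e, Category.id_comp]
    · simp only [δ, Category.assoc]
      rw [← Category.assoc (F.weightι ha e w), F.weightι_weightπ_ne ha e h, Limits.zero_comp,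
        Limits.comp_zero]
  let τ : J → (P.obj ⟶ P.obj) := fun k => hβ.map β (ε k.1) (δ k.2)
  have hτ : ∀ k l, τ k ≫ τ l = if k = l then τ k else 0 := by
    intro k l
    refine hβ.hom_ext fun U m n => ?_
    rw [comp_app_apply, hβ.map_app, hβ.map_app, ← comp_app_apply, ← comp_app_apply, hε, hδ]
    by_cases h : k = l
    · rw [if_pos h, if_pos (congrArg Prod.fst h), if_pos (congrArg Prod.snd h), hβ.map_app]
    · rw [if_neg h]
      by_cases h1 : k.1 = l.1
      · have h2 : k.2 ≠ l.2 := fun h2 => h (Prod.ext h1 h2)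
        rw [if_neg h2, zero_app_apply, map_zero, zero_app_apply]
      · rw [if_neg h1, zero_app_apply, map_zero, zero_app_apply, LinearMap.zero_apply]
  choose N κ ρ hκρ hρκ using fun k => exists_retract_of_idempotent (τ k)
    ((hτ k k).trans (if_pos rfl))
  let B : J → VectorBundle X.left := fun k =>
    ⟨N k, P.isFiniteLocallyFree.of_retract (κ k) (ρ k) (hκρ k)⟩
  have hκτ : ∀ k, κ k ≫ τ k = κ k := fun k => by
    rw [← hρκ, ← Category.assoc, hκρ, Category.id_comp]
  have hτρ : ∀ k, τ k ≫ ρ k = ρ k := fun k => by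
    rw [← hρκ, Category.assoc, hκρ, Category.comp_id]
  have hB : ∀ k, K0.mk (B k) =
      K0.mk (E.weightBundle ha e k.1) * K0.mk (F.weightBundle ha e k.2) := fun k =>
    K0.mk_tensor ⟨_, hβ.of_retract (E.weightι_weightπ ha e k.1) (F.weightι_weightπ ha e k.2)
      (hκρ k) (hρκ k)⟩
  have hEs : ∀ {U : X.left.Opens} (m : Γ(E.obj, U)),
      ∑ w ∈ E.weights ha e, (ε w).app U m = m := fun m => by
    rw [← sum_app_apply, E.sum_weightπ ha e, id_app_apply]
  have hFs : ∀ {U : X.left.Opens} (m : Γ(F.obj, U)),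
      ∑ w ∈ F.weights ha e, (δ w).app U m = m := fun m => by
    rw [← sum_app_apply, F.sum_weightπ ha e, id_app_apply]
  have horth : ∀ k l, k ≠ l → κ k ≫ ρ l = 0 := fun k l hkl => by
    rw [← hκτ k, ← hτρ l, Category.assoc, ← Category.assoc (τ k), hτ, if_neg hkl,
      Limits.zero_comp, Limits.comp_zero]
  have hsum : ∑ k ∈ E.weights ha e ×ˢ F.weights ha e, ρ k ≫ κ k = 𝟙 P.obj := by
    refine hβ.hom_ext fun U m n => ?_
    rw [sum_app_apply, id_app_apply, Finset.sum_product]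
    conv_rhs => rw [← hEs m, map_sum, LinearMap.sum_apply]
    refine Finset.sum_congr rfl fun w _ => ?_
    conv_rhs => rw [← hFs n, map_sum]
    refine Finset.sum_congr rfl fun v _ => ?_
    rw [hρκ, hβ.map_app]
  -- It suffices to test on products of sections, where the eigenvalues χ_w and χ_v multiply to
  -- χ_{w+v}.
  have hdeg : ∀ (k : J) (v : Fin t → ℤ), v ≠ k.1 + k.2 → κ k ≫ P.weightπ ha e v = 0 := by
    intro k v hv
    have h1 : τ k ≫ P.weightπ ha e v = 0 := by
      refine hβ.hom_ext fun U m n => ?_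
      rw [comp_app_apply, hβ.map_app, zero_app_apply]
      have hm : E.HasWeight ha e k.1 ((ε k.1).app U m) := E.weightι_hasWeight ha e k.1 _
      have hn : F.HasWeight ha e k.2 ((δ k.2).app U n) := F.weightι_hasWeight ha e k.2 _
      have hp : P.HasWeight ha e (k.1 + k.2)
          (β.toFun U ((ε k.1).app U m) ((δ k.2).app U n)) := by
        rw [HasWeight, auto_eq] at hm hn ⊢
        rw [e.charOn_add, Units.val_mul]
        exact IsEigensection.pairing (congrArg Over.Hom.left ha.symm) E.φ F.φ P.φ β β₁ β₂ hβ₁ hβ₂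
          hφ hm hn
      obtain ⟨s, hs⟩ := hp.exists_weightι
      rw [← hs, ← comp_app_apply, P.weightι_weightπ_ne ha e hv.symm, zero_app_apply]
    rw [← hκτ k, Category.assoc, h1, Limits.comp_zero]
  rw [P.character_eq_sum ha e (E.weights ha e ×ˢ F.weights ha e) B κ ρ (fun k _ => hκρ k)
    (fun k _ l _ hkl => horth k l hkl) hsum (fun k => k.1 + k.2) (fun k _ => hdeg k),
    character, character, Finset.sum_mul_sum, Finset.sum_product]
  refine Finset.sum_congr rfl fun w _ => Finset.sum_congr rfl fun v _ => ?_
  rw [AddMonoidAlgebra.single_mul_single, hB]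

end EquivariantBundle

end CharacterTensor

/-! ### Unit objects and bilinear maps with scalar equivariant structures -/

section TwistedTensor

variable {X Y : Scheme.{u}}

/-- The bilinear map `(m, r) ↦ r m`. -/
def unitPairing (M : X.Modules) : Pairing M (structureSheaf X) M where
  toFun U := LinearMap.mk₂ Γ(X, U) (fun m r => unitSections U r • m)
    (fun m m' r => smul_add _ _ _) (fun c m r => smul_comm _ _ _)
    (fun m r r' => by rw [map_add, add_smul])
    (fun c m r => by rw [map_smul, smul_eq_mul, mul_smul])
  map_restrict {U V} i m r := res_smul M i.le (unitSections V r) m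

lemma unitPairing_toFun (M : X.Modules) {U : X.Opens} (m : Γ(M, U))
    (r : Γ(structureSheaf X, U)) : (unitPairing M).toFun U m r = unitSections U r • m := rfl

/-- A bilinear map β on M × 𝒪_X is determined by m ↦ β(m, 1). -/
lemma unitPairing_isTensorProduct (M : X.Modules) : (unitPairing M).IsTensorProduct := by
  intro Q β
  let o : ∀ U : X.Opens, Γ(structureSheaf X, U) := fun U => res _ le_top (oneSection X)
  have ho : ∀ U, unitSections U (o U) = 1 := fun U => by
    rw [unitSections_res, unitSections_oneSection, map_one]
  have hor : ∀ {V U : X.Opens} (h : V ≤ U), res _ h (o U) = o V := fun h => res_res _ _ _ _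
  refine ⟨homMk (fun U => (β.toFun U).flip (o U)) (fun {V U} h m => ?_), fun U m r => ?_,
    fun h hh => hom_ext_sections fun U m => ?_⟩
  · rw [LinearMap.flip_apply, LinearMap.flip_apply, β.res_toFun h, hor]
  · rw [homMk_app, LinearMap.flip_apply, unitPairing_toFun, map_smul, LinearMap.smul_apply,
      ← map_smul]
    congr 1
    exact (section_eq_smul_one r).symm
  · rw [homMk_app, LinearMap.flip_apply, ← hh, unitPairing_toFun, ho, one_smul]

lemma VectorBundle.isTensor_trivialLine (E : VectorBundle X) :
    VectorBundle.IsTensor E (VectorBundle.trivialLine X) E :=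
  ⟨unitPairing E.obj, unitPairing_isTensorProduct E.obj⟩

lemma scalarCongr_rfl_app {f : Y ⟶ X} (M : X.Modules) (r : Γ(Y, ⊤)ˣ) {U : Y.Opens}
    (s : Γ((Scheme.Modules.pullback f).obj M, U)) :
    (scalarCongr (rfl : f = f) M r).hom.app U s = resO (V := U) le_top (r : Γ(Y, ⊤)) • s := by
  simp only [scalarCongr, scalarIso, Scheme.Modules.pullbackCongr, eqToIso_refl, Iso.trans_hom,
    Iso.app_hom, Iso.refl_hom, NatTrans.id_app, Category.comp_id]
  rfl

/-- Once f and g are identified, a single pulled back bilinear map serves on both sides, and the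
scalars r and s come out as their product. -/
lemma exists_pairing_scalarCongr {f g : Y ⟶ X} (h : f = g) {M N P : X.Modules}
    (β : Pairing M N P) (r s : Γ(Y, ⊤)ˣ)
    {φM : (Scheme.Modules.pullback f).obj M ≅ (Scheme.Modules.pullback g).obj M}
    {φN : (Scheme.Modules.pullback f).obj N ≅ (Scheme.Modules.pullback g).obj N}
    {φP : (Scheme.Modules.pullback f).obj P ≅ (Scheme.Modules.pullback g).obj P}
    (hM : φM = scalarCongr h M r) (hN : φN = scalarCongr h N s)
    (hP : φP = scalarCongr h P (r * s)) :
    ∃ (β₁ : Pairing ((Scheme.Modules.pullback f).obj M) ((Scheme.Modules.pullback f).obj N)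
        ((Scheme.Modules.pullback f).obj P))
      (β₂ : Pairing ((Scheme.Modules.pullback g).obj M) ((Scheme.Modules.pullback g).obj N)
        ((Scheme.Modules.pullback g).obj P)),
      β.IsPullback f β₁ ∧ β.IsPullback g β₂ ∧
      ∀ (U : Y.Opens) (m : Γ((Scheme.Modules.pullback f).obj M, U))
        (n : Γ((Scheme.Modules.pullback f).obj N, U)),
        φP.hom.app U (β₁.toFun U m n) = β₂.toFun U (φM.hom.app U m) (φN.hom.app U n) := by
  subst h
  subst hM
  subst hN
  subst hP
  obtain ⟨β₁, hβ₁⟩ := Pairing.exists_pullback f β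
  refine ⟨β₁, β₁, hβ₁, hβ₁, fun U m n => ?_⟩
  rw [scalarCongr_rfl_app, scalarCongr_rfl_app, scalarCongr_rfl_app, map_smul, map_smul,
    LinearMap.smul_apply, smul_smul, ← map_mul, Units.val_mul, mul_comm (r : Γ(Y, ⊤))]

lemma scalarCongr_one_pullbackSection {f g : Y ⟶ X} (h : f = g) {M : X.Modules}
    (s : Γ(M, ⊤)) : (scalarCongr h M 1).hom.app ⊤ (pullbackSection f (U := ⊤) s) =
      pullbackSection g (U := ⊤) s := by
  subst h
  refine (scalarCongr_rfl_app M 1 (U := f ⁻¹ᵁ ⊤) (pullbackSection f s)).trans ?_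
  rw [Units.val_one, map_one, one_smul]

end TwistedTensor

/-! ### The isomorphism with the group algebra of the character lattice -/

section Twist

variable {S : Scheme.{u}} {T : Over S} [GrpObj T] {t : ℕ} {X : Over S} {a : ModObj T X}
  (ha : IsTrivialAction a) (e : Splitting T t)

lemma Splitting.inWeight_φ (E : VectorBundle X.left) (w : Fin t → ℤ) :
    (e.inWeight ha E w).φ =
      scalarCongr (congrArg Over.Hom.left ha.symm) E.obj (e.charOn X w) := rfl

lemma EquivariantBundle.isTensor_of_scalarCongr {E F P : EquivariantBundle a}
    (β : Pairing E.obj F.obj P.obj) (hβ : β.IsTensorProduct) (r s : Γ((T ⊗ X).left, ⊤)ˣ)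
    (hE : E.φ = scalarCongr (congrArg Over.Hom.left ha.symm) E.obj r)
    (hF : F.φ = scalarCongr (congrArg Over.Hom.left ha.symm) F.obj s)
    (hP : P.φ = scalarCongr (congrArg Over.Hom.left ha.symm) P.obj (r * s)) :
    EquivariantBundle.IsTensor E F P := by
  obtain ⟨β₁, β₂, hβ₁, hβ₂, H⟩ := exists_pairing_scalarCongr (congrArg Over.Hom.left ha.symm) β r s
    hE hF hP
  exact ⟨β, β₁, β₂, hβ, hβ₁, hβ₂, H⟩

lemma EquivariantBundle.isEquivariantHom_of_isEigensection {N E : EquivariantBundle a}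
    (r : Γ((T ⊗ X).left, ⊤)ˣ)
    (hN : N.φ = scalarCongr (congrArg Over.Hom.left ha.symm) N.obj r) (v : N.obj ⟶ E.obj)
    (hv : ∀ (U : X.left.Opens) (s : Γ(N.obj, U)), IsEigensection (snd T X).left
      (selfIso (congrArg Over.Hom.left ha.symm) E.φ).hom (r : Γ((T ⊗ X).left, ⊤)) (v.app U s)) :
    EquivariantBundle.IsEquivariantHom N E v := by
  rw [EquivariantBundle.IsEquivariantHom, hN]
  exact comp_map_eq_of_isEigensection (congrArg Over.Hom.left ha.symm) E.φ v r hv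

lemma EquivariantBundle.isEquivariantHom_of_scalarCongr {N E : EquivariantBundle a}
    (r : Γ((T ⊗ X).left, ⊤)ˣ)
    (hN : N.φ = scalarCongr (congrArg Over.Hom.left ha.symm) N.obj r)
    (hE : E.φ = scalarCongr (congrArg Over.Hom.left ha.symm) E.obj r) (v : N.obj ⟶ E.obj) :
    EquivariantBundle.IsEquivariantHom N E v := by
  refine EquivariantBundle.isEquivariantHom_of_isEigensection ha r hN v fun U s => ?_
  rw [hE]
  exact isEigensection_scalarCongr _ _ _ _

lemma Splitting.isTensor_inWeight {E F P : VectorBundle X.left} (h : VectorBundle.IsTensor E F P)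
    (w v : Fin t → ℤ) :
    EquivariantBundle.IsTensor (e.inWeight ha E w) (e.inWeight ha F v)
      (e.inWeight ha P (w + v)) := by
  obtain ⟨β, hβ⟩ := h
  refine EquivariantBundle.isTensor_of_scalarCongr ha β hβ (e.charOn X w) (e.charOn X v)
    (e.inWeight_φ ha E w) (e.inWeight_φ ha F v) ?_
  exact (e.inWeight_φ ha P (w + v)).trans
    (congrArg (scalarCongr (congrArg Over.Hom.left ha.symm) P.obj) (e.charOn_add X w v))

lemma Splitting.isTrivialLine_inWeight {E : VectorBundle X.left} (h : E.IsTrivialLine) :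
    (e.inWeight ha E 0).IsTrivialLine := by
  obtain ⟨i⟩ := h
  refine ⟨i, ?_⟩
  rw [e.inWeight_φ ha, e.charOn_zero]
  exact scalarCongr_one_pullbackSection _ _

lemma Splitting.isEquivariantHom_inWeight {E F : VectorBundle X.left} (v : E.obj ⟶ F.obj)
    (w : Fin t → ℤ) :
    EquivariantBundle.IsEquivariantHom (e.inWeight ha E w) (e.inWeight ha F w) v :=
  EquivariantBundle.isEquivariantHom_of_scalarCongr ha (e.charOn X w) (e.inWeight_φ ha E w)
    (e.inWeight_φ ha F w) v

lemma Splitting.exact_inWeight {E' E E'' : VectorBundle X.left}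
    (h : VectorBundle.Exact E' E E'') (w : Fin t → ℤ) :
    EquivariantBundle.Exact (e.inWeight ha E' w) (e.inWeight ha E w) (e.inWeight ha E'' w) := by
  obtain ⟨f, g, hfg, hex⟩ := h
  exact ⟨f, g, hfg, e.isEquivariantHom_inWeight ha f w, e.isEquivariantHom_inWeight ha g w, hex⟩

/-- The homomorphism sending the class of a vector bundle to its class with trivial equivariant
structure. -/
def Splitting.trivialHom : K0 X.left →+* EquivariantK0 a :=
  grothendieckLift (fun E => EquivariantK0.mk (e.inWeight ha E 0))
    (fun _ _ _ h => EquivariantK0.mk_exact (e.exact_inWeight ha h 0))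
    (fun E F P h => EquivariantK0.mk_tensor (by
      have := e.isTensor_inWeight ha h 0 0
      rwa [add_zero] at this))
    (fun _ h => EquivariantK0.mk_unit (e.isTrivialLine_inWeight ha h))

lemma Splitting.trivialHom_mk (E : VectorBundle X.left) :
    e.trivialHom ha (K0.mk E) = EquivariantK0.mk (e.inWeight ha E 0) :=
  grothendieckLift_mk _ _ _ _ _

/-- The homomorphism sending `w` to the class of the trivial line bundle in weight `w`. -/
def Splitting.lineHom : Multiplicative (Fin t → ℤ) →* EquivariantK0 a where
  toFun w := EquivariantK0.mk (e.inWeight ha (VectorBundle.trivialLine X.left) w.toAdd)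
  map_one' := EquivariantK0.mk_unit (e.isTrivialLine_inWeight ha ⟨Iso.refl _⟩)
  map_mul' _ _ := EquivariantK0.mk_tensor
    (e.isTensor_inWeight ha (VectorBundle.isTensor_trivialLine _) _ _)

/-- The homomorphism from the group algebra of the character lattice to the equivariant `K_0`. -/
def Splitting.groupAlgebraHom :
    AddMonoidAlgebra (K0 X.left) (Fin t → ℤ) →+* EquivariantK0 a :=
  AddMonoidAlgebra.liftNCRingHom (e.trivialHom ha) (e.lineHom ha) fun _ _ => Commute.all _ _

lemma Splitting.groupAlgebraHom_single (w : Fin t → ℤ) (r : K0 X.left) :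
    e.groupAlgebraHom ha (AddMonoidAlgebra.single w r) =
      e.trivialHom ha r *
        EquivariantK0.mk (e.inWeight ha (VectorBundle.trivialLine X.left) w) :=
  AddMonoidAlgebra.liftNCRingHom_single _ _ _ _ _

lemma Splitting.groupAlgebraHom_single_mk (w : Fin t → ℤ) (E : VectorBundle X.left) :
    e.groupAlgebraHom ha (AddMonoidAlgebra.single w (K0.mk E)) =
      EquivariantK0.mk (e.inWeight ha E w) := by
  rw [e.groupAlgebraHom_single ha, e.trivialHom_mk ha, ← EquivariantK0.mk_tensor
    (e.isTensor_inWeight ha (VectorBundle.isTensor_trivialLine E) 0 w), zero_add]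

variable [CompactSpace X.left]

/-- The homomorphism sending the class of an equivariant bundle to its character. -/
def Splitting.characterHom :
    EquivariantK0 a →+* AddMonoidAlgebra (K0 X.left) (Fin t → ℤ) :=
  grothendieckLift (fun E => E.character ha e)
    (fun _ _ _ h => EquivariantBundle.character_exact ha e h)
    (fun _ _ _ h => EquivariantBundle.character_tensor ha e h)
    (fun E h => E.character_unit ha e h)

lemma Splitting.characterHom_mk (E : EquivariantBundle a) :
    e.characterHom ha (EquivariantK0.mk E) = E.character ha e := grothendieckLift_mk _ _ _ _ _

namespace EquivariantBundle

variable (E : EquivariantBundle a)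

lemma isEquivariantHom_weightι (w : Fin t → ℤ) :
    IsEquivariantHom (e.inWeight ha (E.weightBundle ha e w) w) E (E.weightι ha e w) := by
  refine isEquivariantHom_of_isEigensection ha (e.charOn X w)
    (e.inWeight_φ ha (E.weightBundle ha e w) w) (E.weightι ha e w) fun U s => ?_
  have h := E.weightι_hasWeight ha e w s
  rwa [HasWeight, auto_eq] at h

/-- The identity of pr^* E is expanded into weight idempotents. As the inclusions are equivariant,
only the term of weight `w` survives the projection. -/
lemma isEquivariantHom_weightπ (w : Fin t → ℤ) :
    IsEquivariantHom E (e.inWeight ha (E.weightBundle ha e w) w) (E.weightπ ha e w) := by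
  let p := Scheme.Modules.pullback (snd T X).left
  let q := Scheme.Modules.pullback (actMap a).left
  let κ : ∀ v, p.obj (E.weightModule ha e v) ⟶ q.obj (E.weightModule ha e v) := fun v =>
    (e.inWeight ha (E.weightBundle ha e v) v).φ.hom
  have hι : ∀ v, κ v ≫ q.map (E.weightι ha e v) = p.map (E.weightι ha e v) ≫ E.φ.hom :=
    fun v => E.isEquivariantHom_weightι ha e v
  change E.φ.hom ≫ q.map (E.weightπ ha e w) = p.map (E.weightπ ha e w) ≫ κ w
  have h1 : 𝟙 (p.obj E.obj) =
      ∑ v ∈ E.weights ha e, p.map (E.weightπ ha e v) ≫ p.map (E.weightι ha e v) := by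
    rw [← CategoryTheory.Functor.map_id, ← E.sum_weightπ ha e, Functor.map_sum]
    exact Finset.sum_congr rfl fun v _ => p.map_comp _ _
  rw [← Category.id_comp E.φ.hom, h1, Preadditive.sum_comp, Preadditive.sum_comp,
    Finset.sum_eq_single w]
  · simp only [Category.assoc]
    rw [← reassoc_of% hι w, ← Functor.map_comp, E.weightι_weightπ ha e,
      CategoryTheory.Functor.map_id, Category.comp_id]
  · intro v _ hv
    simp only [Category.assoc]
    rw [← reassoc_of% hι v, ← Functor.map_comp, E.weightι_weightπ_ne ha e hv,
      Functor.map_zero, Limits.comp_zero, Limits.comp_zero]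
  · intro hw
    rw [E.weightπ_eq_zero ha e hw, Functor.map_zero, Limits.zero_comp, Limits.zero_comp,
      Limits.zero_comp]

end EquivariantBundle

/-- The weight decomposition is equivariant when each summand carries its own weight, so additivity
over direct sums recovers [E]. -/
lemma Splitting.groupAlgebraHom_character (E : EquivariantBundle a) :
    e.groupAlgebraHom ha (E.character ha e) = EquivariantK0.mk E := by
  rw [EquivariantBundle.character, map_sum]
  simp only [e.groupAlgebraHom_single_mk ha]
  exact (EquivariantK0.mk_eq_sum (E.weights ha e) E
    (fun w => e.inWeight ha (E.weightBundle ha e w) w) (E.weightι ha e) (E.weightπ ha e)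
    (fun w _ => E.isEquivariantHom_weightι ha e w) (fun w _ => E.isEquivariantHom_weightπ ha e w)
    (fun w _ => E.weightι_weightπ ha e w) (fun w _ v _ h => E.weightι_weightπ_ne ha e h)
    (E.sum_weightπ ha e)).symm

/-- The equivariant `K_0` for a trivial action of a split torus is a Laurent polynomial ring. -/
def Splitting.groupAlgebraEquiv :
    AddMonoidAlgebra (K0 X.left) (Fin t → ℤ) ≃+* EquivariantK0 a :=
  RingEquiv.ofRingHom (e.groupAlgebraHom ha) (e.characterHom ha)
    (grothendieck_ringHom_ext fun E => by
      refine (congrArg (e.groupAlgebraHom ha) (e.characterHom_mk ha E)).trans ?_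
      exact e.groupAlgebraHom_character ha E)
    (by
      have h : ∀ w E, e.characterHom ha (e.groupAlgebraHom ha
          (AddMonoidAlgebra.single w (K0.mk E))) = AddMonoidAlgebra.single w (K0.mk E) :=
        fun w E => by
          rw [e.groupAlgebraHom_single_mk ha, e.characterHom_mk ha,
            EquivariantBundle.character_inWeight]
      refine AddMonoidAlgebra.ringHom_ext (fun r => ?_) fun w => ?_
      · have h1 : ((e.characterHom ha).comp (e.groupAlgebraHom ha)).comp
            AddMonoidAlgebra.singleZeroRingHom =
              (AddMonoidAlgebra.singleZeroRingHom : K0 X.left →+*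
                AddMonoidAlgebra (K0 X.left) (Fin t → ℤ)) :=
          grothendieck_ringHom_ext fun E => h 0 E
        exact congrArg (fun k => k r) h1
      -- A monomial has coefficient 1, which is the class of 𝒪_X.
      · have h1 := h w (VectorBundle.trivialLine X.left)
        rw [K0.mk_unit ⟨Iso.refl _⟩] at h1
        exact h1)

lemma Splitting.groupAlgebraEquiv_single (w : Fin t → ℤ) (E : VectorBundle X.left) :
    e.groupAlgebraEquiv ha (AddMonoidAlgebra.single w (K0.mk E)) =
      EquivariantK0.mk (e.inWeight ha E w) := e.groupAlgebraHom_single_mk ha w E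

end Twist

/-! ### Generators and relations for the group algebra of ℤ^t -/

section LaurentPresentation

variable (A : Type*) [CommRing A] (t : ℕ)

/-- The ideal generated by `x_i y_i + x_i + y_i`. -/
def laurentIdeal : Ideal (MvPolynomial (Fin t ⊕ Fin t) A) :=
  Ideal.span (Set.range fun i : Fin t =>
    (MvPolynomial.X (Sum.inl i) * MvPolynomial.X (Sum.inr i) +
      MvPolynomial.X (Sum.inl i) + MvPolynomial.X (Sum.inr i) :
      MvPolynomial (Fin t ⊕ Fin t) A))

variable {A t}

/-- The class of `x_i` or `y_i`. -/
def laurentX (j : Fin t ⊕ Fin t) : MvPolynomial (Fin t ⊕ Fin t) A ⧸ laurentIdeal A t :=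
  Ideal.Quotient.mk _ (MvPolynomial.X j)

/-- Expanding gives 1 + (x_i y_i + x_i + y_i), and the bracket is a generator of the ideal. -/
lemma one_add_laurentX_mul (i : Fin t) :
    (1 + laurentX (A := A) (Sum.inl i)) * (1 + laurentX (Sum.inr i)) = 1 := by
  have h : laurentX (A := A) (Sum.inl i) * laurentX (Sum.inr i) + laurentX (Sum.inl i) +
      laurentX (Sum.inr i) = 0 := by
    simp only [laurentX, ← map_mul, ← map_add]
    exact Ideal.Quotient.eq_zero_iff_mem.2 (Ideal.subset_span ⟨i, rfl⟩)
  linear_combination h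

/-- The unit `1 + x_i` with inverse `1 + y_i`. -/
def laurentUnit (i : Fin t) : (MvPolynomial (Fin t ⊕ Fin t) A ⧸ laurentIdeal A t)ˣ where
  val := 1 + laurentX (Sum.inl i)
  inv := 1 + laurentX (Sum.inr i)
  val_inv := one_add_laurentX_mul i
  inv_val := by rw [mul_comm, one_add_laurentX_mul]

/-- The exponents of the generators in terms of the monomials. -/
def laurentExponent (j : Fin t ⊕ Fin t) : Fin t → ℤ :=
  Sum.elim (fun i => Pi.single i 1) (fun i => -Pi.single i 1) j

/-- The homomorphism `x_i ↦ u_i - 1`, `y_i ↦ u_i⁻¹ - 1`. -/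
def toGroupAlgebra : (MvPolynomial (Fin t ⊕ Fin t) A ⧸ laurentIdeal A t) →+*
    AddMonoidAlgebra A (Fin t → ℤ) :=
  Ideal.Quotient.lift _ (MvPolynomial.eval₂Hom AddMonoidAlgebra.singleZeroRingHom
    fun j => AddMonoidAlgebra.single (laurentExponent j) 1 - 1) (by
    change laurentIdeal A t ≤ RingHom.ker _
    refine Ideal.span_le.2 ?_
    rintro _ ⟨i, rfl⟩
    change MvPolynomial.eval₂Hom _ _ _ = 0
    simp only [map_add, map_mul, MvPolynomial.eval₂Hom_X']
    have h : (AddMonoidAlgebra.single (laurentExponent (Sum.inl i)) 1 :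
        AddMonoidAlgebra A (Fin t → ℤ)) *
          AddMonoidAlgebra.single (laurentExponent (Sum.inr i)) 1 = 1 := by
      rw [AddMonoidAlgebra.single_mul_single, mul_one, AddMonoidAlgebra.one_def]
      simp only [laurentExponent, Sum.elim_inl, Sum.elim_inr, add_neg_cancel]
    linear_combination h)

lemma toGroupAlgebra_C (r : A) : toGroupAlgebra (t := t)
    (Ideal.Quotient.mk _ (MvPolynomial.C r)) = AddMonoidAlgebra.single 0 r := by
  rw [toGroupAlgebra, Ideal.Quotient.lift_mk, MvPolynomial.coe_eval₂Hom, MvPolynomial.eval₂_C]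
  rfl

lemma toGroupAlgebra_X (j : Fin t ⊕ Fin t) : toGroupAlgebra (A := A)
    (Ideal.Quotient.mk _ (MvPolynomial.X j)) =
      AddMonoidAlgebra.single (laurentExponent j) 1 - 1 := by
  rw [toGroupAlgebra, Ideal.Quotient.lift_mk, MvPolynomial.eval₂Hom_X']

/-- The monomials in the units `1 + x_i`. -/
def laurentMonomial : Multiplicative (Fin t → ℤ) →*
    (MvPolynomial (Fin t ⊕ Fin t) A ⧸ laurentIdeal A t)ˣ where
  toFun w := ∏ i, laurentUnit i ^ w.toAdd i
  map_one' := by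
    simp only [toAdd_one, Pi.zero_apply, zpow_zero, Finset.prod_const_one]
  map_mul' w v := by
    simp only [toAdd_mul, Pi.add_apply, zpow_add, Finset.prod_mul_distrib]

lemma laurentMonomial_single (i : Fin t) :
    laurentMonomial (A := A) (.ofAdd (Pi.single i 1)) = laurentUnit i := by
  change ∏ k, laurentUnit k ^ (Pi.single i (1 : ℤ) : Fin t → ℤ) k = _
  rw [Finset.prod_eq_single i]
  · rw [Pi.single_eq_same, zpow_one]
  · intro k _ hk
    rw [Pi.single_eq_of_ne hk, zpow_zero]
  · exact fun h => absurd (Finset.mem_univ i) h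

/-- The homomorphism `u^w ↦ ∏ (1 + x_i)^{w_i}`. -/
def ofGroupAlgebra : AddMonoidAlgebra A (Fin t → ℤ) →+*
    (MvPolynomial (Fin t ⊕ Fin t) A ⧸ laurentIdeal A t) :=
  AddMonoidAlgebra.liftNCRingHom ((Ideal.Quotient.mk _).comp MvPolynomial.C)
    ((Units.coeHom _).comp laurentMonomial) fun _ _ => Commute.all _ _

lemma ofGroupAlgebra_single (w : Fin t → ℤ) (r : A) :
    ofGroupAlgebra (AddMonoidAlgebra.single w r) = Ideal.Quotient.mk _ (MvPolynomial.C r) *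
      (laurentMonomial (A := A) (.ofAdd w)).val :=
  AddMonoidAlgebra.liftNCRingHom_single _ _ _ _ _

lemma toGroupAlgebra_laurentUnit (i : Fin t) :
    Units.map (toGroupAlgebra (A := A) (t := t)).toMonoidHom (laurentUnit i) =
      monomialUnit A (Fin t → ℤ) (Pi.single i 1) := by
  ext1
  change toGroupAlgebra (1 + laurentX (Sum.inl i)) = AddMonoidAlgebra.single (Pi.single i 1) 1
  rw [map_add, map_one, laurentX, toGroupAlgebra_X, add_sub_cancel]
  rfl

/-- Both sides are multiplicative in `w`, so the unit vectors suffice, and there 1 + x_i ↦ u_i. -/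
lemma toGroupAlgebra_laurentMonomial (w : Fin t → ℤ) : toGroupAlgebra (A := A)
    (laurentMonomial (A := A) (.ofAdd w)).val =
      AddMonoidAlgebra.single w 1 := by
  have h1 := monoidHom_intPow_apply ((Units.map (toGroupAlgebra (A := A) (t := t)).toMonoidHom).comp
    laurentMonomial) w
  have h2 := monoidHom_intPow_apply (monomialHom A (Fin t → ℤ)) w
  have h3 : (Units.map (toGroupAlgebra (A := A) (t := t)).toMonoidHom).comp
      laurentMonomial (.ofAdd w) = monomialHom A (Fin t → ℤ) (.ofAdd w) := by
    rw [h1, h2]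
    refine Finset.prod_congr rfl fun i _ => ?_
    rw [MonoidHom.comp_apply, laurentMonomial_single, toGroupAlgebra_laurentUnit]
    rfl
  exact congrArg Units.val h3

/-- The group algebra of `ℤ^t` by generators and relations. -/
def laurentEquiv : (MvPolynomial (Fin t ⊕ Fin t) A ⧸ laurentIdeal A t) ≃+*
    AddMonoidAlgebra A (Fin t → ℤ) :=
  RingEquiv.ofRingHom toGroupAlgebra ofGroupAlgebra
    (AddMonoidAlgebra.ringHom_ext
      (fun r => by
        rw [RingHom.comp_apply, ofGroupAlgebra_single, map_mul, toGroupAlgebra_C,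
          toGroupAlgebra_laurentMonomial, AddMonoidAlgebra.single_mul_single, zero_add, mul_one]
        rfl)
      (fun w => by
        rw [RingHom.comp_apply, ofGroupAlgebra_single, map_one, map_one, one_mul,
          toGroupAlgebra_laurentMonomial]
        rfl))
    (by
      refine Ideal.Quotient.ringHom_ext (MvPolynomial.ringHom_ext (fun r => ?_) fun j => ?_)
      · change ofGroupAlgebra (toGroupAlgebra (Ideal.Quotient.mk _ (MvPolynomial.C r))) = _
        rw [toGroupAlgebra_C, ofGroupAlgebra_single, ofAdd_zero, map_one, Units.val_one, mul_one]
        rfl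
      · change ofGroupAlgebra (toGroupAlgebra (Ideal.Quotient.mk _ (MvPolynomial.X j))) =
          laurentX j
        rw [toGroupAlgebra_X, map_sub, map_one, ofGroupAlgebra_single, map_one, map_one, one_mul]
        cases j with
        | inl i =>
          simp only [laurentExponent, Sum.elim_inl, laurentMonomial_single]
          exact add_sub_cancel_left _ _
        | inr i =>
          simp only [laurentExponent, Sum.elim_inr, ofAdd_neg, map_inv, laurentMonomial_single]
          exact add_sub_cancel_left _ _)

end LaurentPresentation

end EquivariantKTheory

end

theorem mainTheorem7 {S : Scheme.{u}} (t : ℕ)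
    (T : Over S) [GrpObj T] (e : Splitting T t)
    (X : Over S) [CompactSpace X.left] (a : ModObj T X) (ha : IsTrivialAction a) :
    ∃ Φ : (MvPolynomial (Fin t ⊕ Fin t) (K0 X.left) ⧸
          Ideal.span (Set.range fun i : Fin t =>
            (MvPolynomial.X (Sum.inl i) * MvPolynomial.X (Sum.inr i) +
                MvPolynomial.X (Sum.inl i) + MvPolynomial.X (Sum.inr i) :
              MvPolynomial (Fin t ⊕ Fin t) (K0 X.left)))) ≃+*
        EquivariantK0 a,
      (∀ E : VectorBundle X.left,
        Φ (Ideal.Quotient.mk _ (MvPolynomial.C (K0.mk E))) =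
          EquivariantK0.mk (e.inWeight ha E 0)) ∧
      (∀ i : Fin t,
        Φ (Ideal.Quotient.mk _ (MvPolynomial.X (Sum.inl i))) =
          EquivariantK0.mk
            (e.inWeight ha (VectorBundle.trivialLine X.left) (Pi.single i 1)) - 1) ∧
      (∀ i : Fin t,
        Φ (Ideal.Quotient.mk _ (MvPolynomial.X (Sum.inr i))) =
          EquivariantK0.mk
            (e.inWeight ha (VectorBundle.trivialLine X.left) (-Pi.single i 1)) - 1) := by
  refine ⟨laurentEquiv.trans (e.groupAlgebraEquiv ha), fun E => ?_, fun i => ?_, fun i => ?_⟩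
  · change e.groupAlgebraEquiv ha (toGroupAlgebra (Ideal.Quotient.mk _ (MvPolynomial.C _))) = _
    rw [toGroupAlgebra_C, e.groupAlgebraEquiv_single ha]
  · change e.groupAlgebraEquiv ha (toGroupAlgebra (Ideal.Quotient.mk _ (MvPolynomial.X _))) = _
    -- The coefficient 1 of the monomial is written as the class of 𝒪_X, so that the monomial maps
    -- to the class of 𝒪_X in the corresponding weight.
    rw [toGroupAlgebra_X, map_sub, map_one, ← K0.mk_unit (E := VectorBundle.trivialLine X.left) ⟨Iso.refl _⟩,
      e.groupAlgebraEquiv_single ha]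
    rfl
  · change e.groupAlgebraEquiv ha (toGroupAlgebra (Ideal.Quotient.mk _ (MvPolynomial.X _))) = _
    rw [toGroupAlgebra_X, map_sub, map_one, ← K0.mk_unit (E := VectorBundle.trivialLine X.left) ⟨Iso.refl _⟩,
      e.groupAlgebraEquiv_single ha]
    rfl
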